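/- Let $G$ be a simply connected real Lie group, $H\subset G$ a closed connected subgroup, $M=G/H$ with its smooth structure as a homogeneous space (the one for which $\pi:G\to M$ is a submersion), and let $\mathfrak g,\mathfrak h$ be the Lie algebras of $G$ and $H$. Let $\mathfrak m\subset\mathfrak g$ be a subspace with $\mathfrak g=\mathfrak h\oplus\mathfrak m$, $[\mathfrak h,\mathfrak m]\subset\mathfrak m$ and $[\mathfrak m,\mathfrak m]\subset\mathfrak h$, and let $\omega_0$ be an $\operatorname{ad}(\mathfrak h)$-invariant non-degenerate skew-symmetric bilinear form on $\mathfrak m$. Let $\omega$ be the $G$-invariant $2$-form on $M$ which satisfies $\omega(\mathrm d\pi\,\mathrm dL_gX,\mathrm d\pi\,\mathrm dL_gY)=\omega_0(X,Y)$ for $g\in G$, $X,Y\in\mathfrak m$; then $(M,\omega)$ is a simply connected symplectic symmetric space. Let $R$ be the symplectic frame bundle of $(M,\omega)$, a symplectic frame at $x\in M$ being a linear isomorphism $\mathfrak m\to T_xM$ which carries $\omega_0$ to $\omega_x$; the group $\mathrm{Sp}(\mathfrak m)$ of $(\mathfrak m,\omega_0)$ acts on $R$ from the right by composition. For $g\in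 G$ and $A\in\mathrm{Sp}(\mathfrak m)$ write $[g,A]\in R$ for the frame $X\mapsto\mathrm d\pi\,\mathrm dL_g(AX)$ at $gH$. Let $\kappa:H\to\mathrm{Sp}(\mathfrak m)$, $\kappa(h)=\operatorname{Ad}(h)|_{\mathfrak m}$, be the isotropy representation, and let $\rho:\mathrm{Mp}(\mathfrak m)\to\mathrm{Sp}(\mathfrak m)$ be a connected double covering group of $\mathrm{Sp}(\mathfrak m)$ (so that $\mathfrak m\neq 0$). A lift of $\kappa$ is a continuous homomorphism $\tilde\kappa:H\to\mathrm{Mp}(\mathfrak m)$ with $\rho\circ\tilde\kappa=\kappa$. A metaplectic structure of $(M,\omega)$ is a pair $(P,F_P)$ of a smooth principal $\mathrm{Mp}(\mathfrak m)$-bundle $P$ over $M$ and a smooth map $F_P:P\to R$ over $\mathrm{id}_M$ with $F_P(pq)=F_P(p)\rho(q)$ for $p\in P$, $q\in\mathrm{Mp}(\mathfrak m)$. An isomorphism $(P,F_P)\to(P',F_{P'})$ is an isomorphism $\Phi:P\to P'$ of principal $\mathrm{Mp}(\mathfrak m)$-bundles over $\mathrm{id}_M$ with $F_{P'}\circ\Phi=F_P$.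 Theorem. For every lift $\tilde\kappa$ of $\kappa$, the associated bundle $P=G\times_{\tilde\kappa}\mathrm{Mp}(\mathfrak m)$ (the quotient of $G\times\mathrm{Mp}(\mathfrak m)$ by $(g,q)\sim(gh,\tilde\kappa(h)^{-1}q)$, $h\in H$, with the smooth structure for which the quotient map is a submersion), with the projection $[g,q]\mapsto gH$ and the action $[g,q]q'=[g,qq']$, together with $F_P([g,q])=[g,\rho(q)]$, is a metaplectic structure of $(M,\omega)$; and the mapping $\tilde\kappa\mapsto(P,F_P)$ induces a bijection from the set of lifts of $\kappa$ onto the set of isomorphism classes of metaplectic structures of $(M,\omega)$. -/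

import Mathlib

open scoped Manifold ContDiff

noncomputable section

namespace MetaplecticSymmetric

universe u v

section HomogeneousSpace

variable {d k : ℕ} {G : Type u} [TopologicalSpace G] [ChartedSpace (EuclideanSpace ℝ (Fin d)) G]
  [Group G]

/-- The Lie algebra of the `d`-dimensional Lie group `G` (the tangent space at the unit, with the
bracket of left-invariant vector fields). -/
abbrev LieAlg (d : ℕ) (G : Type u) [TopologicalSpace G]
    [ChartedSpace (EuclideanSpace ℝ (Fin d)) G] [Group G] : Type :=
  GroupLieAlgebra (𝓡 d) G

/-- A vector of the Lie algebra as an element of the model vector space `ℝ^d`. -/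
def toModel {d : ℕ} {G : Type u} [TopologicalSpace G]
    [ChartedSpace (EuclideanSpace ℝ (Fin d)) G] [Group G] (X : LieAlg d G) :
    EuclideanSpace ℝ (Fin d) := X

/-- The Lie algebra of a closed subgroup `H` of `G`: its tangent space at the unit, i.e. the
velocities at time `0` of the smooth curves of `G` which run in `H` and start at `1`. (These
velocities already form a subspace, since curves in `H` can be multiplied and rescaled.) -/
def lieSubspace (d : ℕ) {G : Type u} [TopologicalSpace G]
    [ChartedSpace (EuclideanSpace ℝ (Fin d)) G] [Group G] (H : Subgroup G) :
    Submodule ℝ (LieAlg d G) :=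
  Submodule.span ℝ {X | ∃ γ : ℝ → G, ContMDiff 𝓘(ℝ, ℝ) (𝓡 d) ∞ γ ∧ (∀ t, γ t ∈ H) ∧ γ 0 = 1 ∧
    (mfderiv 𝓘(ℝ, ℝ) (𝓡 d) γ 0 (1 : ℝ) : EuclideanSpace ℝ (Fin d)) = X}

/-- The adjoint representation of `G` : the differential at `1` of `x ↦ g x g⁻¹`. -/
def adjoint (g : G) (X : LieAlg d G) : LieAlg d G :=
  (mfderiv (𝓡 d) (𝓡 d) (fun x : G => g * x * g⁻¹) 1 X : EuclideanSpace ℝ (Fin d))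

/-- The algebraic data of a symplectic symmetric space: `H` is a closed connected subgroup of `G`,
`𝔤 = 𝔥 ⊕ 𝔪`, `[𝔥, 𝔪] ⊆ 𝔪`, `[𝔪, 𝔪] ⊆ 𝔥`, and `ω₀` is an `ad(𝔥)`-invariant nondegenerate skew form
on `𝔪`. -/
structure IsSymplecticSymmetric (H : Subgroup G) (m : Submodule ℝ (LieAlg d G))
    (ω₀ : LinearMap.BilinForm ℝ m) : Prop where
  isClosed : IsClosed (H : Set G)
  isConnected : IsConnected (H : Set G)
  isCompl : IsCompl (lieSubspace d H) m
  lie_h_m : ∀ Z ∈ lieSubspace d H, ∀ X ∈ m, ⁅Z, X⁆ ∈ m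
  lie_m_m : ∀ X ∈ m, ∀ Y ∈ m, ⁅X, Y⁆ ∈ lieSubspace d H
  alt : ω₀.IsAlt
  nondegenerate : ω₀.Nondegenerate
  invariant : ∀ (Z : LieAlg d G) (hZ : Z ∈ lieSubspace d H) (X Y : m),
    ω₀ ⟨⁅Z, (X : LieAlg d G)⁆, lie_h_m Z hZ X X.2⟩ Y
      + ω₀ X ⟨⁅Z, (Y : LieAlg d G)⁆, lie_h_m Z hZ Y Y.2⟩ = 0

/-- The symplectic group `Sp(𝔪)` of `(𝔪, ω₀)`, with the topology of the operators of `𝔪`. -/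
def Sp {m : Submodule ℝ (LieAlg d G)} (ω₀ : LinearMap.BilinForm ℝ m) :
    Subgroup (m →L[ℝ] m)ˣ where
  carrier := {A | ∀ X Y : m, ω₀ (A.1 X) (A.1 Y) = ω₀ X Y}
  mul_mem' := by
    intro A B hA hB X Y
    simpa using (hA (B.1 X) (B.1 Y)).trans (hB X Y)
  one_mem' := by
    intro X Y
    simp
  inv_mem' := by
    intro A hA X Y
    have h : ∀ Z : m, A.1 ((A⁻¹).1 Z) = Z := fun Z => by
      exact congrArg (fun B : m →L[ℝ] m => B Z) A.mul_inv
    have := hA ((A⁻¹).1 X) ((A⁻¹).1 Y)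
    rw [h, h] at this
    exact this.symm

variable {H : Subgroup G} [ChartedSpace (EuclideanSpace ℝ (Fin k)) (G ⧸ H)]

/-- For `π : G → G / H`, the map `X ↦ dπ (dL_g X)` from `𝔪` to the tangent space of `G / H` at
`gH`. -/
def translate (k : ℕ) {d : ℕ} {G : Type u} [TopologicalSpace G]
    [ChartedSpace (EuclideanSpace ℝ (Fin d)) G] [Group G] (H : Subgroup G)
    [ChartedSpace (EuclideanSpace ℝ (Fin k)) (G ⧸ H)] (m : Submodule ℝ (LieAlg d G)) (g : G) :
    m →L[ℝ] TangentSpace (𝓡 k) (QuotientGroup.mk g : G ⧸ H) :=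
  ((mfderiv (𝓡 d) (𝓡 k) (QuotientGroup.mk : G → G ⧸ H) g).comp
    (mfderiv (𝓡 d) (𝓡 d) (fun x : G => g * x) 1)).comp m.subtypeL

/-- The `G`-invariant 2-form `ω` on `M = G / H` induced by `ω₀` : at `x = gH` it is the form
corresponding to `ω₀` under the isomorphism `X ↦ dπ (dL_g X)` from `𝔪` to the tangent space. By the
invariance of `ω₀` it does not depend on the representative `g` of `x`. -/
def omega (k : ℕ) {d : ℕ} {G : Type u} [TopologicalSpace G]
    [ChartedSpace (EuclideanSpace ℝ (Fin d)) G] [Group G] {H : Subgroup G}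
    [ChartedSpace (EuclideanSpace ℝ (Fin k)) (G ⧸ H)] {m : Submodule ℝ (LieAlg d G)}
    (ω₀ : LinearMap.BilinForm ℝ m) (x : G ⧸ H) (v w : TangentSpace (𝓡 k) x) : ℝ :=
  ω₀ ((translate k H m x.out).inverse (v : EuclideanSpace ℝ (Fin k)))
    ((translate k H m x.out).inverse (w : EuclideanSpace ℝ (Fin k)))

/-- The symplectic frame bundle `R` of `(M, ω)`, `M = G / H`. A symplectic frame at `x` is a linear
isomorphism from the model space `(𝔪, ω₀)` to the tangent space at `x` which carries `ω₀` to `ω`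
(equivalently, the image under it of a fixed symplectic basis of `𝔪`). -/
structure SymplecticFrame (k : ℕ) {d : ℕ} {G : Type u} [TopologicalSpace G]
    [ChartedSpace (EuclideanSpace ℝ (Fin d)) G] [Group G] (H : Subgroup G)
    [ChartedSpace (EuclideanSpace ℝ (Fin k)) (G ⧸ H)] {m : Submodule ℝ (LieAlg d G)}
    (ω₀ : LinearMap.BilinForm ℝ m) where
  base : G ⧸ H
  toLin : m ≃L[ℝ] TangentSpace (𝓡 k) base
  symplectic : ∀ X Y : m, omega k ω₀ base (toLin X) (toLin Y) = ω₀ X Y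

/-- The vector `f(X)` of the frame `f`, as a point of the tangent bundle of `M`. -/
def SymplecticFrame.vec {m : Submodule ℝ (LieAlg d G)} {ω₀ : LinearMap.BilinForm ℝ m}
    (f : SymplecticFrame k H ω₀) (X : m) : TangentBundle (𝓡 k) (G ⧸ H) :=
  ⟨f.base, f.toLin X⟩

/-- The right action of `Sp(𝔪)` on symplectic frames, `f · A = f ∘ A`. -/
def SymplecticFrame.act {m : Submodule ℝ (LieAlg d G)} {ω₀ : LinearMap.BilinForm ℝ m}
    (f : SymplecticFrame k H ω₀) (A : Sp ω₀) : SymplecticFrame k H ω₀ where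
  base := f.base
  toLin := (ContinuousLinearEquiv.unitsEquiv ℝ m A.1).trans f.toLin
  symplectic := by
    intro X Y
    exact (f.symplectic (A.1.1 X) (A.1.1 Y)).trans (A.2 X Y)

end HomogeneousSpace

section PrincipalBundles

/-- A smooth principal `K`-bundle over `M`, where `M` and the Lie group `K` are smooth manifolds of
dimension `k` and `l`. -/
structure SmoothPrincipalBundle (k l : ℕ) (M : Type u) [TopologicalSpace M]
    [ChartedSpace (EuclideanSpace ℝ (Fin k)) M] (K : Type v) [TopologicalSpace K]
    [ChartedSpace (EuclideanSpace ℝ (Fin l)) K] [Group K] where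
  carrier : Type (max u v)
  [top : TopologicalSpace carrier]
  [charted : ChartedSpace (EuclideanSpace ℝ (Fin k) × EuclideanSpace ℝ (Fin l)) carrier]
  [isManifold :
    IsManifold 𝓘(ℝ, EuclideanSpace ℝ (Fin k) × EuclideanSpace ℝ (Fin l)) ∞ carrier]
  proj : carrier → M
  /-- the right action of the structure group -/
  act : carrier → K → carrier
  act_one : ∀ p, act p 1 = p
  act_mul : ∀ p a b, act p (a * b) = act (act p a) b
  /-- smooth equivariant local trivializations `P|_U ≅ U × K` -/
  locally_trivial : ∀ x : M, ∃ (U : Set M) (Φ : OpenPartialHomeomorph carrier (M × K)),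
    IsOpen U ∧ x ∈ U ∧ Φ.source = proj ⁻¹' U ∧ Φ.target = U ×ˢ Set.univ ∧
    ContMDiffOn 𝓘(ℝ, EuclideanSpace ℝ (Fin k) × EuclideanSpace ℝ (Fin l)) ((𝓡 k).prod (𝓡 l)) ∞
      Φ Φ.source ∧
    ContMDiffOn ((𝓡 k).prod (𝓡 l)) 𝓘(ℝ, EuclideanSpace ℝ (Fin k) × EuclideanSpace ℝ (Fin l)) ∞
      Φ.symm Φ.target ∧
    ∀ p, proj p ∈ U → (Φ p).1 = proj p ∧
      ∀ a, proj (act p a) = proj p ∧ Φ (act p a) = ((Φ p).1, (Φ p).2 * a)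

attribute [instance] SmoothPrincipalBundle.top SmoothPrincipalBundle.charted
  SmoothPrincipalBundle.isManifold

end PrincipalBundles

section Metaplectic

variable {d k l : ℕ} {G : Type u} [TopologicalSpace G]
  [ChartedSpace (EuclideanSpace ℝ (Fin d)) G] [Group G] {H : Subgroup G}
  [ChartedSpace (EuclideanSpace ℝ (Fin k)) (G ⧸ H)]
  {m : Submodule ℝ (LieAlg d G)} {ω₀ : LinearMap.BilinForm ℝ m}
  {Mp : Type v} [TopologicalSpace Mp] [ChartedSpace (EuclideanSpace ℝ (Fin l)) Mp] [Group Mp]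

/-- `ρ : Mp → Sp(𝔪)` makes `Mp` the connected double covering group of `Sp(𝔪)` : `Mp` is connected
and `ρ` is a two-sheeted covering and a smooth homomorphism (smoothness of `q ↦ ρ(q)` being that of
`q ↦ ρ(q) X` for every `X ∈ 𝔪`, as `𝔪` has finite dimension). -/
structure IsConnectedDoubleCover (l : ℕ) {d : ℕ} {G : Type u} [TopologicalSpace G]
    [ChartedSpace (EuclideanSpace ℝ (Fin d)) G] [Group G]
    {m : Submodule ℝ (LieAlg d G)} {ω₀ : LinearMap.BilinForm ℝ m}
    {Mp : Type v} [TopologicalSpace Mp] [ChartedSpace (EuclideanSpace ℝ (Fin l)) Mp] [Group Mp]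
    (ρ : Mp →* Sp ω₀) : Prop where
  connected : ConnectedSpace Mp
  smooth : ∀ X : m, ContMDiff (𝓡 l) 𝓘(ℝ, EuclideanSpace ℝ (Fin d)) ∞
    (fun q : Mp => toModel (d := d) (G := G) ((ρ q).1.1 X : m))
  covering : IsCoveringMap ρ
  two_sheeted : ∀ A, (ρ ⁻¹' {A}).ncard = 2

/-- The lifts `κ̃ : H → Mp(𝔪)` of the isotropy representation `κ : H → Sp(𝔪)`,
`κ(h) = Ad(h)|_𝔪`, i.e. the (continuous) homomorphisms `κ̃` with `ρ ∘ κ̃ = κ`. -/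
structure IsotropyLift (H : Subgroup G) (ρ : Mp →* Sp ω₀) where
  hom : H →ₜ* Mp
  lifts : ∀ (h : H) (X : m), (((ρ (hom h)).1.1 X : m) : LieAlg d G) = adjoint (h : G) X

/-- A metaplectic structure `(P, F_P)` of `(M, ω)`, `M = G / H` : a smooth principal `Mp(𝔪)`-bundle
`P` over `M` with a smooth map `F_P` from `P` to the symplectic frame bundle over the identity of
`M` such that `F_P(p q) = F_P(p) ρ(q)`. A map to the frame bundle is smooth if and only if the
vectors of the frame, as points of the tangent bundle, depend smoothly on the argument. -/
structure MetaplecticStructure [IsManifold (𝓡 k) ∞ (G ⧸ H)] (ρ : Mp →* Sp ω₀) extends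
    SmoothPrincipalBundle k l (G ⧸ H) Mp where
  frame : carrier → SymplecticFrame k H ω₀
  frame_base : ∀ p, (frame p).base = proj p
  frame_smooth : ∀ X : m,
    ContMDiff 𝓘(ℝ, EuclideanSpace ℝ (Fin k) × EuclideanSpace ℝ (Fin l)) (𝓡 k).tangent ∞
      (fun p => (frame p).vec X)
  frame_act : ∀ p q, frame (act p q) = (frame p).act (ρ q)

namespace MetaplecticStructure

variable [IsManifold (𝓡 k) ∞ (G ⧸ H)] {ρ : Mp →* Sp ω₀}

/-- Two metaplectic structures are isomorphic if there is an isomorphism of principal bundles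
between them which is compatible with the maps to the frame bundle. -/
def Isomorphic (S T : MetaplecticStructure (k := k) (l := l) (H := H) ρ) : Prop :=
  ∃ φ : Diffeomorph 𝓘(ℝ, EuclideanSpace ℝ (Fin k) × EuclideanSpace ℝ (Fin l))
      𝓘(ℝ, EuclideanSpace ℝ (Fin k) × EuclideanSpace ℝ (Fin l)) S.carrier T.carrier ∞,
    (∀ p, T.proj (φ p) = S.proj p) ∧ (∀ p q, φ (S.act p q) = T.act (φ p) q) ∧
    ∀ p, T.frame (φ p) = S.frame p

/-- Isomorphism of metaplectic structures is an equivalence relation. -/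
instance isoSetoid (ρ : Mp →* Sp ω₀) :
    Setoid (MetaplecticStructure (k := k) (l := l) (H := H) ρ) where
  r := Isomorphic
  iseqv :=
    { refl := fun S => ⟨Diffeomorph.refl _ _ _, fun _ => rfl, fun _ _ => rfl, fun _ => rfl⟩
      symm := by
        rintro S T ⟨φ, h1, h2, h3⟩
        refine ⟨φ.symm, fun p => ?_, fun p q => ?_, fun p => ?_⟩
        · rw [← h1, φ.apply_symm_apply]
        · apply φ.injective
          change φ _ = φ _
          rw [h2, φ.apply_symm_apply, φ.apply_symm_apply]
        · rw [← h3, φ.apply_symm_apply]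
      trans := by
        rintro S T W ⟨φ, h1, h2, h3⟩ ⟨ψ, g1, g2, g3⟩
        refine ⟨φ.trans ψ, fun p => ?_, fun p q => ?_, fun p => ?_⟩
        · exact (g1 _).trans (h1 _)
        · exact (congrArg ψ (h2 p q)).trans (g2 _ _)
        · exact (g3 _).trans (h3 _) }

/-- The isomorphism classes of metaplectic structures of `(M, ω)`. -/
abbrev IsoClass (H : Subgroup G) [ChartedSpace (EuclideanSpace ℝ (Fin k)) (G ⧸ H)]
    [IsManifold (𝓡 k) ∞ (G ⧸ H)] (ρ : Mp →* Sp ω₀) : Type _ :=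
  Quotient (isoSetoid (k := k) (l := l) (H := H) ρ)

end MetaplecticStructure

/-- The equivalence relation `(g, q) ∼ (g h, κ̃(h)⁻¹ q)`, `h ∈ H`, on `G × Mp(𝔪)`. -/
def IsotropyLift.setoid {ρ : Mp →* Sp ω₀} (κ' : IsotropyLift H ρ) : Setoid (G × Mp) where
  r a b := ∃ h : H, b = (a.1 * h, (κ'.hom h)⁻¹ * a.2)
  iseqv :=
    { refl := fun a => ⟨1, by simp⟩
      symm := by
        rintro a b ⟨h, rfl⟩
        exact ⟨h⁻¹, by simp⟩
      trans := by
        rintro a b c ⟨h, rfl⟩ ⟨h', rfl⟩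
        exact ⟨h * h', by simp [mul_assoc]⟩ }

/-- The associated bundle `G ×_κ̃ Mp(𝔪)`, with the quotient topology. -/
def IsotropyLift.AssocBundle {ρ : Mp →* Sp ω₀} (κ' : IsotropyLift H ρ) : Type (max u v) :=
  Quotient κ'.setoid

instance {ρ : Mp →* Sp ω₀} (κ' : IsotropyLift H ρ) : TopologicalSpace κ'.AssocBundle :=
  inferInstanceAs (TopologicalSpace (Quotient κ'.setoid))

/-- The class `[g, q]` in `G ×_κ̃ Mp(𝔪)`. -/
def IsotropyLift.cls {ρ : Mp →* Sp ω₀} (κ' : IsotropyLift H ρ) (a : G × Mp) : κ'.AssocBundle :=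
  Quotient.mk κ'.setoid a

/-- `S` is the metaplectic structure `(P, F_P)` constructed from the lift `κ̃` : its total space is
`P = G ×_κ̃ Mp(𝔪)` (by means of the homeomorphism `e`), with the smooth structure for which
`G × Mp(𝔪) → P` is a submersion, with projection `[g, q] ↦ gH`, with action
`[g, q] · q' = [g, q q']`, and with `F_P([g, q]) = [g, ρ(q)]`, where `[g, A]` is the frame
`X ↦ dπ (dL_g (A X))`. -/
def IsotropyLift.Constructs [IsManifold (𝓡 k) ∞ (G ⧸ H)] {ρ : Mp →* Sp ω₀}
    (κ' : IsotropyLift H ρ) (S : MetaplecticStructure (k := k) (l := l) (H := H) ρ) : Prop :=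
  ∃ e : κ'.AssocBundle ≃ₜ S.carrier,
    Manifold.IsSubmersion ((𝓡 d).prod (𝓡 l))
      𝓘(ℝ, EuclideanSpace ℝ (Fin k) × EuclideanSpace ℝ (Fin l)) ∞
      (fun a : G × Mp => e (κ'.cls a)) ∧
    (∀ g q, S.proj (e (κ'.cls (g, q))) = QuotientGroup.mk g) ∧
    (∀ g q q', S.act (e (κ'.cls (g, q))) q' = e (κ'.cls (g, q * q'))) ∧
    ∀ g q (X : m), (S.frame (e (κ'.cls (g, q)))).vec X =
      ⟨QuotientGroup.mk g, translate k H m g ((ρ q).1.1 X)⟩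

end Metaplectic

end MetaplecticSymmetric

end

/-! The map `g ↦ [g, 1]` from `G` to the frame bundle `R` covers `π : G → M`, and `[gh, 1] = [g, 1]
κ(h)` for `h ∈ H`. Let `(T, F)` be a metaplectic structure. The pairs `(g, p)` with `F(p) = [g, 1]`
form a covering of `G`, being locally the pullback of `ρ : Mp → Sp` (`isCoveringMap_frameLift`). As
`G` is simply connected, this covering has a continuous section, that is, a map `τ : G → T` with
`F(τ(g)) = [g, 1]` (`exists_lift_translateFrame`).

The points `τ(1)` and `τ(h)` lie in one fibre, so `τ(h) = τ(1) κ̃(h)` defines `κ̃` on `H`. For fixed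
`h`, both `g ↦ τ(gh)` and `g ↦ τ(g) κ̃(h)` lift `g ↦ [gh, 1]` and they agree at `1`, hence
everywhere. It follows that `κ̃` is a homomorphism; it is continuous and lifts `κ`
(`exists_isotropyLift`). Then `[g, q] ↦ τ(g) q` is an isomorphism from the structure built from `κ̃`
onto `(T, F)`, which is surjectivity (`Constructs.isomorphic`). Injectivity is uniqueness of lifts:
`H` is connected, so two lifts of `κ`, which agree at `1`, are equal. In particular both sets in the
bijection have at most one element.

The remaining work makes these objects exist and be smooth. Invariance is assumed only
infinitesimally, so one needs that `Ad(H)` preserves `𝔪` and `ω₀`. The derivative of `Ad` is the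
bracket (`mfderiv_adjointOp`), so along a curve in `H` the operators `Ad` solve a linear equation
whose coefficients lie in `ad(𝔥)`; such curves fill a neighbourhood of `1` in `H`, and connectedness
gives all of `H` (`le_isotropyStabilizer`). Smoothness of maps into `Mp` is read off after `ρ`,
because a locally injective smooth representation is an immersion (`contMDiffAt_of_representation`).
The manifold `G ×_κ̃ Mp` is glued from trivializations over local sections of `π`, which exist since
`π` is a submersion (`exists_constructs`). -/

namespace MetaplecticSymmetric

open Filter Function Set Topology

/-! ### Smoothness of operator-valued maps -/

section FiniteDimensional

variable {E N H' : Type*} [NormedAddCommGroup E] [NormedSpace ℝ E] [TopologicalSpace H']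
  {I : ModelWithCorners ℝ E H'} [TopologicalSpace N] [ChartedSpace H' N]
  {V F : Type*} [NormedAddCommGroup V] [NormedSpace ℝ V] [FiniteDimensional ℝ V]
  [NormedAddCommGroup F] [NormedSpace ℝ F]

/-- Expansion in a basis `b` writes `f y` as the sum of the rank-one operators `v ↦ bᵢ*(v) f y
(bᵢ)`, each of which depends on `y` through a continuous linear map of `f y (bᵢ)`. -/
theorem contMDiffAt_clm_of_apply {n : WithTop ℕ∞} {f : N → V →L[ℝ] F} {x : N}
    (hf : ∀ v, ContMDiffAt I 𝓘(ℝ, F) n (fun y => f y v) x) :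
    ContMDiffAt I 𝓘(ℝ, V →L[ℝ] F) n f x := by
  let b := Module.finBasis ℝ V
  have key : f = fun y => ∑ i, ContinuousLinearMap.smulRightL ℝ V F
      (LinearMap.toContinuousLinearMap (b.coord i)) (f y (b i)) := by
    funext y
    ext v
    have h := congrArg (f y) (b.sum_repr v)
    rw [map_sum] at h
    simp only [map_smul] at h
    simp [← h, sum_apply]
  rw [key]
  refine ContMDiffAt.sum fun i _ => ?_
  exact (ContinuousLinearMap.contMDiff _).contMDiffAt.comp x (hf (b i))

end FiniteDimensional

theorem mfderiv_eq_fderiv_chart {d : ℕ} {N F : Type*} [TopologicalSpace N]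
    [ChartedSpace (EuclideanSpace ℝ (Fin d)) N] [NormedAddCommGroup F] [NormedSpace ℝ F]
    {f : N → F} {x : N} (hf : MDifferentiableAt (𝓡 d) 𝓘(ℝ, F) f x) :
    (mfderiv (𝓡 d) 𝓘(ℝ, F) f x : EuclideanSpace ℝ (Fin d) →L[ℝ] F)
      = fderiv ℝ (f ∘ (extChartAt (𝓡 d) x).symm) (extChartAt (𝓡 d) x x) := by
  simp [mfderiv, hf, writtenInExtChartAt]
  rfl

/-! ### Maps into a Lie group are smooth when a locally injective representation of them is -/

section Representation

variable {l : ℕ} {K : Type*} [TopologicalSpace K] [ChartedSpace (EuclideanSpace ℝ (Fin l)) K]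
  [Group K] [LieGroup (𝓡 l) ∞ K]
  {W : Type*} [NormedRing W] [NormedAlgebra ℝ W]

theorem lieGroup_three : LieGroup (𝓡 l) (minSmoothness ℝ 3) K := by
  rw [minSmoothness_of_isRCLikeNormedField]
  exact LieGroup.of_le (n := ∞) (WithTop.coe_le_coe.mpr le_top)

theorem hasDerivAt_comp_curve {E H' N F : Type*} [NormedAddCommGroup E] [NormedSpace ℝ E]
    [TopologicalSpace H'] {I : ModelWithCorners ℝ E H'} [TopologicalSpace N] [ChartedSpace H' N]
    [NormedAddCommGroup F] [NormedSpace ℝ F] {f : N → F} {γ : ℝ → N} {t : ℝ}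
    {v : TangentSpace I (γ t)} (hf : MDifferentiableAt I 𝓘(ℝ, F) f (γ t))
    (hγ : HasMFDerivAt 𝓘(ℝ, ℝ) I γ t ((1 : ℝ →L[ℝ] ℝ).smulRight v)) :
    HasDerivAt (f ∘ γ) (mfderiv I 𝓘(ℝ, F) f (γ t) v : F) t := by
  let D : E →L[ℝ] F := mfderiv I 𝓘(ℝ, F) f (γ t)
  let w : E := v
  have h : HasFDerivAt (f ∘ γ) (D.comp ((1 : ℝ →L[ℝ] ℝ).smulRight w)) t :=
    (hf.hasMFDerivAt.comp t hγ).hasFDerivAt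
  have h2 : HasDerivAt (f ∘ γ) (D ((1 : ℝ) • w)) t := h.hasDerivAt
  rw [one_smul] at h2
  exact h2

/-- The base point is a variable with `g = 1` as a hypothesis, since it will be `γ 0` for an
integral curve `γ`, which equals `1` only propositionally. -/
theorem mulInvariantVectorField_one {g : K} (hg : g = 1) (v : GroupLieAlgebra (𝓡 l) K)
    (h : mulInvariantVectorField v g = 0) : v = 0 := by
  subst hg
  rw [mulInvariantVectorField] at h
  have e : (fun x : K => 1 * x) = id := funext one_mul
  rw [e, mfderiv_id] at h
  exact h

/-- If `dJ` kills `v` at `1`, it kills the left-invariant field of `v` everywhere, so `J` is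
constant along the integral curve through `1`. Local injectivity then makes that curve constant near
time `0`, and its velocity `v` vanishes. -/
theorem mfderiv_injective_of_locally_injective {J : K →* W}
    (hJ : ContMDiff (𝓡 l) 𝓘(ℝ, W) ∞ J) (hloc : ∀ᶠ q in 𝓝 (1 : K), J q = 1 → q = 1) :
    Injective (mfderiv (𝓡 l) 𝓘(ℝ, W) J 1) := by
  have : LieGroup (𝓡 l) (minSmoothness ℝ 3) K := lieGroup_three
  have : LieGroup (𝓡 l) 1 K := LieGroup.of_le (n := ∞) (by exact_mod_cast le_top)
  have hJd : MDifferentiable (𝓡 l) 𝓘(ℝ, W) J := hJ.mdifferentiable (by simp)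
  rw [injective_iff_map_eq_zero]
  intro v hv
  have hsm : ContMDiffAt (𝓡 l) (𝓡 l).tangent 1
      (fun g : K => (⟨g, mulInvariantVectorField v g⟩ : TangentBundle (𝓡 l) K)) 1 :=
    (contMDiff_mulInvariantVectorField v).contMDiffAt.of_le (by
      rw [minSmoothness_of_isRCLikeNormedField]; exact one_le_two)
  obtain ⟨γ, hγ0, hγ⟩ := exists_isMIntegralCurveAt_of_contMDiffAt_boundaryless 0 hsm
  have hderiv : ∀ᶠ t in 𝓝 (0 : ℝ), HasDerivAt (J ∘ γ) 0 t := by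
    filter_upwards [hγ] with t ht
    have h1 := hasDerivAt_comp_curve (hJd (γ t)) ht
    have h2 : mfderiv (𝓡 l) 𝓘(ℝ, W) J (γ t) (mulInvariantVectorField v (γ t)) = 0 := by
      -- `J` intertwines left translation by `γ t` with multiplication by `J (γ t)`, which carries
      -- the vanishing of `dJ v` from `1` to `γ t`.
      have e : J ∘ (fun x => γ t * x) = fun x => J (γ t) * J x := by
        funext x; simp
      have hl : MDifferentiableAt (𝓡 l) (𝓡 l) (fun x : K => γ t * x) 1 :=
        (contMDiff_mul_left (I := 𝓡 l) (n := ∞)).mdifferentiable (by simp) 1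
      have h3 := mfderiv_comp_apply_of_eq (x := (1 : K)) (hJd (γ t)) hl (mul_one _) v
      rw [e] at h3
      have h4 : mfderiv (𝓡 l) 𝓘(ℝ, W) (fun x => J (γ t) * J x) 1 v = 0 := by
        have hm : HasMFDerivAt 𝓘(ℝ, W) 𝓘(ℝ, W) (fun w : W => J (γ t) * w) (J 1)
            (ContinuousLinearMap.mul ℝ W (J (γ t))) :=
          (ContinuousLinearMap.mul ℝ W (J (γ t))).hasFDerivAt.hasMFDerivAt
        have h5 := (hm.comp 1 (hJd 1).hasMFDerivAt).mfderiv
        have h6 := congrArg (fun T => T v) h5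
        refine Eq.trans h6 ?_
        change ContinuousLinearMap.mul ℝ W (J (γ t)) (mfderiv (𝓡 l) 𝓘(ℝ, W) J 1 v) = 0
        rw [hv]
        exact map_zero _
      exact h3.symm.trans h4
    rw [h2] at h1
    exact h1
  have hconst : ∀ᶠ t in 𝓝 (0 : ℝ), J (γ t) = 1 := by
    obtain ⟨ε, hε, hball⟩ := Metric.eventually_nhds_iff_ball.mp hderiv
    filter_upwards [Metric.ball_mem_nhds (0 : ℝ) hε] with t ht
    have h := (convex_ball (0 : ℝ) ε).isPreconnected
    have h2 := Metric.isOpen_ball.is_const_of_deriv_eq_zero h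
      (fun s hs => (hball s hs).differentiableAt.differentiableWithinAt)
      (fun s hs => (hball s hs).deriv) ht (Metric.mem_ball_self hε)
    simpa [hγ0] using h2
  have hγc : ContinuousAt γ 0 := hγ.self_of_nhds.continuousAt
  have hγ1 : γ =ᶠ[𝓝 0] fun _ => (1 : K) := by
    have := hγc.eventually (by rw [hγ0]; exact hloc)
    filter_upwards [hconst, this] with t h1 h2 using h2 h1
  have h1 := hγ.self_of_nhds.mfderiv
  have h2 : mfderiv 𝓘(ℝ, ℝ) (𝓡 l) γ 0 = 0 := by
    rw [hγ1.mfderiv_eq]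
    exact mfderiv_const
  refine mulInvariantVectorField_one hγ0 v ?_
  have h3 := congrArg (fun T => T (1 : ℝ)) (h1.symm.trans h2)
  refine Eq.trans ?_ h3
  change _ = (1 : ℝ) • mulInvariantVectorField v (γ 0)
  rw [one_smul]

/-- In a chart at `1` the derivative of `J` is injective. Composing with a linear left inverse `R`
of it gives a map between spaces of equal dimension with derivative the identity, to which the
inverse function theorem applies. -/
theorem exists_contMDiffAt_leftInverse [FiniteDimensional ℝ W] {J : K →* W}
    (hJ : ContMDiff (𝓡 l) 𝓘(ℝ, W) ∞ J) (hloc : ∀ᶠ q in 𝓝 (1 : K), J q = 1 → q = 1) :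
    ∃ Ψ : W → K, ContMDiffAt 𝓘(ℝ, W) (𝓡 l) ∞ Ψ 1 ∧ ∀ᶠ q in 𝓝 (1 : K), Ψ (J q) = q := by
  have : IsManifold (𝓡 l) ∞ K := LieGroup.toContMDiffMul.toIsManifold
  let ψ := extChartAt (𝓡 l) (1 : K)
  let g : EuclideanSpace ℝ (Fin l) → W := J ∘ ψ.symm
  let a := ψ 1
  have ha : ψ.symm a = 1 := extChartAt_to_inv 1
  have hinj := mfderiv_injective_of_locally_injective hJ hloc
  have hgs : ContDiffAt ℝ ∞ g a := by
    rw [← contMDiffAt_iff_contDiffAt]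
    have h1 : ContMDiffAt 𝓘(ℝ, EuclideanSpace ℝ (Fin l)) (𝓡 l) ∞ ψ.symm a :=
      (contMDiffOn_extChartAt_symm 1).contMDiffAt (extChartAt_target_mem_nhds 1)
    exact hJ.contMDiffAt.comp a h1
  have hfd : (fderiv ℝ g a : EuclideanSpace ℝ (Fin l) →L[ℝ] W) = mfderiv (𝓡 l) 𝓘(ℝ, W) J 1 := by
    exact (mfderiv_eq_fderiv_chart (hJ.mdifferentiable (by simp) 1)).symm
  have hinj' : Injective (fderiv ℝ g a) := by rw [hfd]; exact hinj
  obtain ⟨R, hR⟩ := LinearMap.exists_leftInverse_of_injective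
    (fderiv ℝ g a : EuclideanSpace ℝ (Fin l) →ₗ[ℝ] W) (LinearMap.ker_eq_bot.mpr hinj')
  let R' : W →L[ℝ] EuclideanSpace ℝ (Fin l) := LinearMap.toContinuousLinearMap R
  have hhs : ContDiffAt ℝ ∞ (R' ∘ g) a := R'.contDiff.contDiffAt.comp a hgs
  have hgd : HasFDerivAt g (fderiv ℝ g a) a := (hgs.differentiableAt (by simp)).hasFDerivAt
  have hhd : HasFDerivAt (R' ∘ g)
      ((ContinuousLinearEquiv.refl ℝ (EuclideanSpace ℝ (Fin l)) :
        EuclideanSpace ℝ (Fin l) ≃L[ℝ] EuclideanSpace ℝ (Fin l)) :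
        EuclideanSpace ℝ (Fin l) →L[ℝ] EuclideanSpace ℝ (Fin l)) a := by
    have h1 := R'.hasFDerivAt.comp a hgd
    have e : R'.comp (fderiv ℝ g a) = ContinuousLinearMap.id ℝ (EuclideanSpace ℝ (Fin l)) :=
      ContinuousLinearMap.ext fun v => congrArg (fun T => T v) hR
    rw [e] at h1
    exact h1
  let h' := hhs.localInverse hhd (by simp)
  have hh's : ContDiffAt ℝ ∞ h' ((R' ∘ g) a) := hhs.to_localInverse hhd (by simp)
  have hleft : ∀ᶠ y in 𝓝 a, h' ((R' ∘ g) y) = y :=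
    (hhs.hasStrictFDerivAt' hhd (by simp)).eventually_left_inverse
  have hga : g a = 1 := by simp [g, ha]
  refine ⟨fun w => ψ.symm (h' (R' w)), ?_, ?_⟩
  · have e1 : h' (R' 1) = a := by
      have := hleft.self_of_nhds
      rwa [comp_apply, hga] at this
    have h1 : ContMDiffAt 𝓘(ℝ, EuclideanSpace ℝ (Fin l)) (𝓡 l) ∞ ψ.symm (h' (R' 1)) := by
      rw [e1]
      exact (contMDiffOn_extChartAt_symm 1).contMDiffAt (extChartAt_target_mem_nhds 1)
    have h2 : ContDiffAt ℝ ∞ (fun w => h' (R' w)) 1 := by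
      have : ContDiffAt ℝ ∞ h' (R' 1) := by rw [← hga]; exact hh's
      exact this.comp 1 R'.contDiff.contDiffAt
    exact h1.comp 1 h2.contMDiffAt
  · have h1 : ∀ᶠ q in 𝓝 (1 : K), h' ((R' ∘ g) (ψ q)) = ψ q :=
      (continuousAt_extChartAt (I := 𝓡 l) (1 : K)).eventually hleft
    filter_upwards [h1, extChartAt_source_mem_nhds (I := 𝓡 l) (1 : K)] with q hq hqs
    have e : ψ.symm (ψ q) = q := ψ.left_inv hqs
    simp only [comp_apply, g, e] at hq
    rw [hq, e]

/-- A continuous map into a Lie group is smooth if its composite with a smooth, locally injective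
representation is smooth. -/
theorem contMDiffAt_of_representation [FiniteDimensional ℝ W] {J : K →* W}
    (hJ : ContMDiff (𝓡 l) 𝓘(ℝ, W) ∞ J) (hloc : ∀ᶠ q in 𝓝 (1 : K), J q = 1 → q = 1)
    {E N H' : Type*} [NormedAddCommGroup E] [NormedSpace ℝ E] [TopologicalSpace H']
    {I : ModelWithCorners ℝ E H'} [TopologicalSpace N] [ChartedSpace H' N]
    {f : N → K} {x : N} (hf : ContinuousAt f x) (hJf : ContMDiffAt I 𝓘(ℝ, W) ∞ (J ∘ f) x) :
    ContMDiffAt I (𝓡 l) ∞ f x := by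
  have : IsTopologicalGroup K := topologicalGroup_of_lieGroup (𝓡 l) ∞
  obtain ⟨Ψ, hΨ, hleft⟩ := exists_contMDiffAt_leftInverse hJ hloc
  -- The left inverse `Ψ` is available only near `1`, so `f` is first translated there: near `x` one
  -- has `f n = f x · Ψ (J (f x)⁻¹ J (f n))`.
  have h1 : ContMDiffAt I 𝓘(ℝ, W) ∞ (fun n => J (f x)⁻¹ * J (f n)) x := by
    exact (ContinuousLinearMap.contMDiff (ContinuousLinearMap.mul ℝ W (J (f x)⁻¹))).contMDiffAt.comp
      x hJf
  have h2 : ContMDiffAt I (𝓡 l) ∞ (fun n => f x * Ψ (J (f x)⁻¹ * J (f n))) x := by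
    refine contMDiffAt_const.mul (ContMDiffAt.comp x ?_ h1)
    rw [← map_mul, inv_mul_cancel, map_one]
    exact hΨ
  refine h2.congr_of_eventuallyEq ?_
  have h3 : Tendsto (fun n => (f x)⁻¹ * f n) (𝓝 x) (𝓝 1) := by
    have : ContinuousAt (fun n => (f x)⁻¹ * f n) x := continuousAt_const.mul hf
    simpa [ContinuousAt] using this
  filter_upwards [h3.eventually hleft] with n hn
  rw [← map_mul, hn, mul_inv_cancel_left]

end Representation

/-! ### Submersions: local sections, descent of smoothness, composition with diffeomorphisms -/

section Submersion

variable {E E'' F H G : Type*} [NormedAddCommGroup E] [NormedSpace ℝ E]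
  [NormedAddCommGroup E''] [NormedSpace ℝ E''] [NormedAddCommGroup F] [NormedSpace ℝ F]
  [TopologicalSpace H] [TopologicalSpace G]
  {I : ModelWithCorners ℝ E H} {J : ModelWithCorners ℝ E'' G}
  {M N : Type*} [TopologicalSpace M] [ChartedSpace H M] [TopologicalSpace N] [ChartedSpace G N]
  {n : WithTop ℕ∞} {f : M → N} {x : M}

/-- In submersion charts `f` is the projection `E'' × F → E''`, and the section is `y ↦ (y, c)`.
Freezing `c` at the complementary coordinate of `x` makes it pass through `x`. -/
theorem exists_section_of_isSubmersionAt [I.Boundaryless]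
    (h : Manifold.IsSubmersionAtOfComplement F I J n f x) :
    ∃ (U : Set N) (s : N → M), IsOpen U ∧ f x ∈ U ∧ ContMDiffOn J I n s U ∧
      (∀ y ∈ U, f (s y) = y) ∧ s (f x) = x := by
  let c := (h.equiv (h.domChart.extend I x)).2
  let τ : N → E := fun y => h.equiv.symm (h.codChart.extend J y, c)
  have hO : IsOpen (h.domChart.extend I).target := h.domChart.isOpen_extend_target
  have hx := h.mem_domChart_source
  have hxe : h.domChart.extend I x ∈ (h.domChart.extend I).target :=
    (h.domChart.extend I).map_source (by rwa [OpenPartialHomeomorph.extend_source])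
  have hτ : ContMDiffOn J 𝓘(ℝ, E) n τ h.codChart.source := by
    have h1 := OpenPartialHomeomorph.contMDiffOn_extend (I := J) h.codChart_mem_maximalAtlas
    have h2 : ContDiff ℝ n (fun z : E'' => h.equiv.symm (z, c)) := by fun_prop
    exact h2.contMDiff.comp_contMDiffOn h1
  have hfst : ∀ z ∈ (h.domChart.extend I).target,
      h.codChart.extend J (f ((h.domChart.extend I).symm z)) = (h.equiv z).1 :=
    fun z hz => h.writtenInCharts hz
  have hfx : h.codChart.extend J (f x) = (h.equiv (h.domChart.extend I x)).1 := by
    have := hfst _ hxe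
    rwa [(h.domChart.extend I).left_inv (by rwa [OpenPartialHomeomorph.extend_source])] at this
  have hτx : τ (f x) = h.domChart.extend I x := by
    simp only [τ, hfx, c, Prod.mk.eta, ContinuousLinearEquiv.symm_apply_apply]
  refine ⟨h.codChart.source ∩ τ ⁻¹' (h.domChart.extend I).target,
    fun y => (h.domChart.extend I).symm (τ y),
    hτ.continuousOn.isOpen_inter_preimage h.codChart.open_source hO,
    ⟨h.mem_codChart_source, ?_⟩, ?_, ?_, ?_⟩
  · rw [mem_preimage, hτx]
    exact hxe
  · refine (contMDiffOn_extend_symm h.domChart_mem_maximalAtlas).comp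
      (hτ.mono inter_subset_left) ?_
    intro y hy
    rw [mem_preimage, ← OpenPartialHomeomorph.extend_target']
    exact hy.2
  · intro y hy
    have h1 := hfst _ hy.2
    have hs : (h.domChart.extend I).symm (τ y) ∈ h.domChart.source := by
      rw [← h.domChart.extend_source (I := I)]
      exact (h.domChart.extend I).map_target hy.2
    refine (h.codChart.extend J).injOn ?_ ?_ ?_
    · rw [OpenPartialHomeomorph.extend_source]
      exact h.source_subset_preimage_source hs
    · rw [OpenPartialHomeomorph.extend_source]
      exact hy.1
    · rw [h1]
      simp [τ]
  · simp only [hτx]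
    exact (h.domChart.extend I).left_inv (by rwa [OpenPartialHomeomorph.extend_source])

/-- With a local section `s` through `x`, the map `g` is locally `(g ∘ f) ∘ s`. -/
theorem contMDiffAt_of_comp_submersion [I.Boundaryless]
    {E' H' N' : Type*} [NormedAddCommGroup E'] [NormedSpace ℝ E'] [TopologicalSpace H']
    {I' : ModelWithCorners ℝ E' H'} [TopologicalSpace N'] [ChartedSpace H' N']
    (h : Manifold.IsSubmersionAtOfComplement F I J n f x) {g : N → N'}
    (hg : ContMDiffAt I I' n (g ∘ f) x) : ContMDiffAt J I' n g (f x) := by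
  obtain ⟨U, s, hU, hxU, hs, hfs, hsx⟩ := exists_section_of_isSubmersionAt h
  have h1 : ContMDiffAt J I' n ((g ∘ f) ∘ s) (f x) := by
    refine ContMDiffAt.comp (f x) ?_ (hs.contMDiffAt (hU.mem_nhds hxU))
    rwa [hsx]
  refine h1.congr_of_eventuallyEq ?_
  filter_upwards [hU.mem_nhds hxU] with y hy
  simp [hfs y hy]

theorem contMDiff_of_comp_submersion [I.Boundaryless]
    {E' H' N' : Type*} [NormedAddCommGroup E'] [NormedSpace ℝ E'] [TopologicalSpace H']
    {I' : ModelWithCorners ℝ E' H'} [TopologicalSpace N'] [ChartedSpace H' N']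
    (h : Manifold.IsSubmersion I J n f) (hf : Surjective f) {g : N → N'}
    (hg : ContMDiff I I' n (g ∘ f)) : ContMDiff J I' n g := by
  intro y
  obtain ⟨x, rfl⟩ := hf y
  exact contMDiffAt_of_comp_submersion (h.isSubmersionOfComplement_complement x) (hg x)

/-- The chart of the source is replaced by its composite with `θ`, so that `f ∘ θ` has the same
expression in charts as `f`. -/
theorem isSubmersionAtOfComplement_comp_right [IsManifold I n M]
    {M' : Type*} [TopologicalSpace M'] [ChartedSpace H M'] [IsManifold I n M']
    {θ : OpenPartialHomeomorph M' M} {x : M'} (hx : x ∈ θ.source)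
    (hθ : ContMDiffOn I I n θ θ.source) (hθ' : ContMDiffOn I I n θ.symm θ.target)
    (h : Manifold.IsSubmersionAtOfComplement F I J n f (θ x)) :
    Manifold.IsSubmersionAtOfComplement F I J n (f ∘ θ) x := by
  refine Manifold.IsSubmersionAtOfComplement.mk_of_charts h.equiv (θ ≫ₕ h.domChart) h.codChart
    ⟨hx, h.mem_domChart_source⟩ h.mem_codChart_source ?_ h.codChart_mem_maximalAtlas ?_ ?_
  · refine OpenPartialHomeomorph.mem_maximalAtlas_of_contMDiffOn _ ?_ ?_
    · exact (contMDiffOn_of_mem_maximalAtlas h.domChart_mem_maximalAtlas).comp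
        (hθ.mono fun y hy => hy.1) fun y hy => hy.2
    · exact hθ'.comp ((contMDiffOn_symm_of_mem_maximalAtlas h.domChart_mem_maximalAtlas).mono
        fun y hy => hy.1) fun y hy => hy.2
  · intro y hy
    exact h.source_subset_preimage_source hy.2
  · intro z hz
    have hz' : I.symm z ∈ (θ ≫ₕ h.domChart).target ∧ z ∈ range I := by
      rw [OpenPartialHomeomorph.extend_target] at hz
      exact hz
    have hz1 : z ∈ (h.domChart.extend I).target := by
      rw [OpenPartialHomeomorph.extend_target]
      exact ⟨hz'.1.1, hz'.2⟩
    have h1 := h.writtenInCharts hz1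
    rw [← h1]
    have h2 : θ (θ.symm (h.domChart.symm (I.symm z))) = h.domChart.symm (I.symm z) :=
      θ.right_inv hz'.1.2
    simp only [comp_apply, OpenPartialHomeomorph.extend_coe_symm,
      OpenPartialHomeomorph.coe_trans_symm, h2]

theorem isSubmersionAtOfComplement_comp_left [IsManifold J n N] [IsManifold I n M]
    {N' : Type*} [TopologicalSpace N'] [ChartedSpace G N'] [IsManifold J n N']
    {θ : OpenPartialHomeomorph N N'} (hx : f x ∈ θ.source)
    (hθ : ContMDiffOn J J n θ θ.source) (hθ' : ContMDiffOn J J n θ.symm θ.target)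
    (h : Manifold.IsSubmersionAtOfComplement F I J n f x) :
    Manifold.IsSubmersionAtOfComplement F I J n (θ ∘ f) x := by
  have hO : IsOpen (h.domChart.source ∩ f ⁻¹' θ.source) :=
    h.contMDiffOn.continuousOn.isOpen_inter_preimage h.domChart.open_source θ.open_source
  -- The new chart of the target is defined only on the image under `θ` of part of `θ.source`, so
  -- the chart of the source is shrunk to points which `f` sends into `θ.source`.
  let φ := h.domChart.restrOpen _ hO
  refine Manifold.IsSubmersionAtOfComplement.mk_of_charts h.equiv φ
    (θ.symm ≫ₕ h.codChart)
    ⟨h.mem_domChart_source, h.mem_domChart_source, hx⟩ ⟨θ.map_source hx, ?_⟩ ?_ ?_ ?_ ?_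
  · change θ.symm (θ (f x)) ∈ h.codChart.source
    rw [θ.left_inv hx]
    exact h.mem_codChart_source
  · refine OpenPartialHomeomorph.mem_maximalAtlas_of_contMDiffOn _ ?_ ?_
    · exact (contMDiffOn_of_mem_maximalAtlas h.domChart_mem_maximalAtlas).mono fun y hy => hy.1
    · exact (contMDiffOn_symm_of_mem_maximalAtlas h.domChart_mem_maximalAtlas).mono
        fun y hy => hy.1
  · refine OpenPartialHomeomorph.mem_maximalAtlas_of_contMDiffOn _ ?_ ?_
    · exact (contMDiffOn_of_mem_maximalAtlas h.codChart_mem_maximalAtlas).comp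
        (hθ'.mono fun y hy => hy.1) fun y hy => hy.2
    · exact hθ.comp ((contMDiffOn_symm_of_mem_maximalAtlas h.codChart_mem_maximalAtlas).mono
        fun y hy => hy.1) fun y hy => hy.2
  · intro y hy
    refine ⟨θ.map_source hy.2.2, ?_⟩
    change θ.symm (θ (f y)) ∈ h.codChart.source
    rw [θ.left_inv hy.2.2]
    exact h.source_subset_preimage_source hy.1
  · intro z hz
    have hz' : I.symm z ∈ φ.target ∧ z ∈ range I := by
      rw [OpenPartialHomeomorph.extend_target] at hz
      exact hz
    have hs := φ.map_target hz'.1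
    have hz1 : z ∈ (h.domChart.extend I).target := by
      rw [OpenPartialHomeomorph.extend_target]
      exact ⟨hz'.1.1, hz'.2⟩
    rw [← h.writtenInCharts hz1]
    have h2 : θ.symm (θ (f (h.domChart.symm (I.symm z)))) = f (h.domChart.symm (I.symm z)) :=
      θ.left_inv hs.2.2
    simp only [comp_apply, OpenPartialHomeomorph.extend_coe_symm, OpenPartialHomeomorph.extend_coe,
      OpenPartialHomeomorph.coe_trans, φ, OpenPartialHomeomorph.coe_restrOpen_symm, h2]

end Submersion

/-! ### Gluing a manifold structure from local homeomorphisms -/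

section Glue

variable {E H B X : Type*} [NormedAddCommGroup E] [NormedSpace ℝ E] [TopologicalSpace H]
  [TopologicalSpace B] [ChartedSpace H B] [TopologicalSpace X]

/-- The atlas on `X` obtained from local homeomorphisms to a manifold `B`. -/
@[reducible]
def gluedChartedSpace (Φ : X → OpenPartialHomeomorph X B) (hΦ : ∀ x, x ∈ (Φ x).source) :
    ChartedSpace H X where
  atlas := {e | ∃ x, ∃ c ∈ atlas H B, e = Φ x ≫ₕ c}
  chartAt x := Φ x ≫ₕ chartAt H (Φ x x)
  mem_chart_source x := ⟨hΦ x, mem_chart_source H (Φ x x)⟩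
  chart_mem_atlas x := ⟨x, _, chart_mem_atlas H _, rfl⟩

variable {I : ModelWithCorners ℝ E H} {n : WithTop ℕ∞} [IsManifold I n B]
  {Φ : X → OpenPartialHomeomorph X B} (hΦ : ∀ x, x ∈ (Φ x).source)

/-- A change of charts is `c⁻¹` followed by `Φ x`⁻¹, `Φ y` and `c'`. The outer maps are charts of
`B`, and the middle pair is smooth by hypothesis. -/
theorem isManifold_glued (hc : ∀ x y, ContMDiffOn I I n ((Φ x).symm ≫ₕ Φ y)
      ((Φ x).symm ≫ₕ Φ y).source) :
    letI := gluedChartedSpace (H := H) Φ hΦ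
    IsManifold I n X := by
  let _ := gluedChartedSpace (H := H) Φ hΦ
  refine isManifold_of_contDiffOn I n X ?_
  rintro _ _ ⟨x, c, hcB, rfl⟩ ⟨y, c', hcB', rfl⟩
  rw [← contMDiffOn_iff_contDiffOn]
  have h1 := contMDiffOn_symm_of_mem_maximalAtlas (I := I) (n := n)
    (StructureGroupoid.subset_maximalAtlas _ hcB)
  have h2 := contMDiffOn_of_mem_maximalAtlas (I := I) (n := n)
    (StructureGroupoid.subset_maximalAtlas _ hcB')
  refine I.contMDiff.comp_contMDiffOn ?_
  refine h2.comp ((hc x y).comp (h1.comp (I.contMDiffOn_symm.mono ?_) ?_) ?_) ?_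
  · exact inter_subset_right
  · rintro z ⟨hz, -⟩
    exact hz.1.1
  · rintro z ⟨hz, -⟩
    exact ⟨hz.1.2, hz.2.1⟩
  · rintro z ⟨hz, -⟩
    exact hz.2.2

/-- `Φ x` followed by a chart `c` of `B` is itself a chart of `X`, so locally `Φ x` is that chart
followed by `c⁻¹`, and similarly for its inverse. -/
theorem contMDiffOn_glued (hc : ∀ x y, ContMDiffOn I I n ((Φ x).symm ≫ₕ Φ y)
      ((Φ x).symm ≫ₕ Φ y).source) (x : X) :
    letI := gluedChartedSpace (H := H) Φ hΦ
    ContMDiffOn I I n (Φ x) (Φ x).source ∧ ContMDiffOn I I n (Φ x).symm (Φ x).target := by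
  let _ := gluedChartedSpace (H := H) Φ hΦ
  have := isManifold_glued (I := I) (n := n) hΦ hc
  have hat : ∀ y, ∀ c ∈ atlas H B, Φ y ≫ₕ c ∈ IsManifold.maximalAtlas I n X := fun y c hcB =>
    StructureGroupoid.subset_maximalAtlas _ ⟨y, c, hcB, rfl⟩
  constructor
  · intro y hy
    let c := chartAt H (Φ x y)
    have hyc : Φ x y ∈ c.source := mem_chart_source H _
    have h1 : ContMDiffAt I I n (Φ x ≫ₕ c) y :=
      contMDiffAt_of_mem_maximalAtlas (hat x c (chart_mem_atlas H _)) ⟨hy, hyc⟩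
    have h2 : ContMDiffAt I I n c.symm ((Φ x ≫ₕ c) y) :=
      contMDiffAt_symm_of_mem_maximalAtlas (IsManifold.chart_mem_maximalAtlas _)
        (c.map_source hyc)
    refine ((h2.comp y h1).congr_of_eventuallyEq ?_).contMDiffWithinAt
    have h3 : ∀ᶠ z in 𝓝 y, Φ x z ∈ c.source :=
      ((Φ x).continuousAt hy).eventually (c.open_source.mem_nhds hyc)
    filter_upwards [h3] with z hz
    exact (c.left_inv hz).symm
  · intro b hb
    let c := chartAt H b
    have hyc : b ∈ c.source := mem_chart_source H _
    have h1 : ContMDiffAt I I n c b :=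
      contMDiffAt_of_mem_maximalAtlas (IsManifold.chart_mem_maximalAtlas _) hyc
    have h2 : ContMDiffAt I I n (Φ x ≫ₕ c).symm (c b) := by
      refine contMDiffAt_symm_of_mem_maximalAtlas (hat x c (chart_mem_atlas H _)) ?_
      refine ⟨c.map_source hyc, ?_⟩
      change c.symm (c b) ∈ (Φ x).symm.source
      rwa [c.left_inv hyc]
    refine ((h2.comp b h1).congr_of_eventuallyEq ?_).contMDiffWithinAt
    filter_upwards [c.open_source.mem_nhds hyc] with z hz
    change _ = (Φ x).symm (c.symm (c z))
    rw [c.left_inv hz]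

end Glue

/-! ### The adjoint representation and its differential -/

section Adjoint

variable {d : ℕ} {G : Type*} [TopologicalSpace G] [ChartedSpace (EuclideanSpace ℝ (Fin d)) G]
  [Group G]

/-- The adjoint action of `g` as an operator of the model space. -/
noncomputable def adjointOp (d : ℕ) {G : Type*} [TopologicalSpace G]
    [ChartedSpace (EuclideanSpace ℝ (Fin d)) G] [Group G] (g : G) :
    EuclideanSpace ℝ (Fin d) →L[ℝ] EuclideanSpace ℝ (Fin d) :=
  mfderiv (𝓡 d) (𝓡 d) (fun x : G => g * x * g⁻¹) 1

/-- Multiplication of `G`, read in the preferred chart at `1`. -/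
noncomputable def chartMul (d : ℕ) (G : Type*) [TopologicalSpace G]
    [ChartedSpace (EuclideanSpace ℝ (Fin d)) G] [Group G] (p : EuclideanSpace ℝ (Fin d) × EuclideanSpace ℝ (Fin d)) :
    EuclideanSpace ℝ (Fin d) :=
  extChartAt (𝓡 d) (1 : G)
    ((extChartAt (𝓡 d) (1 : G)).symm p.1 * (extChartAt (𝓡 d) (1 : G)).symm p.2)

theorem adjointOp_one : adjointOp d (1 : G) = ContinuousLinearMap.id ℝ _ := by
  have e : (fun x : G => 1 * x * (1 : G)⁻¹) = id := by funext x; simp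
  rw [adjointOp, e, mfderiv_id]
  rfl

variable [LieGroup (𝓡 d) ∞ G]

theorem mdifferentiable_mul_left (g : G) : MDifferentiable (𝓡 d) (𝓡 d) (fun x : G => g * x) :=
  (contMDiff_mul_left (I := 𝓡 d) (n := ∞)).mdifferentiable (by simp)

theorem mdifferentiable_mul_right (g : G) : MDifferentiable (𝓡 d) (𝓡 d) (fun x : G => x * g) :=
  (contMDiff_mul_right (I := 𝓡 d) (n := ∞)).mdifferentiable (by simp)

theorem mdifferentiable_conj (g : G) :
    MDifferentiable (𝓡 d) (𝓡 d) (fun x : G => g * x * g⁻¹) :=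
  (mdifferentiable_mul_right g⁻¹).comp (mdifferentiable_mul_left g)

theorem adjointOp_mul (g h : G) : adjointOp d (g * h) = (adjointOp d g).comp (adjointOp d h) := by
  apply ContinuousLinearMap.ext
  intro v
  have e : (fun x : G => g * h * x * (g * h)⁻¹)
      = (fun x : G => g * x * g⁻¹) ∘ (fun x : G => h * x * h⁻¹) := by
    funext x; simp [mul_assoc]
  have h1 := mfderiv_comp_apply_of_eq (x := (1 : G)) (y := 1) (mdifferentiable_conj g 1)
    (mdifferentiable_conj h 1) (by simp) v
  rw [← e] at h1
  exact h1

/-- `Ad(g)` is the derivative in `x`, at the fixed point `1`, of a map smooth in `(g, x)`. Source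
and target base points are always `1`, so the changes of tangent coordinates in the general
statement are identities. -/
theorem contMDiff_adjointOp :
    ContMDiff (𝓡 d) 𝓘(ℝ, EuclideanSpace ℝ (Fin d) →L[ℝ] EuclideanSpace ℝ (Fin d)) ∞
      (adjointOp d : G → _) := by
  have : IsManifold (𝓡 d) ∞ G := LieGroup.toContMDiffMul.toIsManifold
  intro g₀
  have hf : ContMDiff ((𝓡 d).prod (𝓡 d)) (𝓡 d) ∞
      (uncurry fun (g x : G) => g * x * g⁻¹) :=
    (contMDiff_fst.mul contMDiff_snd).mul contMDiff_fst.inv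
  have h := ContMDiffAt.mfderiv (m := ∞) (n := ∞) (x₀ := g₀) (fun g x : G => g * x * g⁻¹)
    (fun _ => (1 : G)) hf.contMDiffAt contMDiffAt_const (by simp)
  have e : inTangentCoordinates (𝓡 d) (𝓡 d) (fun _ : G => (1 : G)) (fun g : G => g * 1 * g⁻¹)
      (fun g => adjointOp d g) g₀ = adjointOp d := by
    funext g
    have hg : ∀ x : G, x * 1 * x⁻¹ = 1 := by intro x; simp
    refine (inTangentCoordinates_eq (I := 𝓡 d) (I' := 𝓡 d) (fun _ : G => (1 : G))
      (fun g : G => g * 1 * g⁻¹) (fun g => adjointOp d g) (mem_chart_source _ _)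
      (by rw [hg, hg]; exact mem_chart_source _ _)).trans ?_
    apply ContinuousLinearMap.ext
    intro v
    change (tangentBundleCore (𝓡 d) G).coordChange (achart _ (g * 1 * g⁻¹))
      (achart _ (g₀ * 1 * g₀⁻¹)) (g * 1 * g⁻¹)
      (adjointOp d g ((tangentBundleCore (𝓡 d) G).coordChange _ _ _ v)) = _
    simp only [hg]
    rw [(tangentBundleCore (𝓡 d) G).coordChange_self _ _ (mem_chart_source _ _),
      (tangentBundleCore (𝓡 d) G).coordChange_self _ _ (mem_chart_source _ _)]
  rw [← e]
  exact h

theorem contDiffAt_chartMul :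
    ContDiffAt ℝ ∞ (chartMul d G) (extChartAt (𝓡 d) (1 : G) 1, extChartAt (𝓡 d) (1 : G) 1) := by
  have : IsManifold (𝓡 d) ∞ G := LieGroup.toContMDiffMul.toIsManifold
  have h0 : ContMDiffAt 𝓘(ℝ, EuclideanSpace ℝ (Fin d)) (𝓡 d) ∞ (extChartAt (𝓡 d) (1 : G)).symm
      (extChartAt (𝓡 d) (1 : G) 1) :=
    (contMDiffOn_extChartAt_symm 1).contMDiffAt (extChartAt_target_mem_nhds 1)
  rw [← contMDiffAt_iff_contDiffAt]
  have h1 : ContMDiffAt 𝓘(ℝ, EuclideanSpace ℝ (Fin d) × EuclideanSpace ℝ (Fin d)) (𝓡 d) ∞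
      (fun p : EuclideanSpace ℝ (Fin d) × EuclideanSpace ℝ (Fin d) =>
        (extChartAt (𝓡 d) (1 : G)).symm p.1 * (extChartAt (𝓡 d) (1 : G)).symm p.2)
      (extChartAt (𝓡 d) (1 : G) 1, extChartAt (𝓡 d) (1 : G) 1) :=
    (h0.comp_of_eq (f := Prod.fst) contDiff_fst.contMDiff.contMDiffAt rfl).mul
      (h0.comp_of_eq (f := Prod.snd) contDiff_snd.contMDiff.contMDiffAt rfl)
  refine ContMDiffAt.comp _ ?_ h1
  simp only [extChartAt_to_inv, mul_one]
  exact contMDiffAt_extChartAt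

section Chart

variable {y : EuclideanSpace ℝ (Fin d)}

theorem mdifferentiableAt_chart_mul {q r : G} (h : q * r ∈ (extChartAt (𝓡 d) (1 : G)).source) :
    MDifferentiableAt (𝓡 d) 𝓘(ℝ, EuclideanSpace ℝ (Fin d)) (extChartAt (𝓡 d) (1 : G)) (q * r) := by
  have : IsManifold (𝓡 d) ∞ G := LieGroup.toContMDiffMul.toIsManifold
  have : IsManifold (𝓡 d) 1 G := IsManifold.of_le (n := ∞) (by exact_mod_cast le_top)
  exact mdifferentiableAt_extChartAt (by rwa [← extChartAt_source (𝓡 d)])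

theorem mfderiv_chart_mul_left
    (hy : y ∈ (extChartAt (𝓡 d) (1 : G)).target)
    (hF : DifferentiableAt ℝ (chartMul d G) (y, extChartAt (𝓡 d) (1 : G) 1))
    (v : EuclideanSpace ℝ (Fin d)) :
    (mfderiv (𝓡 d) 𝓘(ℝ, EuclideanSpace ℝ (Fin d))
      (fun q : G => extChartAt (𝓡 d) (1 : G) ((extChartAt (𝓡 d) (1 : G)).symm y * q)) 1 v :
        EuclideanSpace ℝ (Fin d))
      = fderiv ℝ (chartMul d G) (y, extChartAt (𝓡 d) (1 : G) 1) (0, v) := by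
  have hs : (extChartAt (𝓡 d) (1 : G)).symm y * 1 ∈ (extChartAt (𝓡 d) (1 : G)).source := by
    rw [mul_one]; exact (extChartAt (𝓡 d) (1 : G)).map_target hy
  have hd : MDifferentiableAt (𝓡 d) 𝓘(ℝ, EuclideanSpace ℝ (Fin d))
      (fun q : G => extChartAt (𝓡 d) (1 : G) ((extChartAt (𝓡 d) (1 : G)).symm y * q)) 1 :=
    (mdifferentiableAt_chart_mul hs).comp 1 (mdifferentiable_mul_left _ 1)
  have h1 : HasFDerivAt (fun z => chartMul d G (y, z))
      ((fderiv ℝ (chartMul d G) (y, extChartAt (𝓡 d) (1 : G) 1)).comp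
        (ContinuousLinearMap.inr ℝ _ _)) (extChartAt (𝓡 d) (1 : G) 1) :=
    hF.hasFDerivAt.comp _ (hasFDerivAt_prodMk_right y _)
  have h2 : (mfderiv (𝓡 d) 𝓘(ℝ, EuclideanSpace ℝ (Fin d))
      (fun q : G => extChartAt (𝓡 d) (1 : G) ((extChartAt (𝓡 d) (1 : G)).symm y * q)) 1 :
        EuclideanSpace ℝ (Fin d) →L[ℝ] EuclideanSpace ℝ (Fin d)) = _ := mfderiv_eq_fderiv_chart hd
  have h3 := h2.trans h1.fderiv
  exact congrArg (fun T => T v) h3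

theorem mfderiv_chart_mul_right
    (hy : y ∈ (extChartAt (𝓡 d) (1 : G)).target)
    (hF : DifferentiableAt ℝ (chartMul d G) (extChartAt (𝓡 d) (1 : G) 1, y))
    (v : EuclideanSpace ℝ (Fin d)) :
    (mfderiv (𝓡 d) 𝓘(ℝ, EuclideanSpace ℝ (Fin d))
      (fun q : G => extChartAt (𝓡 d) (1 : G) (q * (extChartAt (𝓡 d) (1 : G)).symm y)) 1 v :
        EuclideanSpace ℝ (Fin d))
      = fderiv ℝ (chartMul d G) (extChartAt (𝓡 d) (1 : G) 1, y) (v, 0) := by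
  have hs : 1 * (extChartAt (𝓡 d) (1 : G)).symm y ∈ (extChartAt (𝓡 d) (1 : G)).source := by
    rw [one_mul]; exact (extChartAt (𝓡 d) (1 : G)).map_target hy
  have hd : MDifferentiableAt (𝓡 d) 𝓘(ℝ, EuclideanSpace ℝ (Fin d))
      (fun q : G => extChartAt (𝓡 d) (1 : G) (q * (extChartAt (𝓡 d) (1 : G)).symm y)) 1 :=
    (mdifferentiableAt_chart_mul hs).comp 1 (mdifferentiable_mul_right _ 1)
  have h1 : HasFDerivAt (fun z => chartMul d G (z, y))
      ((fderiv ℝ (chartMul d G) (extChartAt (𝓡 d) (1 : G) 1, y)).comp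
        (ContinuousLinearMap.inl ℝ _ _)) (extChartAt (𝓡 d) (1 : G) 1) :=
    HasFDerivAt.comp (f := fun z => (z, y)) (extChartAt (𝓡 d) (1 : G) 1) hF.hasFDerivAt
      (hasFDerivAt_prodMk_left _ y)
  have h2 : (mfderiv (𝓡 d) 𝓘(ℝ, EuclideanSpace ℝ (Fin d))
      (fun q : G => extChartAt (𝓡 d) (1 : G) (q * (extChartAt (𝓡 d) (1 : G)).symm y)) 1 :
        EuclideanSpace ℝ (Fin d) →L[ℝ] EuclideanSpace ℝ (Fin d)) = _ := mfderiv_eq_fderiv_chart hd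
  have h3 := h2.trans h1.fderiv
  exact congrArg (fun T => T v) h3

/-- This is the derivative at `x = 1` of `(g x g⁻¹) g = g x`, that is `dR_g Ad(g) = dL_g`, written
with the two partial derivatives of multiplication in the chart. It determines `Ad` near `1` from
the multiplication alone. -/
theorem fderiv_chartMul_adjointOp
    (hy : y ∈ (extChartAt (𝓡 d) (1 : G)).target)
    (hF : DifferentiableAt ℝ (chartMul d G) (y, extChartAt (𝓡 d) (1 : G) 1))
    (hF' : DifferentiableAt ℝ (chartMul d G) (extChartAt (𝓡 d) (1 : G) 1, y))
    (w : EuclideanSpace ℝ (Fin d)) :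
    fderiv ℝ (chartMul d G) (extChartAt (𝓡 d) (1 : G) 1, y)
        (adjointOp d ((extChartAt (𝓡 d) (1 : G)).symm y) w, 0)
      = fderiv ℝ (chartMul d G) (y, extChartAt (𝓡 d) (1 : G) 1) (0, w) := by
  rw [← mfderiv_chart_mul_left hy hF, ← mfderiv_chart_mul_right hy hF']
  set g := (extChartAt (𝓡 d) (1 : G)).symm y
  have hs : 1 * g ∈ (extChartAt (𝓡 d) (1 : G)).source := by
    rw [one_mul]; exact (extChartAt (𝓡 d) (1 : G)).map_target hy
  have hd : MDifferentiableAt (𝓡 d) 𝓘(ℝ, EuclideanSpace ℝ (Fin d))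
      (fun q : G => extChartAt (𝓡 d) (1 : G) (q * g)) 1 :=
    (mdifferentiableAt_chart_mul hs).comp 1 (mdifferentiable_mul_right _ 1)
  have h1 := mfderiv_comp_apply_of_eq (x := (1 : G)) (y := 1) hd (mdifferentiable_conj g 1)
    (by simp) w
  have e : (fun q : G => extChartAt (𝓡 d) (1 : G) (q * g)) ∘ (fun x : G => g * x * g⁻¹)
      = fun q : G => extChartAt (𝓡 d) (1 : G) (g * q) := by
    funext q; simp
  rw [e] at h1
  exact h1.symm

/-- In the chart, the left-invariant field of `v` is the partial derivative of multiplication in the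
second factor at the unit. This puts the bracket in terms of the same function as `Ad`. -/
theorem mpullbackWithin_mulInvariantVectorField
    (hy : y ∈ (extChartAt (𝓡 d) (1 : G)).target)
    (hF : DifferentiableAt ℝ (chartMul d G) (y, extChartAt (𝓡 d) (1 : G) 1))
    (v : EuclideanSpace ℝ (Fin d)) :
    (VectorField.mpullbackWithin 𝓘(ℝ, EuclideanSpace ℝ (Fin d)) (𝓡 d)
      (extChartAt (𝓡 d) (1 : G)).symm
      (mulInvariantVectorField (I := 𝓡 d) (G := G) (v : GroupLieAlgebra (𝓡 d) G))
      (range (𝓡 d)) y : EuclideanSpace ℝ (Fin d))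
      = fderiv ℝ (chartMul d G) (y, extChartAt (𝓡 d) (1 : G) 1) (0, v) := by
  have : IsManifold (𝓡 d) ∞ G := LieGroup.toContMDiffMul.toIsManifold
  have : IsManifold (𝓡 d) 1 G := IsManifold.of_le (n := ∞) (by exact_mod_cast le_top)
  rw [← mfderiv_chart_mul_left hy hF]
  have hinv := ContinuousLinearMap.inverse_eq
    (mfderivWithin_extChartAt_symm_comp_mfderiv_extChartAt (I := 𝓡 d) hy)
    (mfderiv_extChartAt_comp_mfderivWithin_extChartAt_symm (I := 𝓡 d) hy)
  rw [VectorField.mpullbackWithin, hinv]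
  set g := (extChartAt (𝓡 d) (1 : G)).symm y
  have hs : g * 1 ∈ (extChartAt (𝓡 d) (1 : G)).source := by
    rw [mul_one]; exact (extChartAt (𝓡 d) (1 : G)).map_target hy
  have h1 := mfderiv_comp_apply_of_eq (x := (1 : G)) (y := g)
    (by simpa using mdifferentiableAt_chart_mul hs) (mdifferentiable_mul_left g 1)
    (mul_one g) v
  exact h1.symm

end Chart

/-- The differential of the adjoint representation at `1` is the bracket. -/
theorem mfderiv_adjointOp (Z W : LieAlg d G) :
    (mfderiv (𝓡 d) 𝓘(ℝ, EuclideanSpace ℝ (Fin d)) (fun g : G => adjointOp d g (toModel W)) 1 Z :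
        EuclideanSpace ℝ (Fin d)) = toModel ⁅Z, W⁆ := by
  set w := toModel W
  let z := toModel Z
  have : IsManifold (𝓡 d) ∞ G := LieGroup.toContMDiffMul.toIsManifold
  have : IsManifold (𝓡 d) 1 G := IsManifold.of_le (n := ∞) (by exact_mod_cast le_top)
  set a := extChartAt (𝓡 d) (1 : G) 1 with ha
  let F := chartMul d G
  have hF : ContDiffAt ℝ ∞ F (a, a) := contDiffAt_chartMul
  have hF2 : ContDiffAt ℝ 2 F (a, a) := hF.of_le (WithTop.coe_le_coe.mpr le_top)
  have hFd : ∀ᶠ p in 𝓝 (a, a), DifferentiableAt ℝ F p := by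
    filter_upwards [hF2.eventually (by simp)] with p hp using hp.differentiableAt (by simp)
  have hy1 : ∀ᶠ y in 𝓝 a, DifferentiableAt ℝ F (y, a) :=
    (Continuous.prodMk_left a).continuousAt.eventually hFd
  have hy2 : ∀ᶠ y in 𝓝 a, DifferentiableAt ℝ F (a, y) :=
    (Continuous.prodMk_right a).continuousAt.eventually hFd
  have hyt : ∀ᶠ y in 𝓝 a, y ∈ (extChartAt (𝓡 d) (1 : G)).target :=
    extChartAt_target_mem_nhds (I := 𝓡 d) (1 : G)
  let B := fderiv ℝ (fderiv ℝ F) (a, a)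
  have hB : HasFDerivAt (fderiv ℝ F) B (a, a) :=
    ((hF2.fderiv_right (m := 1) (by norm_num)).differentiableAt (by simp)).hasFDerivAt
  have hsymm : ∀ p q, B p q = B q p :=
    hF2.isSymmSndFDerivAt (by simp [minSmoothness_of_isRCLikeNormedField])
  have hleft : ∀ u, HasFDerivAt (fun y => fderiv ℝ F (y, a) (0, u))
      ((ContinuousLinearMap.apply ℝ _ ((0 : EuclideanSpace ℝ (Fin d)), u)).comp
        (B.comp (ContinuousLinearMap.inl ℝ _ _))) a := fun u =>
    (ContinuousLinearMap.apply ℝ (EuclideanSpace ℝ (Fin d))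
      ((0 : EuclideanSpace ℝ (Fin d)), u)).hasFDerivAt.comp a
      (HasFDerivAt.comp (f := fun y => (y, a)) a hB (hasFDerivAt_prodMk_left a a))
  have hright : HasFDerivAt (fun y => fderiv ℝ F (a, y)) (B.comp (ContinuousLinearMap.inr ℝ _ _)) a :=
    hB.comp a (hasFDerivAt_prodMk_right a a)
  let A : EuclideanSpace ℝ (Fin d) → EuclideanSpace ℝ (Fin d) :=
    fun y => adjointOp d ((extChartAt (𝓡 d) (1 : G)).symm y) w
  have hAG : ContMDiff (𝓡 d) 𝓘(ℝ, EuclideanSpace ℝ (Fin d)) ∞ (fun g : G => adjointOp d g w) :=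
    (contMDiff_adjointOp (G := G)).clm_apply contMDiff_const
  have hmd : MDifferentiableAt (𝓡 d) 𝓘(ℝ, EuclideanSpace ℝ (Fin d))
      (fun g : G => adjointOp d g w) 1 := hAG.mdifferentiable (by simp) 1
  have hA : DifferentiableAt ℝ A a := by
    have h0 : ContMDiffAt 𝓘(ℝ, EuclideanSpace ℝ (Fin d)) (𝓡 d) ∞ (extChartAt (𝓡 d) (1 : G)).symm
        a := (contMDiffOn_extChartAt_symm 1).contMDiffAt (extChartAt_target_mem_nhds 1)
    have h1 : ContMDiffAt 𝓘(ℝ, EuclideanSpace ℝ (Fin d)) 𝓘(ℝ, EuclideanSpace ℝ (Fin d)) ∞ A a :=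
      hAG.contMDiffAt.comp a h0
    exact (contMDiffAt_iff_contDiffAt.mp h1).differentiableAt (by simp)
  have hA0 : A a = w := by
    simp only [A, ha, extChartAt_to_inv, adjointOp_one]
    rfl
  have hmf : (mfderiv (𝓡 d) 𝓘(ℝ, EuclideanSpace ℝ (Fin d)) (fun g : G => adjointOp d g w) 1 :
      EuclideanSpace ℝ (Fin d) →L[ℝ] EuclideanSpace ℝ (Fin d)) = fderiv ℝ A a :=
    mfderiv_eq_fderiv_chart hmd
  have ha1 : (extChartAt (𝓡 d) (1 : G)).symm a = 1 := extChartAt_to_inv 1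
  have hFa : ∀ᶠ y in 𝓝 a, F (y, a) = y := by
    filter_upwards [hyt] with y hy
    change extChartAt (𝓡 d) (1 : G) ((extChartAt (𝓡 d) (1 : G)).symm y *
      (extChartAt (𝓡 d) (1 : G)).symm a) = y
    rw [ha1, mul_one, (extChartAt (𝓡 d) (1 : G)).right_inv hy]
  have hid : ∀ u, fderiv ℝ F (a, a) (u, 0) = u := by
    intro u
    have h1 : HasFDerivAt (fun y => F (y, a))
        ((fderiv ℝ F (a, a)).comp (ContinuousLinearMap.inl ℝ _ _)) a :=
      HasFDerivAt.comp (f := fun y => (y, a)) a hFd.self_of_nhds.hasFDerivAt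
        (hasFDerivAt_prodMk_left a a)
    have h2 : HasFDerivAt (fun y => F (y, a)) (ContinuousLinearMap.id ℝ _) a :=
      (hasFDerivAt_id a).congr_of_eventuallyEq hFa
    exact congrArg (fun T => T u) (h1.unique h2)
  -- Both sides of `∂₁F(a, y) A(y) = ∂₂F(y, a) w` are differentiated at `y = a` in direction `z`.
  -- Since `∂₁F(a, a)` is the identity and `A(a) = w`, this reads `B(0, z)(w, 0) + A'(z) = B(z,
  -- 0)(0, w)`, and symmetry of `B` brings it to the stated form.
  have key : fderiv ℝ A a z = B (z, 0) (0, w) - B (w, 0) (0, z) := by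
    have h1 : (fun y => fderiv ℝ F (a, y) (A y, 0)) =ᶠ[𝓝 a] fun y => fderiv ℝ F (y, a) (0, w) := by
      filter_upwards [hy1, hy2, hyt] with y h1 h2 h3
      exact fderiv_chartMul_adjointOp h3 h1 h2 w
    have h2 := (hleft w).congr_of_eventuallyEq h1
    have h3 := hright.clm_apply
      ((ContinuousLinearMap.inl ℝ _ (EuclideanSpace ℝ (Fin d))).hasFDerivAt.comp a hA.hasFDerivAt)
    have h4 := congrArg (fun T => T z) (h3.unique h2)
    simp only [add_apply, ContinuousLinearMap.comp_apply,
      ContinuousLinearMap.flip_apply, ContinuousLinearMap.inl_apply, ContinuousLinearMap.inr_apply,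
      comp_apply, hid, hA0, ContinuousLinearMap.apply_apply] at h4
    rw [hsymm (w, 0) (0, z), ← h4]
    abel
  obtain ⟨V, hVdef⟩ : ∃ V : LieAlg d G → EuclideanSpace ℝ (Fin d) → EuclideanSpace ℝ (Fin d),
      V = fun v => VectorField.mpullbackWithin 𝓘(ℝ, EuclideanSpace ℝ (Fin d)) (𝓡 d)
        (extChartAt (𝓡 d) (1 : G)).symm (mulInvariantVectorField (I := 𝓡 d) (G := G) v)
        (range (𝓡 d)) := ⟨_, rfl⟩
  have hV : ∀ v : LieAlg d G, V v =ᶠ[𝓝 a] fun y => fderiv ℝ F (y, a) (0, toModel v) := by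
    intro v
    filter_upwards [hy1, hyt] with y h1 h2
    rw [hVdef]
    exact mpullbackWithin_mulInvariantVectorField h2 h1 (toModel v)
  have hid' : ∀ u, fderiv ℝ F (a, a) (0, u) = u := by
    intro u
    have hFa' : ∀ᶠ y in 𝓝 a, F (a, y) = y := by
      filter_upwards [hyt] with y hy
      change extChartAt (𝓡 d) (1 : G) ((extChartAt (𝓡 d) (1 : G)).symm a *
        (extChartAt (𝓡 d) (1 : G)).symm y) = y
      rw [ha1, one_mul, (extChartAt (𝓡 d) (1 : G)).right_inv hy]
    have h1 : HasFDerivAt (fun y => F (a, y))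
        ((fderiv ℝ F (a, a)).comp (ContinuousLinearMap.inr ℝ _ _)) a :=
      HasFDerivAt.comp (f := fun y => (a, y)) a hFd.self_of_nhds.hasFDerivAt
        (hasFDerivAt_prodMk_right a a)
    have h2 : HasFDerivAt (fun y => F (a, y)) (ContinuousLinearMap.id ℝ _) a :=
      (hasFDerivAt_id a).congr_of_eventuallyEq hFa'
    exact congrArg (fun T => T u) (h1.unique h2)
  -- The left-invariant fields are `y ↦ ∂₂F(y, a)(0, ·)`, with value the given vector at `a`. Their
  -- bracket at `a` is therefore the same antisymmetrized second derivative as in `key`.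
  have hbr : toModel (⁅Z, W⁆ : LieAlg d G) = B (z, 0) (0, w) - B (w, 0) (0, z) := by
    have h1 : toModel (⁅Z, W⁆ : LieAlg d G) = VectorField.lieBracketWithin ℝ (V Z) (V W)
        ((extChartAt (𝓡 d) (1 : G)).symm ⁻¹' univ ∩ range (𝓡 d)) a := by
      rw [hVdef]
      change (mfderiv (𝓡 d) 𝓘(ℝ, EuclideanSpace ℝ (Fin d)) (extChartAt (𝓡 d) (1 : G)) 1).inverse _
        = _
      rw [mfderiv_extChartAt_self]
      exact congrArg (fun (T : EuclideanSpace ℝ (Fin d) →L[ℝ] EuclideanSpace ℝ (Fin d)) => T _)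
        ContinuousLinearMap.inverse_id
    have h2 : (extChartAt (𝓡 d) (1 : G)).symm ⁻¹' univ ∩ range (𝓡 d) = univ := by simp
    have h3 : ∀ v : LieAlg d G, fderiv ℝ (V v) a = _ :=
      fun v => ((hleft (toModel v)).congr_of_eventuallyEq (hV v)).fderiv
    have h4 : ∀ v : LieAlg d G, V v a = toModel v := fun v => (hV v).eq_of_nhds.trans (hid' _)
    rw [h1, h2, VectorField.lieBracketWithin_univ, VectorField.lieBracket, h3, h3, h4, h4]
    rfl
  rw [hbr, ← key]
  exact congrArg (fun T => T z) hmf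

end Adjoint

/-! ### The homogeneous space: slice charts, the Lie algebra of `H`, differentials of translations
-/

section Homogeneous

variable {d k : ℕ} {G : Type*} [TopologicalSpace G] [ChartedSpace (EuclideanSpace ℝ (Fin d)) G]
  [Group G] [LieGroup (𝓡 d) ∞ G] {H : Subgroup G}
  [ChartedSpace (EuclideanSpace ℝ (Fin k)) (G ⧸ H)]

theorem contMDiff_smul_quotient
    (hM : Manifold.IsSubmersion (𝓡 d) (𝓡 k) ∞ (QuotientGroup.mk : G → G ⧸ H)) (g : G) :
    ContMDiff (𝓡 k) (𝓡 k) ∞ (fun x : G ⧸ H => g • x) := by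
  refine contMDiff_of_comp_submersion hM Quotient.mk_surjective ?_
  exact hM.contMDiff.comp (contMDiff_mul_left (a := g))

/-- A chart of `G` near `1` in which `H` is an affine subspace. -/
theorem exists_slice_chart
    (hM : Manifold.IsSubmersion (𝓡 d) (𝓡 k) ∞ (QuotientGroup.mk : G → G ⧸ H)) :
    ∃ (φ : PartialEquiv G (EuclideanSpace ℝ (Fin d)))
      (ℓ : EuclideanSpace ℝ (Fin d) →L[ℝ] EuclideanSpace ℝ (Fin k)),
      IsOpen φ.source ∧ 1 ∈ φ.source ∧ IsOpen φ.target ∧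
      ContMDiffOn (𝓡 d) 𝓘(ℝ, EuclideanSpace ℝ (Fin d)) ∞ φ φ.source ∧
      ContMDiffOn 𝓘(ℝ, EuclideanSpace ℝ (Fin d)) (𝓡 d) ∞ φ.symm φ.target ∧
      (∀ g ∈ φ.source, ℓ (φ g) = ℓ (φ 1) ↔ g ∈ H) ∧
      ∀ X : LieAlg d G, (mfderiv (𝓡 d) (𝓡 k) (QuotientGroup.mk : G → G ⧸ H) 1 X :
        EuclideanSpace ℝ (Fin k)) = 0 →
        ℓ (mfderiv (𝓡 d) 𝓘(ℝ, EuclideanSpace ℝ (Fin d)) φ 1 X) = 0 := by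
  have h := hM.isSubmersionOfComplement_complement (1 : G)
  let φ := h.domChart.extend (𝓡 d)
  have hsrc : φ.source = h.domChart.source := OpenPartialHomeomorph.extend_source _
  let ℓ : EuclideanSpace ℝ (Fin d) →L[ℝ] EuclideanSpace ℝ (Fin k) :=
    (ContinuousLinearMap.fst ℝ (EuclideanSpace ℝ (Fin k)) hM.complement).comp
      h.equiv.toContinuousLinearMap
  -- In submersion charts `π` is the linear map `ℓ`, so near `1` the coset `H` is the affine slice
  -- `ℓ = ℓ (φ 1)`.
  have hw : ∀ g ∈ φ.source, h.codChart.extend (𝓡 k) (QuotientGroup.mk g) = ℓ (φ g) := by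
    intro g hg
    have h1 := h.writtenInCharts (φ.map_source hg)
    simp only [comp_apply] at h1
    rw [φ.left_inv hg] at h1
    exact h1
  have h1s : (1 : G) ∈ φ.source := by rw [hsrc]; exact h.mem_domChart_source
  have hcs : ∀ g ∈ φ.source,
      (QuotientGroup.mk g : G ⧸ H) ∈ (h.codChart.extend (𝓡 k)).source := by
    intro g hg
    rw [OpenPartialHomeomorph.extend_source]
    exact h.source_subset_preimage_source (hsrc ▸ hg)
  have hφ : ContMDiffOn (𝓡 d) 𝓘(ℝ, EuclideanSpace ℝ (Fin d)) ∞ φ φ.source := by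
    rw [hsrc]
    exact OpenPartialHomeomorph.contMDiffOn_extend h.domChart_mem_maximalAtlas
  have hopen : IsOpen φ.source := by rw [hsrc]; exact h.domChart.open_source
  refine ⟨φ, ℓ, hopen, h1s, h.domChart.isOpen_extend_target, hφ, ?_, ?_, ?_⟩
  · refine (contMDiffOn_extend_symm h.domChart_mem_maximalAtlas).mono ?_
    rw [OpenPartialHomeomorph.extend_target']
  · intro g hg
    rw [← hw g hg, ← hw 1 h1s, (h.codChart.extend (𝓡 k)).injOn.eq_iff (hcs g hg) (hcs 1 h1s),
      eq_comm, QuotientGroup.eq]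
    simp
  · intro X hX
    have hφd : MDifferentiableAt (𝓡 d) 𝓘(ℝ, EuclideanSpace ℝ (Fin d)) φ 1 :=
      (hφ.contMDiffAt (hopen.mem_nhds h1s)).mdifferentiableAt (by simp)
    have hcd : MDifferentiableAt (𝓡 k) 𝓘(ℝ, EuclideanSpace ℝ (Fin k)) (h.codChart.extend (𝓡 k))
        (QuotientGroup.mk (1 : G) : G ⧸ H) :=
      (OpenPartialHomeomorph.contMDiffAt_extend h.codChart_mem_maximalAtlas
        h.mem_codChart_source).mdifferentiableAt (by simp)
    have h1 := mfderiv_comp_apply (x := (1 : G)) hcd (hM.contMDiff.mdifferentiable (by simp) 1) X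
    have h2 := mfderiv_comp_apply (x := (1 : G)) (g := ℓ) ℓ.differentiable.mdifferentiable.mdifferentiableAt hφd X
    -- The last clause is the derivative at `1` of this local identity: a vector killed by `dπ` is
    -- tangent to the slice.
    have e : h.codChart.extend (𝓡 k) ∘ (QuotientGroup.mk : G → G ⧸ H) =ᶠ[𝓝 1] ℓ ∘ φ := by
      filter_upwards [hopen.mem_nhds h1s] with g hg using hw g hg
    rw [e.mfderiv_eq] at h1
    rw [mfderiv_eq_fderiv, ℓ.fderiv] at h2
    exact h2.symm.trans (h1.trans ((congrArg _ hX).trans (map_zero _)))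

/-- The curves in `H` which are affine segments, run through sinusoidally, in a slice chart. -/
theorem exists_curve_of_slice_chart {φ : PartialEquiv G (EuclideanSpace ℝ (Fin d))}
    {ℓ : EuclideanSpace ℝ (Fin d) →L[ℝ] EuclideanSpace ℝ (Fin k)} (h1 : 1 ∈ φ.source)
    (ht : IsOpen φ.target) (hφ' : ContMDiffOn 𝓘(ℝ, EuclideanSpace ℝ (Fin d)) (𝓡 d) ∞ φ.symm φ.target)
    (hH : ∀ g ∈ φ.source, ℓ (φ g) = ℓ (φ 1) ↔ g ∈ H) :
    ∃ r > 0, ∀ w, ‖w‖ < r → ℓ w = 0 →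
      (∀ t : ℝ, φ 1 + Real.sin t • w ∈ φ.target) ∧
      ContMDiff 𝓘(ℝ, ℝ) (𝓡 d) ∞ (fun t : ℝ => φ.symm (φ 1 + Real.sin t • w)) ∧
      ∀ t : ℝ, φ.symm (φ 1 + Real.sin t • w) ∈ H := by
  obtain ⟨r, hr, hball⟩ := Metric.isOpen_iff.mp ht _ (φ.map_source h1)
  refine ⟨r, hr, fun w hw hℓ => ?_⟩
  -- The sine is bounded by `1`, so the path stays in the ball for all real `t`. It also has value
  -- `0` and slope `1` at `0`, and value `1` at `π / 2`, so the curve starts at `1`, has velocity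
  -- `w` in the chart and reaches the end of the segment.
  have hmem : ∀ t : ℝ, φ 1 + Real.sin t • w ∈ φ.target := by
    intro t
    apply hball
    rw [Metric.mem_ball, dist_self_add_left, norm_smul]
    refine lt_of_le_of_lt ?_ hw
    exact mul_le_of_le_one_left (norm_nonneg w) (Real.abs_sin_le_one t)
  refine ⟨hmem, ?_, fun t => ?_⟩
  · have h2 : ContDiff ℝ ∞ (fun t : ℝ => φ 1 + Real.sin t • w) :=
      contDiff_const.add (Real.contDiff_sin.smul contDiff_const)
    intro t
    exact (hφ'.contMDiffAt (ht.mem_nhds (hmem t))).comp t h2.contMDiff.contMDiffAt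
  · rw [← hH _ (φ.map_target (hmem t)), φ.right_inv (hmem t), map_add, map_smul, hℓ]
    simp

/-- Near `1`, a subgroup with submersive quotient map is swept out by smooth curves. -/
theorem exists_curve_through
    (hM : Manifold.IsSubmersion (𝓡 d) (𝓡 k) ∞ (QuotientGroup.mk : G → G ⧸ H)) :
    ∀ᶠ h in 𝓝 (1 : G), h ∈ H → ∃ γ : ℝ → G, ContMDiff 𝓘(ℝ, ℝ) (𝓡 d) ∞ γ ∧ (∀ t, γ t ∈ H) ∧
      γ 0 = 1 ∧ γ (Real.pi / 2) = h := by
  obtain ⟨φ, ℓ, hs, h1, ht, hφ, hφ', hH, -⟩ := exists_slice_chart hM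
  obtain ⟨r, hr, hcurve⟩ := exists_curve_of_slice_chart h1 ht hφ' hH
  have hc : Tendsto φ (𝓝 1) (𝓝 (φ 1)) := (hφ.contMDiffAt (hs.mem_nhds h1)).continuousAt
  filter_upwards [hs.mem_nhds h1, hc.eventually (Metric.ball_mem_nhds _ hr)] with h hhs hhr hhH
  obtain ⟨-, h2, h3⟩ := hcurve (φ h - φ 1) (by rwa [← dist_eq_norm])
    (by rw [map_sub, (hH h hhs).mpr hhH, sub_self])
  exact ⟨_, h2, h3, by simp [φ.left_inv h1], by simp [φ.left_inv hhs]⟩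

/-- A curve in `H` is constant after `π`, and the kernel of `dπ` is a subspace, so it contains the
span of the velocities. Conversely a kernel vector is tangent to the slice chart of `H`, and a small
multiple of it is the velocity of a sinusoidal curve in `H`. -/
theorem mem_lieSubspace_iff
    (hM : Manifold.IsSubmersion (𝓡 d) (𝓡 k) ∞ (QuotientGroup.mk : G → G ⧸ H)) (X : LieAlg d G) :
    X ∈ lieSubspace d H ↔ (mfderiv (𝓡 d) (𝓡 k) (QuotientGroup.mk : G → G ⧸ H) 1 X :
      EuclideanSpace ℝ (Fin k)) = 0 := by
  constructor
  · intro hX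
    let K : Submodule ℝ (LieAlg d G) :=
      LinearMap.ker (mfderiv (𝓡 d) (𝓡 k) (QuotientGroup.mk : G → G ⧸ H) 1).toLinearMap
    suffices lieSubspace d H ≤ K from this hX
    refine Submodule.span_le.mpr ?_
    rintro Y ⟨γ, hγ, hγH, hγ0, rfl⟩
    have h1 := mfderiv_comp_apply_of_eq (x := (0 : ℝ)) (y := (1 : G))
      (hM.contMDiff.mdifferentiable (by simp) 1) (hγ.mdifferentiable (by simp) 0) hγ0 (1 : ℝ)
    have e : (QuotientGroup.mk : G → G ⧸ H) ∘ γ = fun _ => QuotientGroup.mk 1 := by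
      funext t
      exact QuotientGroup.eq.mpr (by simpa using hγH t)
    rw [e, mfderiv_const] at h1
    exact h1.symm
  · intro hX
    obtain ⟨φ, ℓ, hs, h1, ht, hφ, hφ', hH, hker⟩ := exists_slice_chart hM
    obtain ⟨r, hr, hcurve⟩ := exists_curve_of_slice_chart h1 ht hφ' hH
    have hφd : MDifferentiableAt (𝓡 d) 𝓘(ℝ, EuclideanSpace ℝ (Fin d)) φ 1 :=
      (hφ.contMDiffAt (hs.mem_nhds h1)).mdifferentiableAt (by simp)
    have hφ'd : MDifferentiableAt 𝓘(ℝ, EuclideanSpace ℝ (Fin d)) (𝓡 d) φ.symm (φ 1) :=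
      (hφ'.contMDiffAt (ht.mem_nhds (φ.map_source h1))).mdifferentiableAt (by simp)
    let w₀ : EuclideanSpace ℝ (Fin d) := mfderiv (𝓡 d) 𝓘(ℝ, EuclideanSpace ℝ (Fin d)) φ 1 X
    have hw₀ : (mfderiv 𝓘(ℝ, EuclideanSpace ℝ (Fin d)) (𝓡 d) φ.symm (φ 1) w₀ :
        EuclideanSpace ℝ (Fin d)) = toModel X := by
      have h2 := mfderiv_comp_apply (x := (1 : G)) hφ'd hφd X
      have e : φ.symm ∘ φ =ᶠ[𝓝 1] id := by
        filter_upwards [hs.mem_nhds h1] with g hg using φ.left_inv hg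
      rw [e.mfderiv_eq, mfderiv_id] at h2
      exact h2.symm
    -- The multiple must have norm below `r`; the summand `1` in the denominator covers `w₀ = 0`.
    obtain ⟨c, hc, hcr⟩ : ∃ c : ℝ, 0 < c ∧ ‖c • w₀‖ < r := by
      refine ⟨r / (2 * (‖w₀‖ + 1)), by positivity, ?_⟩
      rw [norm_smul, Real.norm_of_nonneg (by positivity), div_mul_eq_mul_div,
        div_lt_iff₀ (by positivity)]
      nlinarith [norm_nonneg w₀]
    obtain ⟨h2, h3, h4⟩ := hcurve (c • w₀) hcr (by rw [map_smul, hker X hX, smul_zero])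
    have hcX : (c • X : LieAlg d G) ∈ lieSubspace d H := by
      refine Submodule.subset_span ⟨_, h3, h4, by simp [φ.left_inv h1], ?_⟩
      have h5 : HasDerivAt (fun t : ℝ => φ 1 + Real.sin t • (c • w₀)) (c • w₀) 0 := by
        have := ((Real.hasDerivAt_sin 0).smul_const (c • w₀)).const_add (φ 1)
        simpa using this
      have h6 := mfderiv_comp_apply_of_eq (x := (0 : ℝ)) (y := φ 1) (I := 𝓘(ℝ, ℝ))
        (f := fun t : ℝ => φ 1 + Real.sin t • (c • w₀)) hφ'd
        h5.differentiableAt.mdifferentiableAt (by simp) (1 : ℝ)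
      have h7 : (mfderiv 𝓘(ℝ, ℝ) 𝓘(ℝ, EuclideanSpace ℝ (Fin d))
          (fun t : ℝ => φ 1 + Real.sin t • (c • w₀)) 0 (1 : ℝ) : EuclideanSpace ℝ (Fin d))
          = c • w₀ := by
        rw [mfderiv_eq_fderiv]
        exact h5.deriv
      refine h6.trans ?_
      refine (congrArg _ h7).trans ?_
      refine (map_smul _ c w₀).trans ?_
      exact congrArg (fun v : EuclideanSpace ℝ (Fin d) => c • v) hw₀
    have := (lieSubspace d H).smul_mem c⁻¹ hcX
    rwa [smul_smul, inv_mul_cancel₀ hc.ne', one_smul] at this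

/-- The differential at `1` of `x ↦ gxH`, as an operator of the model spaces. -/
noncomputable def translateOp (d k : ℕ) {G : Type*} [TopologicalSpace G]
    [ChartedSpace (EuclideanSpace ℝ (Fin d)) G] [Group G] (H : Subgroup G)
    [ChartedSpace (EuclideanSpace ℝ (Fin k)) (G ⧸ H)] (g : G) :
    EuclideanSpace ℝ (Fin d) →L[ℝ] EuclideanSpace ℝ (Fin k) :=
  mfderiv (𝓡 d) (𝓡 k) (fun x : G => (QuotientGroup.mk (g * x) : G ⧸ H)) 1

theorem translate_apply
    (hM : Manifold.IsSubmersion (𝓡 d) (𝓡 k) ∞ (QuotientGroup.mk : G → G ⧸ H))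
    {m : Submodule ℝ (LieAlg d G)} (g : G) (X : m) :
    (translate k H m g X : EuclideanSpace ℝ (Fin k)) = translateOp d k H g (toModel X.1) := by
  have h := mfderiv_comp_apply_of_eq (x := (1 : G)) (y := g)
    (hM.contMDiff.mdifferentiable (by simp) g) (mdifferentiable_mul_left g 1) (mul_one g) X.1
  exact h.symm

/-- The reason is `ghxH = g(hxh⁻¹)H`, since `h ∈ H`. -/
theorem translateOp_mul
    (hM : Manifold.IsSubmersion (𝓡 d) (𝓡 k) ∞ (QuotientGroup.mk : G → G ⧸ H)) (g : G) {h : G}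
    (hh : h ∈ H) (X : EuclideanSpace ℝ (Fin d)) :
    translateOp d k H (g * h) X = translateOp d k H g (adjointOp d h X) := by
  have e : (fun x : G => (QuotientGroup.mk (g * h * x) : G ⧸ H))
      = (fun x : G => (QuotientGroup.mk (g * x) : G ⧸ H)) ∘ (fun x : G => h * x * h⁻¹) := by
    funext x
    refine QuotientGroup.eq.mpr ?_
    have : (g * h * x)⁻¹ * (g * (h * x * h⁻¹)) = h⁻¹ := by group
    rw [this]
    exact H.inv_mem hh
  have hd : MDifferentiable (𝓡 d) (𝓡 k) (fun x : G => (QuotientGroup.mk (g * x) : G ⧸ H)) :=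
    (hM.contMDiff.mdifferentiable (by simp)).comp (mdifferentiable_mul_left g)
  have h := mfderiv_comp_apply_of_eq (x := (1 : G)) (y := 1) (hd 1)
    (mdifferentiable_conj h 1) (by simp) X
  rw [← e] at h
  exact h

/-- The differential of `x ↦ gx` at the base point of `G / H`. -/
noncomputable def quotientOp (d k : ℕ) {G : Type*} [TopologicalSpace G]
    [ChartedSpace (EuclideanSpace ℝ (Fin d)) G] [Group G] (H : Subgroup G)
    [ChartedSpace (EuclideanSpace ℝ (Fin k)) (G ⧸ H)] (g : G) (x : G ⧸ H) :
    EuclideanSpace ℝ (Fin k) →L[ℝ] EuclideanSpace ℝ (Fin k) :=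
  mfderiv (𝓡 k) (𝓡 k) (fun x : G ⧸ H => g • x) x

theorem quotientOp_leftInverse
    (hM : Manifold.IsSubmersion (𝓡 d) (𝓡 k) ∞ (QuotientGroup.mk : G → G ⧸ H)) (g : G) (x y : G ⧸ H)
    (hy : g • x = y) (v : EuclideanSpace ℝ (Fin k)) :
    quotientOp d k H g⁻¹ y (quotientOp d k H g x v) = v := by
  have h := mfderiv_comp_apply_of_eq (x := x) (y := y)
    ((contMDiff_smul_quotient hM g⁻¹).mdifferentiable (by simp) y)
    ((contMDiff_smul_quotient hM g).mdifferentiable (by simp) x) hy v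
  have e : (fun x : G ⧸ H => g⁻¹ • x) ∘ (fun x : G ⧸ H => g • x) = id := by
    funext x; simp
  rw [e, mfderiv_id] at h
  exact h.symm

theorem translateOp_eq
    (hM : Manifold.IsSubmersion (𝓡 d) (𝓡 k) ∞ (QuotientGroup.mk : G → G ⧸ H)) (g : G)
    (X : EuclideanSpace ℝ (Fin d)) :
    translateOp d k H g X = quotientOp d k H g (QuotientGroup.mk 1)
      (mfderiv (𝓡 d) (𝓡 k) (QuotientGroup.mk : G → G ⧸ H) 1 X) := by
  have h := mfderiv_comp_apply (x := (1 : G))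
    ((contMDiff_smul_quotient hM g).mdifferentiable (by simp) (QuotientGroup.mk 1))
    (hM.contMDiff.mdifferentiable (by simp) 1) X
  exact h

/-- `x ↦ gxH` is `π` followed by the action of `g`, whose differential is injective, so the kernel
is that of `dπ` at `1`. -/
theorem translateOp_eq_zero_iff
    (hM : Manifold.IsSubmersion (𝓡 d) (𝓡 k) ∞ (QuotientGroup.mk : G → G ⧸ H)) (g : G)
    (X : LieAlg d G) : translateOp d k H g (toModel X) = 0 ↔ X ∈ lieSubspace d H := by
  rw [mem_lieSubspace_iff hM, translateOp_eq hM]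
  constructor
  · intro h
    have := quotientOp_leftInverse hM g (QuotientGroup.mk 1) _ rfl
      (mfderiv (𝓡 d) (𝓡 k) (QuotientGroup.mk : G → G ⧸ H)
      1 X)
    rw [← this]
    exact (congrArg _ h).trans (map_zero _)
  · intro h
    exact (congrArg _ h).trans (map_zero _)

/-- The vector is moved to the base point by `g⁻¹` and lifted to `G` by the differential of a local
section of `π`. -/
theorem translateOp_surjective
    (hM : Manifold.IsSubmersion (𝓡 d) (𝓡 k) ∞ (QuotientGroup.mk : G → G ⧸ H)) (g : G) :
    Surjective (translateOp d k H g) := by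
  intro v
  obtain ⟨U, s, hU, hxU, hs, hfs, hsx⟩ :=
    exists_section_of_isSubmersionAt (hM.isSubmersionOfComplement_complement (1 : G))
  set x₀ : G ⧸ H := QuotientGroup.mk 1
  have hsd : MDifferentiableAt (𝓡 k) (𝓡 d) s x₀ :=
    (hs.contMDiffAt (hU.mem_nhds hxU)).mdifferentiableAt (by simp)
  have hy : g⁻¹ • (g • x₀) = x₀ := by simp
  let w := quotientOp d k H g⁻¹ (g • x₀) v
  let X : EuclideanSpace ℝ (Fin d) := mfderiv (𝓡 k) (𝓡 d) s x₀ w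
  refine ⟨X, ?_⟩
  have h1 := mfderiv_comp_apply_of_eq (x := x₀) (y := (1 : G))
    (hM.contMDiff.mdifferentiable (by simp) 1) hsd hsx w
  have e : (QuotientGroup.mk : G → G ⧸ H) ∘ s =ᶠ[𝓝 x₀] id := by
    filter_upwards [hU.mem_nhds hxU] with y hy using hfs y hy
  rw [e.mfderiv_eq, mfderiv_id] at h1
  rw [translateOp_eq hM]
  have h2 := quotientOp_leftInverse hM g⁻¹ (g • x₀) x₀ hy v
  rw [inv_inv] at h2
  refine Eq.trans ?_ h2
  exact congrArg (quotientOp d k H g x₀) h1.symm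

end Homogeneous

/-! ### Invariants of linear differential equations -/

section LinearODE

variable {E : Type*} [NormedAddCommGroup E] [NormedSpace ℝ E] [FiniteDimensional ℝ E]
  {D N : ℝ → E →L[ℝ] E}

/-- The solution of `D' = N D`, `D 0 = id`, preserves every subspace which is preserved by `N`. -/
theorem mem_of_linear_ode (hN : Continuous N) (hD : ∀ t, HasDerivAt D ((N t).comp (D t)) t)
    (h0 : D 0 = ContinuousLinearMap.id ℝ E) {W : Submodule ℝ E} (hW : ∀ t, ∀ v ∈ W, N t v ∈ W)
    {v : E} (hv : v ∈ W) {t : ℝ} (ht : 0 ≤ t) : D t v ∈ W := by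
  obtain ⟨W', hW'⟩ := W.exists_isCompl
  let P : E →L[ℝ] E := LinearMap.toContinuousLinearMap (W'.subtype ∘ₗ W'.projectionOnto W hW'.symm)
  have hP : ∀ u, P u = 0 ↔ u ∈ W := by
    intro u
    change ((W'.projectionOnto W hW'.symm u : W') : E) = 0 ↔ _
    rw [Submodule.coe_eq_zero, Submodule.projectionOnto_apply_eq_zero_iff]
  have hPP : ∀ u, P (P u) = P u := by
    intro u
    change ((W'.projectionOnto W hW'.symm (W'.projectionOnto W hW'.symm u : W') : W') : E) = _
    rw [Submodule.projectionOnto_apply_left]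
    rfl
  -- `P` is a projection with kernel `W`. As `N` preserves `W`, only `P u` matters for `P (N u)`, so
  -- `P (D v)` has derivative bounded by a multiple of itself and vanishes by Gronwall's inequality.
  have hPN : ∀ s u, P (N s u) = P (N s (P u)) := by
    intro s u
    rw [← sub_eq_zero, ← map_sub, ← map_sub, hP]
    apply hW
    rw [← hP, map_sub, hPP, sub_self]
  have hderiv : ∀ s, HasDerivAt (fun s => P (D s v)) (P (N s (D s v))) s := by
    intro s
    exact P.hasFDerivAt.comp_hasDerivAt s ((hD s).clm_apply (hasDerivAt_const s v) |>.congr_deriv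
      (by simp))
  obtain ⟨K, hK⟩ := (isCompact_Icc (a := (0 : ℝ)) (b := t)).exists_bound_of_continuousOn
    (f := fun s => P.comp (N s)) (continuous_const.clm_comp hN).continuousOn
  have := eq_zero_of_abs_deriv_le_mul_abs_self_of_eq_zero_right (K := K) (a := 0) (b := t)
    (f := fun s => P (D s v)) (f' := fun s => P (N s (D s v)))
    (fun s _ => (hderiv s).continuousAt.continuousWithinAt)
    (fun s _ => (hderiv s).hasDerivWithinAt) (by rw [h0]; exact (hP v).mpr hv)
    (fun s hs => by
      rw [hPN]
      exact (P.comp (N s)).le_of_opNorm_le (hK s ⟨hs.1, hs.2.le⟩) _) t ⟨ht, le_rfl⟩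
  exact (hP _).mp this

/-- The solution of `D' = N D`, `D 0 = id`, preserves every bilinear form which is invariant
under `N`. -/
theorem bilin_eq_of_linear_ode (hD : ∀ t, HasDerivAt D ((N t).comp (D t)) t)
    (h0 : D 0 = ContinuousLinearMap.id ℝ E) (B : E →ₗ[ℝ] E →ₗ[ℝ] ℝ) {u v : E}
    (hB : ∀ t, B (N t (D t u)) (D t v) + B (D t u) (N t (D t v)) = 0) (t : ℝ) :
    B (D t u) (D t v) = B u v := by
  let B' : E →L[ℝ] E →L[ℝ] ℝ := LinearMap.toContinuousLinearMap
    ((LinearMap.toContinuousLinearMap : (E →ₗ[ℝ] ℝ) ≃ₗ[ℝ] (E →L[ℝ] ℝ)).toLinearMap ∘ₗ B)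
  have hd : ∀ w s, HasDerivAt (fun s => D s w) (N s (D s w)) s := fun w s =>
    ((hD s).clm_apply (hasDerivAt_const s w)).congr_deriv (by simp)
  have h1 : ∀ s, HasDerivAt (fun s => B' (D s u) (D s v)) 0 s := by
    intro s
    have h2 : HasDerivAt (fun s => B' (D s u)) (B' (N s (D s u))) s :=
      B'.hasFDerivAt.comp_hasDerivAt s (hd u s)
    exact (h2.clm_apply (hd v s)).congr_deriv (hB s)
  have h3 := is_const_of_deriv_eq_zero (fun s => (h1 s).differentiableAt)
    (fun s => (h1 s).deriv) t 0
  rw [h0] at h3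
  exact h3

end LinearODE

/-- The Lie algebra as the model vector space. -/
noncomputable def modelEquiv (d : ℕ) (G : Type*) [TopologicalSpace G]
    [ChartedSpace (EuclideanSpace ℝ (Fin d)) G] [Group G] :
    LieAlg d G ≃ₗ[ℝ] EuclideanSpace ℝ (Fin d) where
  toFun := toModel
  invFun v := v
  map_add' _ _ := rfl
  map_smul' _ _ := rfl
  left_inv _ := rfl
  right_inv _ := rfl

theorem mem_map_modelEquiv {d : ℕ} {G : Type*} [TopologicalSpace G]
    [ChartedSpace (EuclideanSpace ℝ (Fin d)) G] [Group G] {m : Submodule ℝ (LieAlg d G)} (X : LieAlg d G) :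
    toModel X ∈ m.map (modelEquiv d G).toLinearMap ↔ X ∈ m := by
  constructor
  · rintro ⟨Y, hY, h⟩
    have : Y = X := (modelEquiv d G).injective h
    exact this ▸ hY
  · intro h
    exact ⟨X, h, rfl⟩

/-! ### `Ad(H)` preserves `𝔪` and `ω₀` -/

section Isotropy

variable {d k : ℕ} {G : Type*} [TopologicalSpace G] [ChartedSpace (EuclideanSpace ℝ (Fin d)) G]
  [Group G] [LieGroup (𝓡 d) ∞ G]

/-- The curve `s ↦ γ(t + s) γ(t)⁻¹` lies in `H` and starts at `1`, so its velocity `Z` belongs to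
`𝔥`. Moreover `Ad(γ(s)) Ad(γ(t))⁻¹` is `Ad` along this curve at time `s - t`, whose derivative is
`ad Z`. -/
theorem exists_velocity_adjointOp {H : Subgroup G} {γ : ℝ → G}
    (hγ : ContMDiff 𝓘(ℝ, ℝ) (𝓡 d) ∞ γ) (hH : ∀ t, γ t ∈ H) (t : ℝ) :
    ∃ Z ∈ lieSubspace d H, ∀ X : LieAlg d G,
      HasDerivAt (fun s => adjointOp d (γ s) (adjointOp d (γ t)⁻¹ (toModel X)))
        (toModel ⁅Z, X⁆) t := by
  have : IsManifold (𝓡 d) ∞ G := LieGroup.toContMDiffMul.toIsManifold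
  let c : ℝ → G := fun s => γ (t + s) * (γ t)⁻¹
  have hc : ContMDiff 𝓘(ℝ, ℝ) (𝓡 d) ∞ c :=
    (hγ.comp (contDiff_const.add contDiff_id).contMDiff).mul contMDiff_const
  have hc0 : c 0 = 1 := by simp [c]
  let Z : LieAlg d G := (mfderiv 𝓘(ℝ, ℝ) (𝓡 d) c 0 (1 : ℝ) : EuclideanSpace ℝ (Fin d))
  refine ⟨Z, Submodule.subset_span ⟨c, hc, fun s => H.mul_mem (hH _) (H.inv_mem (hH _)), hc0, rfl⟩,
    fun X => ?_⟩
  have hA : ContMDiff (𝓡 d) 𝓘(ℝ, EuclideanSpace ℝ (Fin d)) ∞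
      (fun g : G => adjointOp d g (toModel X)) :=
    (contMDiff_adjointOp (G := G)).clm_apply contMDiff_const
  have h1 : HasDerivAt ((fun g : G => adjointOp d g (toModel X)) ∘ c) (toModel ⁅Z, X⁆) 0 := by
    have h2 : HasMFDerivAt 𝓘(ℝ, ℝ) (𝓡 d) c 0
        ((1 : ℝ →L[ℝ] ℝ).smulRight (mfderiv 𝓘(ℝ, ℝ) (𝓡 d) c 0 (1 : ℝ))) := by
      refine (hc.mdifferentiable (by simp) 0).hasMFDerivAt.congr_mfderiv ?_
      apply ContinuousLinearMap.ext
      intro s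
      have h4 := (mfderiv 𝓘(ℝ, ℝ) (𝓡 d) c 0).map_smul s (1 : ℝ)
      refine Eq.trans ?_ h4
      exact congrArg (mfderiv 𝓘(ℝ, ℝ) (𝓡 d) c 0) (mul_one (M := ℝ) s).symm
    have h5 := hasDerivAt_comp_curve (hA.mdifferentiable (by simp) (c 0)) h2
    rw [← mfderiv_adjointOp Z X]
    refine h5.congr_deriv ?_
    rw [hc0]
    rfl
  have h6 : HasDerivAt (fun s : ℝ => s - t) 1 t := (hasDerivAt_id t).sub_const t
  have h7 := HasDerivAt.scomp (h := fun s : ℝ => s - t) t (by rwa [sub_self]) h6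
  rw [one_smul] at h7
  refine h7.congr_of_eventuallyEq (Eventually.of_forall fun s => ?_)
  change adjointOp d (γ s) (adjointOp d (γ t)⁻¹ (toModel X))
    = adjointOp d (γ (t + (s - t)) * (γ t)⁻¹) (toModel X)
  rw [add_sub_cancel, adjointOp_mul]
  rfl

variable {H : Subgroup G} {m : Submodule ℝ (LieAlg d G)} {ω₀ : LinearMap.BilinForm ℝ m}

/-- `D = Ad ∘ γ` solves `D' = N D` with `N = D' D⁻¹`, and `N t` is `ad Z` for some `Z ∈ 𝔥` by the
preceding lemma. The infinitesimal hypotheses thus become statements about `N`. -/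
theorem exists_linear_ode_adjointOp {γ : ℝ → G} (hγ : ContMDiff 𝓘(ℝ, ℝ) (𝓡 d) ∞ γ)
    (hH : ∀ t, γ t ∈ H) :
    ∃ N : ℝ → EuclideanSpace ℝ (Fin d) →L[ℝ] EuclideanSpace ℝ (Fin d), Continuous N ∧
      (∀ t, HasDerivAt (fun s => adjointOp d (γ s)) ((N t).comp (adjointOp d (γ t))) t) ∧
      ∀ t, ∃ Z ∈ lieSubspace d H, ∀ X : LieAlg d G, N t (toModel X) = toModel ⁅Z, X⁆ := by
  have hD : ContDiff ℝ ∞ (fun s => adjointOp d (γ s)) :=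
    (contMDiff_adjointOp.comp hγ).contDiff
  have hD' : ContDiff ℝ ∞ (fun s => adjointOp d (γ s)⁻¹) :=
    (contMDiff_adjointOp.comp hγ.inv).contDiff
  have hd : ∀ t, HasDerivAt (fun s => adjointOp d (γ s)) (deriv (fun s => adjointOp d (γ s)) t) t :=
    fun t => (hD.differentiable (by simp) t).hasDerivAt
  refine ⟨fun t => (deriv (fun s => adjointOp d (γ s)) t).comp (adjointOp d (γ t)⁻¹),
    (hD.continuous_deriv (by exact_mod_cast le_top)).clm_comp hD'.continuous, fun t => ?_,
    fun t => ?_⟩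
  · rw [ContinuousLinearMap.comp_assoc, ← adjointOp_mul, inv_mul_cancel, adjointOp_one,
      ContinuousLinearMap.comp_id]
    exact hd t
  · obtain ⟨Z, hZ, h⟩ := exists_velocity_adjointOp hγ hH t
    refine ⟨Z, hZ, fun X => ?_⟩
    have h1 := (hd t).clm_apply (hasDerivAt_const t (adjointOp d (γ t)⁻¹ (toModel X)))
    exact (h1.congr_deriv (by simp)).unique (h X)

theorem IsSymplecticSymmetric.adjoint_curve_mem (hs : IsSymplecticSymmetric H m ω₀) {γ : ℝ → G}
    (hγ : ContMDiff 𝓘(ℝ, ℝ) (𝓡 d) ∞ γ) (hH : ∀ t, γ t ∈ H) (h0 : γ 0 = 1) (t : ℝ) :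
    ∀ X ∈ m, adjoint (γ t) X ∈ m := by
  intro X hX
  -- The invariance of subspaces is available for nonnegative times; negative times follow from the
  -- reversed curve.
  wlog ht : 0 ≤ t generalizing γ t
  · have := this (γ := fun s => γ (-s)) (hγ.comp contDiff_neg.contMDiff) (fun s => hH _)
      (by simpa using h0) (-t) (by linarith)
    rwa [neg_neg] at this
  obtain ⟨N, hN, hD, hZ⟩ := exists_linear_ode_adjointOp hγ hH
  have hNW : ∀ t, ∀ v ∈ m.map (modelEquiv d G).toLinearMap,
      N t v ∈ m.map (modelEquiv d G).toLinearMap := by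
    rintro s _ ⟨Y, hY, rfl⟩
    obtain ⟨Z, hZh, hZ⟩ := hZ s
    have h1 : N s (toModel Y) ∈ m.map (modelEquiv d G).toLinearMap := by
      rw [hZ, mem_map_modelEquiv]
      exact hs.lie_h_m Z hZh Y hY
    exact h1
  rw [← mem_map_modelEquiv]
  exact mem_of_linear_ode (D := fun s => adjointOp d (γ s)) hN hD (by rw [h0, adjointOp_one]) hNW
    ((mem_map_modelEquiv X).mpr hX) ht

theorem IsSymplecticSymmetric.adjoint_curve (hs : IsSymplecticSymmetric H m ω₀) {γ : ℝ → G}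
    (hγ : ContMDiff 𝓘(ℝ, ℝ) (𝓡 d) ∞ γ) (hH : ∀ t, γ t ∈ H) (h0 : γ 0 = 1) (t : ℝ) (X Y X' Y' : m)
    (hX : adjoint (γ t) X.1 = X'.1) (hY : adjoint (γ t) Y.1 = Y'.1) : ω₀ X' Y' = ω₀ X Y := by
  obtain ⟨N, hN, hD, hZ⟩ := exists_linear_ode_adjointOp hγ hH
  -- The conservation lemma needs a form on the whole space, so `ω₀` is extended through the
  -- projection `Q` to `𝔪` along `𝔥`. The extension is only evaluated on vectors of `𝔪`, where `Q`
  -- does nothing.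
  let Q : EuclideanSpace ℝ (Fin d) →ₗ[ℝ] m :=
    m.projectionOnto _ hs.isCompl.symm ∘ₗ (modelEquiv d G).symm.toLinearMap
  have hQ : ∀ (Z : LieAlg d G) (hZ : Z ∈ m), Q (toModel Z) = ⟨Z, hZ⟩ := fun Z hZ =>
    Submodule.projectionOnto_apply_left hs.isCompl.symm ⟨Z, hZ⟩
  have hm := fun s => hs.adjoint_curve_mem hγ hH h0 s
  have h1 := bilin_eq_of_linear_ode (D := fun s => adjointOp d (γ s)) (u := toModel X.1)
    (v := toModel Y.1) hD (by rw [h0, adjointOp_one]) (ω₀.compl₁₂ Q Q) (fun s => by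
      obtain ⟨Z, hZh, hZ⟩ := hZ s
      have hA : ∀ X : m, N s (adjointOp d (γ s) (toModel X.1)) = toModel ⁅Z, adjoint (γ s) X.1⁆ :=
        fun X => hZ (adjoint (γ s) X.1)
      have hB : ∀ X : m, adjointOp d (γ s) (toModel X.1) = toModel (adjoint (γ s) X.1) :=
        fun X => rfl
      rw [LinearMap.compl₁₂_apply, LinearMap.compl₁₂_apply, hA, hA, hB, hB,
        hQ _ (hm s X X.2), hQ _ (hm s Y Y.2), hQ _ (hs.lie_h_m Z hZh _ (hm s X X.2)),
        hQ _ (hs.lie_h_m Z hZh _ (hm s Y Y.2))]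
      exact hs.invariant Z hZh ⟨_, hm s X X.2⟩ ⟨_, hm s Y Y.2⟩) t
  have hB : ∀ X X' : m, adjoint (γ t) X.1 = X'.1 → Q (adjointOp d (γ t) (toModel X.1)) = X' := by
    intro X X' h
    exact (congrArg (fun Z => Q (toModel Z)) h).trans (hQ X' X'.2)
  rw [LinearMap.compl₁₂_apply, LinearMap.compl₁₂_apply, hB X X' hX, hB Y Y' hY, hQ _ X.2,
    hQ _ Y.2] at h1
  exact h1

theorem adjoint_one (X : LieAlg d G) : adjoint (1 : G) X = X :=
  congrArg (fun T => T (toModel X)) (adjointOp_one (d := d) (G := G))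

theorem adjoint_mul (g h : G) (X : LieAlg d G) : adjoint (g * h) X = adjoint g (adjoint h X) :=
  congrArg (fun T => T (toModel X)) (adjointOp_mul (d := d) g h)

variable [ChartedSpace (EuclideanSpace ℝ (Fin k)) (G ⧸ H)]

/-- The subgroup of the elements whose adjoint action preserves `𝔪` and `ω₀`. -/
def isotropyStabilizer (ω₀ : LinearMap.BilinForm ℝ m) : Subgroup G where
  carrier := {h | (∀ X : m, adjoint h X.1 ∈ m ∧ adjoint h⁻¹ X.1 ∈ m) ∧
    ∀ X Y X' Y' : m, adjoint h X.1 = X'.1 → adjoint h Y.1 = Y'.1 → ω₀ X' Y' = ω₀ X Y}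
  one_mem' := by
    refine ⟨fun X => by simp [adjoint_one], fun X Y X' Y' hX hY => ?_⟩
    rw [adjoint_one] at hX hY
    rw [Subtype.ext hX, Subtype.ext hY]
  mul_mem' := by
    rintro a b ⟨ha, ha'⟩ ⟨hb, hb'⟩
    refine ⟨fun X => ⟨?_, ?_⟩, fun X Y X' Y' hX hY => ?_⟩
    · rw [adjoint_mul]
      exact (ha ⟨_, (hb X).1⟩).1
    · rw [mul_inv_rev, adjoint_mul]
      exact (hb ⟨_, (ha X).2⟩).2
    · rw [adjoint_mul] at hX hY
      rw [ha' ⟨_, (hb X).1⟩ ⟨_, (hb Y).1⟩ X' Y' hX hY]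
      exact hb' X Y _ _ rfl rfl
  inv_mem' := by
    rintro a ⟨ha, ha'⟩
    refine ⟨fun X => ⟨(ha X).2, by rw [inv_inv]; exact (ha X).1⟩, fun X Y X' Y' hX hY => ?_⟩
    refine (ha' X' Y' X Y ?_ ?_).symm
    · rw [← hX, ← adjoint_mul, mul_inv_cancel, adjoint_one]
    · rw [← hY, ← adjoint_mul, mul_inv_cancel, adjoint_one]

/-- If `h ∈ H` is near `1`, then `h` and `h⁻¹` are joined to `1` by smooth curves in `H`, and `h`
lies in the stabilizer by the linear equation. The stabilizer thus meets `H` in an open, hence also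
closed, subgroup, which is all of the connected group `H`. -/
theorem IsSymplecticSymmetric.le_isotropyStabilizer (hs : IsSymplecticSymmetric H m ω₀)
    (hM : Manifold.IsSubmersion (𝓡 d) (𝓡 k) ∞ (QuotientGroup.mk : G → G ⧸ H)) :
    H ≤ isotropyStabilizer ω₀ := by
  have : IsTopologicalGroup G := topologicalGroup_of_lieGroup (𝓡 d) ∞
  have h1 : ∀ᶠ h : H in 𝓝 (1 : H), (Subtype.val h : G) ∈ isotropyStabilizer ω₀ := by
    have h2 := exists_curve_through hM
    have h3 : Tendsto (fun h : H => (h : G)) (𝓝 1) (𝓝 1) := continuous_subtype_val.tendsto (1 : H)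
    have h4 := h3.eventually h2
    have h5 : Tendsto (fun h : H => ((h⁻¹ : H) : G)) (𝓝 1) (𝓝 1) := by
      have := h3.comp (continuous_inv.tendsto' (1 : H) 1 inv_one)
      exact this
    filter_upwards [h4, h5.eventually h2] with h h6 h7
    obtain ⟨γ, hγ, hγH, hγ0, hγh⟩ := h6 h.2
    obtain ⟨γ', hγ', hγH', hγ0', hγh'⟩ := h7 (h⁻¹).2
    refine ⟨fun X => ⟨?_, ?_⟩, fun X Y X' Y' hX hY => ?_⟩
    · rw [← hγh]
      exact hs.adjoint_curve_mem hγ hγH hγ0 _ X X.2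
    · have := hs.adjoint_curve_mem hγ' hγH' hγ0' (Real.pi / 2) X X.2
      rw [hγh'] at this
      exact this
    · rw [← hγh] at hX hY
      exact hs.adjoint_curve hγ hγH hγ0 _ X Y X' Y' hX hY
  have : ConnectedSpace H := isConnected_iff_connectedSpace.mp hs.isConnected
  have h2 : IsOpen (((isotropyStabilizer ω₀).subgroupOf H : Subgroup H) : Set H) :=
    Subgroup.isOpen_of_mem_nhds _ h1
  have h3 : IsClosed (((isotropyStabilizer ω₀).subgroupOf H : Subgroup H) : Set H) :=
    Subgroup.isClosed_of_isOpen _ h2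
  have h4 := IsClopen.eq_univ ⟨h3, h2⟩ ⟨1, one_mem _⟩
  intro h hh
  have : (⟨h, hh⟩ : H) ∈ (((isotropyStabilizer ω₀).subgroupOf H : Subgroup H) : Set H) := by
    rw [h4]; trivial
  exact this

end Isotropy

theorem contMDiffAt_of_operator_representation {l : ℕ} {K : Type*} [TopologicalSpace K]
    [ChartedSpace (EuclideanSpace ℝ (Fin l)) K] [Group K] [LieGroup (𝓡 l) ∞ K]
    {V : Type*} [NormedAddCommGroup V] [NormedSpace ℝ V] [FiniteDimensional ℝ V]
    {J : K →* (V →L[ℝ] V)} (hJ : ContMDiff (𝓡 l) 𝓘(ℝ, V →L[ℝ] V) ∞ J)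
    (hloc : ∀ᶠ q in 𝓝 (1 : K), J q = 1 → q = 1)
    {E N H' : Type*} [NormedAddCommGroup E] [NormedSpace ℝ E] [TopologicalSpace H']
    {I : ModelWithCorners ℝ E H'} [TopologicalSpace N] [ChartedSpace H' N]
    {f : N → K} {x : N} (hf : ContinuousAt f x) (hJf : ContMDiffAt I 𝓘(ℝ, V →L[ℝ] V) ∞ (J ∘ f) x) :
    ContMDiffAt I (𝓡 l) ∞ f x := by
  have h := contMDiffAt_of_representation (W := V →L[ℝ] V) (K := K) (l := l) (J := J) (I := I) (f := f) (x := x)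
  exact h hJ hloc hf hJf
-- The symplectic group as operators of a normed space; smoothness of maps to `Mp`
section Model

variable {d : ℕ} {G : Type*} [TopologicalSpace G] [ChartedSpace (EuclideanSpace ℝ (Fin d)) G]
  [Group G]

instance : FiniteDimensional ℝ (LieAlg d G) :=
  inferInstanceAs (FiniteDimensional ℝ (EuclideanSpace ℝ (Fin d)))

instance : T2Space (LieAlg d G) :=
  inferInstanceAs (T2Space (EuclideanSpace ℝ (Fin d)))

variable (m : Submodule ℝ (LieAlg d G))

/-- The subspace `𝔪`, as a subspace of the model vector space. -/
noncomputable abbrev modelSubspace : Submodule ℝ (EuclideanSpace ℝ (Fin d)) :=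
  m.map (modelEquiv d G).toLinearMap

/-- The identity of `𝔪`, as a map to a normed space. -/
noncomputable def subspaceEquiv : m ≃L[ℝ] modelSubspace m :=
  ((modelEquiv d G).submoduleMap m).toContinuousLinearEquiv

variable {m} {ω₀ : LinearMap.BilinForm ℝ m}

/-- The symplectic group as a group of operators of a normed space. -/
noncomputable def spOp (ω₀ : LinearMap.BilinForm ℝ m) :
    Sp ω₀ →* (modelSubspace m →L[ℝ] modelSubspace m) where
  toFun A := (subspaceEquiv m).arrowCongr (subspaceEquiv m) A.1.1
  map_one' := by
    apply ContinuousLinearMap.ext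
    intro v
    change subspaceEquiv m ((subspaceEquiv m).symm v) = v
    exact (subspaceEquiv m).apply_symm_apply v
  map_mul' A B := by
    apply ContinuousLinearMap.ext
    intro v
    change _ = subspaceEquiv m (A.1.1 ((subspaceEquiv m).symm (subspaceEquiv m
      (B.1.1 ((subspaceEquiv m).symm v)))))
    rw [ContinuousLinearEquiv.symm_apply_apply]
    rfl

theorem spOp_apply (A : Sp ω₀) (v : modelSubspace m) :
    spOp ω₀ A v = subspaceEquiv m (A.1.1 ((subspaceEquiv m).symm v)) := rfl

theorem spOp_injective : Injective (spOp ω₀) := by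
  intro A B h
  apply Subtype.ext
  apply Units.ext
  exact ((subspaceEquiv m).arrowCongr (subspaceEquiv m)).injective h

/-- An element of the symplectic group as an automorphism of a normed space. -/
noncomputable def spEquiv (A : Sp ω₀) : modelSubspace m ≃L[ℝ] modelSubspace m :=
  ContinuousLinearEquiv.equivOfInverse (spOp ω₀ A) (spOp ω₀ A⁻¹)
    (fun v => by
      have h : spOp ω₀ A⁻¹ * spOp ω₀ A = 1 := by rw [← map_mul, inv_mul_cancel, map_one]
      exact congrArg (fun T => T v) h)
    (fun v => by
      have h : spOp ω₀ A * spOp ω₀ A⁻¹ = 1 := by rw [← map_mul, mul_inv_cancel, map_one]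
      exact congrArg (fun T => T v) h)

theorem inverse_spOp (A : Sp ω₀) : ContinuousLinearMap.inverse (spOp ω₀ A) = spOp ω₀ A⁻¹ :=
  ContinuousLinearMap.inverse_equiv (spEquiv A)

/-- The topology of `Sp` is that of a group of units, in which the inverse must converge too. This
comes for free because inversion of operators is continuous at an invertible one. -/
theorem continuousAt_sp {N : Type*} [TopologicalSpace N] {f : N → Sp ω₀} {x : N}
    (h : ContinuousAt (fun n => spOp ω₀ (f n)) x) : ContinuousAt f x := by
  have hA : ∀ {g : N → Sp ω₀}, ContinuousAt (fun n => spOp ω₀ (g n)) x →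
      ContinuousAt (fun n => (g n).1.1) x := by
    intro g hg
    have h1 := ((subspaceEquiv m).arrowCongr (subspaceEquiv m)).symm.continuous.continuousAt.comp hg
    refine h1.congr (Eventually.of_forall fun n => ?_)
    exact ((subspaceEquiv m).arrowCongr (subspaceEquiv m)).symm_apply_apply _
  have hinv : ContinuousAt (fun n => spOp ω₀ (f n)⁻¹) x := by
    simp only [← inverse_spOp]
    exact ContinuousAt.comp (f := fun n => spOp ω₀ (f n))
      (contDiffAt_map_inverse (n := 0) (spEquiv (f x))).continuousAt h
  have h4 : ContinuousAt (fun n => (f n).1) x := by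
    rw [Units.isInducing_embedProduct.continuousAt_iff]
    exact (hA h).prodMk (MulOpposite.continuous_op.continuousAt.comp (hA hinv))
  exact Topology.IsInducing.subtypeVal.continuousAt_iff.mpr h4

variable {l : ℕ} {Mp : Type*} [TopologicalSpace Mp] [ChartedSpace (EuclideanSpace ℝ (Fin l)) Mp]
  [Group Mp] {ρ : Mp →* Sp ω₀}

/-- Smoothness of each `q ↦ ρ(q) X` suffices in finite dimension. The values lie in the ambient
space, and the linear retraction `R` onto the subspace brings them back to it. -/
theorem IsConnectedDoubleCover.contMDiff_spOp (hρ : IsConnectedDoubleCover l ρ) :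
    ContMDiff (𝓡 l) 𝓘(ℝ, modelSubspace m →L[ℝ] modelSubspace m) ∞ ((spOp ω₀).comp ρ) := by
  obtain ⟨R, hR⟩ := LinearMap.exists_leftInverse_of_injective (modelSubspace m).subtype
    (Submodule.ker_subtype _)
  let R' : EuclideanSpace ℝ (Fin d) →L[ℝ] modelSubspace m := LinearMap.toContinuousLinearMap R
  intro q
  refine contMDiffAt_clm_of_apply fun v => ?_
  have h1 := R'.contDiff.contMDiff.comp (hρ.smooth ((subspaceEquiv m).symm v))
  have e : (fun y => ((spOp ω₀).comp ρ) y v) = R' ∘ fun q : Mp =>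
      toModel (((ρ q).1.1 ((subspaceEquiv m).symm v)).1) := by
    funext y
    exact (congrArg (fun T => T (spOp ω₀ (ρ y) v)) hR).symm
  rw [e]
  exact h1 q

/-- A covering map is a local homeomorphism, and passing from `Sp` to operators loses nothing. -/
theorem IsConnectedDoubleCover.spOp_locally_injective (hρ : IsConnectedDoubleCover l ρ) :
    ∀ᶠ q in 𝓝 (1 : Mp), ((spOp ω₀).comp ρ) q = 1 → q = 1 := by
  obtain ⟨e, he, heq⟩ := hρ.covering.isLocalHomeomorph (1 : Mp)
  filter_upwards [e.open_source.mem_nhds he] with q hq h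
  refine e.injOn hq he ?_
  rw [← heq, map_one]
  exact spOp_injective (h.trans (map_one _).symm)

theorem IsConnectedDoubleCover.surjective (hρ : IsConnectedDoubleCover l ρ) : Surjective ρ := by
  intro A
  have h := hρ.two_sheeted A
  have : (ρ ⁻¹' {A}).Nonempty := Set.nonempty_of_ncard_ne_zero (by rw [h]; norm_num)
  exact this

/-- A continuous map to `Mp(𝔪)` is smooth if its projection to `Sp(𝔪)` is smooth. -/
theorem IsConnectedDoubleCover.contMDiffAt [LieGroup (𝓡 l) ∞ Mp] (hρ : IsConnectedDoubleCover l ρ)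
    {E N H' : Type*} [NormedAddCommGroup E] [NormedSpace ℝ E] [TopologicalSpace H']
    {I : ModelWithCorners ℝ E H'} [TopologicalSpace N] [ChartedSpace H' N]
    {f : N → Mp} {x : N} (hf : ContinuousAt f x)
    (hJf : ContMDiffAt I 𝓘(ℝ, modelSubspace m →L[ℝ] modelSubspace m) ∞
      (fun n => spOp ω₀ (ρ (f n))) x) : ContMDiffAt I (𝓡 l) ∞ f x := by
  let J : Mp →* (modelSubspace m →L[ℝ] modelSubspace m) := (spOp ω₀).comp ρ
  have h1 : ContMDiff (𝓡 l) 𝓘(ℝ, modelSubspace m →L[ℝ] modelSubspace m) ∞ J := hρ.contMDiff_spOp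
  have h2 : ∀ᶠ q in 𝓝 (1 : Mp), J q = 1 → q = 1 := hρ.spOp_locally_injective
  have h3 : ContMDiffAt I 𝓘(ℝ, modelSubspace m →L[ℝ] modelSubspace m) ∞ (J ∘ f) x := hJf
  exact contMDiffAt_of_operator_representation (V := modelSubspace m) (J := J) h1 h2 hf h3

variable [LieGroup (𝓡 d) ∞ G] {H : Subgroup G}

/-- A lift of the isotropy representation is smooth. -/
theorem IsotropyLift.contMDiffAt_comp [LieGroup (𝓡 l) ∞ Mp] (hρ : IsConnectedDoubleCover l ρ)
    (κ' : IsotropyLift H ρ)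
    {E N H' : Type*} [NormedAddCommGroup E] [NormedSpace ℝ E] [TopologicalSpace H']
    {I : ModelWithCorners ℝ E H'} [TopologicalSpace N] [ChartedSpace H' N]
    {f : N → H} {x : N} (hf : ContMDiffAt I (𝓡 d) ∞ (fun n => (f n : G)) x) :
    ContMDiffAt I (𝓡 l) ∞ (fun n => κ'.hom (f n)) x := by
  refine hρ.contMDiffAt ?_ (contMDiffAt_clm_of_apply fun v => ?_)
  · exact κ'.hom.continuous_toFun.continuousAt.comp
      (Topology.IsInducing.subtypeVal.continuousAt_iff.mpr hf.continuousAt)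
  obtain ⟨R, hR⟩ := LinearMap.exists_leftInverse_of_injective (modelSubspace m).subtype
    (Submodule.ker_subtype _)
  let R' : EuclideanSpace ℝ (Fin d) →L[ℝ] modelSubspace m := LinearMap.toContinuousLinearMap R
  have h1 : ContMDiffAt I 𝓘(ℝ, EuclideanSpace ℝ (Fin d)) ∞
      (fun n => adjointOp d (f n : G) (v : EuclideanSpace ℝ (Fin d))) x :=
    ((contMDiff_adjointOp (f x : G)).comp x hf).clm_apply contMDiffAt_const
  have h2 := R'.contDiff.contMDiff.contMDiffAt.comp x h1
  -- After `ρ` the lift becomes the restriction of `Ad` to `𝔪`, and `Ad` is smooth on `G`.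
  have e : (fun n => spOp ω₀ (ρ (κ'.hom (f n))) v) = R' ∘ fun n =>
      adjointOp d (f n : G) (v : EuclideanSpace ℝ (Fin d)) := by
    funext n
    have h3 := congrArg (fun T => T (spOp ω₀ (ρ (κ'.hom (f n))) v)) hR
    refine h3.symm.trans (congrArg R' ?_)
    have h4 := κ'.lifts (f n) ((subspaceEquiv m).symm v)
    exact h4
  rw [e]
  exact h2

end Model

/-! ### Coordinates of the tangent bundle -/

section TangentCoordinates

variable {k : ℕ} {M : Type*} [TopologicalSpace M] [ChartedSpace (EuclideanSpace ℝ (Fin k)) M]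
  [IsManifold (𝓡 k) ∞ M]

/-- The change of coordinates of the tangent bundle, from the preferred chart at `x` to that at
`x₀`. -/
noncomputable def tangentCoord (x₀ x : M) :
    EuclideanSpace ℝ (Fin k) →L[ℝ] EuclideanSpace ℝ (Fin k) :=
  (tangentBundleCore (𝓡 k) M).coordChange (achart _ x) (achart _ x₀) x

theorem tangentCoord_leftInverse {x₀ x : M}
    (hx : x ∈ (chartAt (EuclideanSpace ℝ (Fin k)) x₀).source) (v : EuclideanSpace ℝ (Fin k)) :
    (tangentBundleCore (𝓡 k) M).coordChange (achart _ x₀) (achart _ x) x (tangentCoord x₀ x v)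
      = v := by
  rw [tangentCoord, (tangentBundleCore (𝓡 k) M).coordChange_comp,
    (tangentBundleCore (𝓡 k) M).coordChange_self]
  · exact mem_chart_source _ x
  · exact ⟨⟨mem_chart_source _ x, hx⟩, mem_chart_source _ x⟩

theorem tangentCoord_self (x : M) (v : EuclideanSpace ℝ (Fin k)) : tangentCoord x x v = v :=
  (tangentBundleCore (𝓡 k) M).coordChange_self _ _ (mem_chart_source _ x) v

theorem contMDiffAt_tangentBundle_iff {E N H' : Type*} [NormedAddCommGroup E] [NormedSpace ℝ E]
    [TopologicalSpace H'] {I : ModelWithCorners ℝ E H'} [TopologicalSpace N] [ChartedSpace H' N]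
    {x : N → M} {u : N → EuclideanSpace ℝ (Fin k)} {n₀ : N} :
    ContMDiffAt I (𝓡 k).tangent ∞ (fun n => (⟨x n, u n⟩ : TangentBundle (𝓡 k) M)) n₀ ↔
      ContMDiffAt I (𝓡 k) ∞ x n₀ ∧
        ContMDiffAt I 𝓘(ℝ, EuclideanSpace ℝ (Fin k)) ∞
          (fun n => tangentCoord (x n₀) (x n) (u n)) n₀ :=
  Bundle.contMDiffAt_totalSpace

end TangentCoordinates

/-- If `C` and `C'` are two frames written in fixed coordinates, this recovers the group element `S`
between them by an expression whose smoothness is visible. -/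
theorem inverse_comp_comp_of_isInvertible {V F : Type*} [NormedAddCommGroup V] [NormedSpace ℝ V]
    [NormedAddCommGroup F] [NormedSpace ℝ F] {C : V →L[ℝ] F} (hC : C.IsInvertible) {C' : V →L[ℝ] F}
    {S : V →L[ℝ] V} (h : C' = C.comp S) : C.inverse.comp C' = S := by
  obtain ⟨e, rfl⟩ := hC
  rw [h, ContinuousLinearMap.inverse_equiv, ← ContinuousLinearMap.comp_assoc,
    e.coe_symm_comp_coe, ContinuousLinearMap.id_comp]

theorem isInvertible_of_inverses {V F : Type*} [NormedAddCommGroup V] [NormedSpace ℝ V]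
    [NormedAddCommGroup F] [NormedSpace ℝ F] (C : V →L[ℝ] F) (C' : F →L[ℝ] V)
    (h : ∀ v, C' (C v) = v) (h' : ∀ v, C (C' v) = v) : C.IsInvertible :=
  ⟨ContinuousLinearEquiv.equivOfInverse C C' h h', rfl⟩

/-! ### Symplectic frames and smooth families of them -/

section Frames

variable {d k : ℕ} {G : Type*} [TopologicalSpace G] [ChartedSpace (EuclideanSpace ℝ (Fin d)) G]
  [Group G] {H : Subgroup G} [ChartedSpace (EuclideanSpace ℝ (Fin k)) (G ⧸ H)]
  {m : Submodule ℝ (LieAlg d G)} {ω₀ : LinearMap.BilinForm ℝ m}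

theorem SymplecticFrame.ext_vec {f f' : SymplecticFrame k H ω₀} (hb : f.base = f'.base)
    (h : ∀ X, f.vec X = f'.vec X) : f = f' := by
  obtain ⟨b, T, hT⟩ := f
  obtain ⟨b', T', hT'⟩ := f'
  obtain rfl : b = b' := hb
  obtain rfl : T = T' := by
    apply ContinuousLinearEquiv.ext
    funext X
    have h1 := h X
    simpa [SymplecticFrame.vec] using h1
  rfl

/-- A frame, as a map between the model spaces. -/
noncomputable def SymplecticFrame.op (f : SymplecticFrame k H ω₀) :
    modelSubspace m →L[ℝ] EuclideanSpace ℝ (Fin k) :=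
  f.toLin.toContinuousLinearMap.comp (subspaceEquiv m).symm.toContinuousLinearMap

/-- The inverse of a frame, as a map between the model spaces. -/
noncomputable def SymplecticFrame.opInv (f : SymplecticFrame k H ω₀) :
    EuclideanSpace ℝ (Fin k) →L[ℝ] modelSubspace m :=
  (subspaceEquiv m).toContinuousLinearMap.comp f.toLin.symm.toContinuousLinearMap

theorem SymplecticFrame.opInv_op (f : SymplecticFrame k H ω₀) (v : modelSubspace m) :
    f.opInv (f.op v) = v := by
  change subspaceEquiv m (f.toLin.symm (f.toLin ((subspaceEquiv m).symm v))) = v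
  rw [ContinuousLinearEquiv.symm_apply_apply, ContinuousLinearEquiv.apply_symm_apply]

theorem SymplecticFrame.op_opInv (f : SymplecticFrame k H ω₀) (v : EuclideanSpace ℝ (Fin k)) :
    f.op (f.opInv v) = v := by
  change f.toLin ((subspaceEquiv m).symm (subspaceEquiv m (f.toLin.symm v))) = v
  rw [ContinuousLinearEquiv.symm_apply_apply]
  exact f.toLin.apply_symm_apply v

theorem SymplecticFrame.op_act (f : SymplecticFrame k H ω₀) (A : Sp ω₀) (v : modelSubspace m) :
    (f.act A).op v = f.op (spOp ω₀ A v) := by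
  change _ = f.toLin ((subspaceEquiv m).symm (subspaceEquiv m (A.1.1 ((subspaceEquiv m).symm v))))
  rw [ContinuousLinearEquiv.symm_apply_apply]
  rfl

/-- Two frames at the same point differ by an element of the symplectic group. -/
theorem SymplecticFrame.exists_act_eq (f f' : SymplecticFrame k H ω₀) (hb : f.base = f'.base) :
    ∃ A : Sp ω₀, f.act A = f' := by
  obtain ⟨b, T, hT⟩ := f
  obtain ⟨b', T', hT'⟩ := f'
  obtain rfl : b = b' := hb
  refine ⟨⟨(ContinuousLinearEquiv.unitsEquiv ℝ m).symm (T'.trans T.symm), fun X Y => ?_⟩, ?_⟩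
  · change ω₀ (T.symm (T' X)) (T.symm (T' Y)) = _
    rw [← hT, T.apply_symm_apply, T.apply_symm_apply, hT']
  · refine SymplecticFrame.ext_vec rfl fun X => ?_
    change (⟨b, T (T.symm (T' X))⟩ : TangentBundle (𝓡 k) (G ⧸ H)) = ⟨b, T' X⟩
    rw [T.apply_symm_apply]

theorem SymplecticFrame.act_injective (f : SymplecticFrame k H ω₀) : Injective f.act := by
  intro A B h
  apply spOp_injective
  apply ContinuousLinearMap.ext
  intro v
  have h1 := f.op_act A v
  rw [h, f.op_act] at h1
  have h2 := congrArg f.opInv h1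
  rw [f.opInv_op, f.opInv_op] at h2
  exact h2.symm

theorem SymplecticFrame.act_mul (f : SymplecticFrame k H ω₀) (A B : Sp ω₀) :
    f.act (A * B) = (f.act A).act B :=
  SymplecticFrame.ext_vec rfl fun _ => rfl

section Smooth

variable [IsManifold (𝓡 k) ∞ (G ⧸ H)] {E N H' : Type*} [NormedAddCommGroup E] [NormedSpace ℝ E]
  [TopologicalSpace H'] {I : ModelWithCorners ℝ E H'} [TopologicalSpace N] [ChartedSpace H' N]

theorem SymplecticFrame.contMDiffAt_coord {f : N → SymplecticFrame k H ω₀} {n₀ : N}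
    (hf : ∀ X, ContMDiffAt I (𝓡 k).tangent ∞ (fun n => (f n).vec X) n₀) :
    ContMDiffAt I 𝓘(ℝ, modelSubspace m →L[ℝ] EuclideanSpace ℝ (Fin k)) ∞
      (fun n => (tangentCoord (f n₀).base (f n).base).comp (f n).op) n₀ := by
  refine contMDiffAt_clm_of_apply fun v => ?_
  have h1 := hf ((subspaceEquiv m).symm v)
  exact (contMDiffAt_tangentBundle_iff (x := fun n => (f n).base)
    (u := fun n => (f n).op v)).mp h1 |>.2

theorem SymplecticFrame.continuousAt_base {f : N → SymplecticFrame k H ω₀} {n₀ : N}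
    (hf : ∀ X, ContMDiffAt I (𝓡 k).tangent ∞ (fun n => (f n).vec X) n₀) :
    ContinuousAt (fun n => (f n).base) n₀ := by
  -- Any vector would do, as only the base point of the image is used.
  have h1 := hf ((subspaceEquiv m).symm 0)
  exact (contMDiffAt_tangentBundle_iff (x := fun n => (f n).base)
    (u := fun n => (f n).op 0)).mp h1 |>.1.continuousAt

/-- The element of the symplectic group by which two smooth frames differ is smooth. -/
theorem SymplecticFrame.contMDiffAt_of_act_eq {f f' : N → SymplecticFrame k H ω₀} {A : N → Sp ω₀}
    {n₀ : N} (hf : ∀ X, ContMDiffAt I (𝓡 k).tangent ∞ (fun n => (f n).vec X) n₀)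
    (hf' : ∀ X, ContMDiffAt I (𝓡 k).tangent ∞ (fun n => (f' n).vec X) n₀)
    (hA : ∀ᶠ n in 𝓝 n₀, (f n).act (A n) = f' n) :
    ContMDiffAt I 𝓘(ℝ, modelSubspace m →L[ℝ] modelSubspace m) ∞ (fun n => spOp ω₀ (A n)) n₀ := by
  have h1 := SymplecticFrame.contMDiffAt_coord hf
  have h2 := SymplecticFrame.contMDiffAt_coord hf'
  let e : modelSubspace m ≃L[ℝ] EuclideanSpace ℝ (Fin k) :=
    ContinuousLinearEquiv.equivOfInverse (f n₀).op (f n₀).opInv (f n₀).opInv_op (f n₀).op_opInv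
  have he : (tangentCoord (f n₀).base (f n₀).base).comp (f n₀).op = e :=
    ContinuousLinearMap.ext fun v => tangentCoord_self _ _
  -- In the tangent coordinates at `(f n₀).base` the frames are operators between fixed spaces. At
  -- `n₀` the operator is the invertible `e`, where inversion is smooth, and `A n` is the inverse of
  -- the first frame composed with the second.
  have h3 : ContMDiffAt I 𝓘(ℝ, EuclideanSpace ℝ (Fin k) →L[ℝ] modelSubspace m) ∞
      (fun n => ContinuousLinearMap.inverse ((tangentCoord (f n₀).base (f n).base).comp (f n).op))
      n₀ := by
    refine ContMDiffAt.comp n₀ (g := ContinuousLinearMap.inverse) ?_ h1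
    rw [he]
    exact (contDiffAt_map_inverse e).contMDiffAt
  refine (h3.clm_comp h2).congr_of_eventuallyEq ?_
  filter_upwards [hA, (SymplecticFrame.continuousAt_base hf).eventually
    ((chartAt (EuclideanSpace ℝ (Fin k)) (f n₀).base).open_source.mem_nhds
      (mem_chart_source _ _))] with n hn hn'
  have hb : (f' n).base = (f n).base := by rw [← hn]; rfl
  have hb0 : (f' n₀).base = (f n₀).base := by rw [← hA.self_of_nhds]; rfl
  obtain ⟨T, hT⟩ : ∃ T : EuclideanSpace ℝ (Fin k) →L[ℝ] EuclideanSpace ℝ (Fin k), ∀ v,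
      T (tangentCoord (f n₀).base (f n).base v) = v := ⟨_, tangentCoord_leftInverse hn'⟩
  -- In finite dimension a left inverse is also a right inverse.
  have hT' : ∀ v, tangentCoord (f n₀).base (f n).base (T v) = v := by
    have h6 := mul_eq_one_comm.mp (show ((T.toLinearMap : Module.End ℝ (EuclideanSpace ℝ (Fin k))) *
      (tangentCoord (f n₀).base (f n).base).toLinearMap) = 1 from LinearMap.ext hT)
    exact fun v => congrArg (fun T => T v) h6
  have hC : ((tangentCoord (f n₀).base (f n).base).comp (f n).op).IsInvertible := by
    refine isInvertible_of_inverses _ ((f n).opInv.comp T) (fun v => ?_) (fun v => ?_)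
    · change (f n).opInv (T (tangentCoord (f n₀).base (f n).base ((f n).op v))) = v
      rw [hT, (f n).opInv_op]
    · change tangentCoord (f n₀).base (f n).base ((f n).op ((f n).opInv (T v))) = v
      rw [(f n).op_opInv, hT']
  refine (inverse_comp_comp_of_isInvertible hC ?_).symm
  apply ContinuousLinearMap.ext
  intro v
  change tangentCoord (f' n₀).base (f' n).base ((f' n).op v)
    = tangentCoord (f n₀).base (f n).base ((f n).op (spOp ω₀ (A n) v))
  rw [hb, hb0, ← (f n).op_act (A n) v, hn]

theorem SymplecticFrame.contMDiffAt_act {f : N → SymplecticFrame k H ω₀} {A : N → Sp ω₀}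
    {n₀ : N} (hf : ∀ X, ContMDiffAt I (𝓡 k).tangent ∞ (fun n => (f n).vec X) n₀)
    (hA : ContMDiffAt I 𝓘(ℝ, modelSubspace m →L[ℝ] modelSubspace m) ∞
      (fun n => spOp ω₀ (A n)) n₀) (X : m) :
    ContMDiffAt I (𝓡 k).tangent ∞ (fun n => ((f n).act (A n)).vec X) n₀ := by
  have hb : ContMDiffAt I (𝓡 k) ∞ (fun n => (f n).base) n₀ :=
    (contMDiffAt_tangentBundle_iff (x := fun n => (f n).base)
      (u := fun n => (f n).op 0)).mp (hf ((subspaceEquiv m).symm 0)) |>.1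
  refine (contMDiffAt_tangentBundle_iff (x := fun n => (f n).base)
    (u := fun n => ((f n).act (A n)).toLin X)).mpr ⟨hb, ?_⟩
  have h1 := (SymplecticFrame.contMDiffAt_coord hf).clm_apply
    (hA.clm_apply (contMDiffAt_const (c := subspaceEquiv m X)))
  refine h1.congr_of_eventuallyEq (Eventually.of_forall fun n => ?_)
  refine congrArg (tangentCoord (f n₀).base (f n).base) ?_
  refine Eq.trans ?_ ((f n).op_act (A n) (subspaceEquiv m X))
  change _ = ((f n).act (A n)).toLin ((subspaceEquiv m).symm (subspaceEquiv m X))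
  rw [ContinuousLinearEquiv.symm_apply_apply]

end Smooth

end Frames

/-! ### The frames `[g, 1]` -/

section TranslateFrame

variable {d k : ℕ} {G : Type*} [TopologicalSpace G] [ChartedSpace (EuclideanSpace ℝ (Fin d)) G]
  [Group G] [LieGroup (𝓡 d) ∞ G] {H : Subgroup G}
  [ChartedSpace (EuclideanSpace ℝ (Fin k)) (G ⧸ H)]
  {m : Submodule ℝ (LieAlg d G)} {ω₀ : LinearMap.BilinForm ℝ m}

theorem tangentBundle_mk_eq {M : Type*} [TopologicalSpace M]
    [ChartedSpace (EuclideanSpace ℝ (Fin k)) M] {x y : M} {v w : EuclideanSpace ℝ (Fin k)}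
    (h : x = y) (h' : v = w) :
    (⟨x, v⟩ : TangentBundle (𝓡 k) M) = (⟨y, w⟩ : TangentBundle (𝓡 k) M) := by
  subst h h'
  rfl

/-- The map `x ↦ gxH` has surjective differential at `1` with kernel `𝔥`, and `𝔪` is a complement of
`𝔥`. -/
theorem translate_bijective (hs : IsSymplecticSymmetric H m ω₀)
    (hM : Manifold.IsSubmersion (𝓡 d) (𝓡 k) ∞ (QuotientGroup.mk : G → G ⧸ H)) (g : G) :
    Bijective (translate k H m g) := by
  constructor
  · rw [injective_iff_map_eq_zero]
    intro X hX
    have h1 : translateOp d k H g (toModel X.1) = 0 := (translate_apply hM g X).symm.trans hX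
    rw [translateOp_eq_zero_iff hM] at h1
    exact Subtype.ext (Submodule.disjoint_def.mp hs.isCompl.disjoint _ h1 X.2)
  · intro v
    obtain ⟨Y, hY⟩ := translateOp_surjective hM g v
    let Y' : LieAlg d G := Y
    obtain ⟨Z, hZ, X, hX, hZX⟩ := Submodule.mem_sup.mp
      (show Y' ∈ lieSubspace d H ⊔ m by rw [hs.isCompl.sup_eq_top]; trivial)
    refine ⟨⟨X, hX⟩, (translate_apply hM g ⟨X, hX⟩).trans ?_⟩
    have h1 := (translateOp_eq_zero_iff hM g Z).mpr hZ
    have h2 := (translateOp d k H g).map_add (toModel Z) (toModel X)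
    rw [h1, zero_add] at h2
    refine h2.symm.trans (Eq.trans ?_ hY)
    exact congrArg (fun W => translateOp d k H g (toModel W)) hZX

instance (x : G ⧸ H) : FiniteDimensional ℝ (TangentSpace (𝓡 k) x) :=
  inferInstanceAs (FiniteDimensional ℝ (EuclideanSpace ℝ (Fin k)))

instance (x : G ⧸ H) : T2Space (TangentSpace (𝓡 k) x) :=
  inferInstanceAs (T2Space (EuclideanSpace ℝ (Fin k)))

/-- The isomorphism `X ↦ dπ (dL_g X)` from `𝔪` to the tangent space at `gH`. -/
noncomputable def translateEquiv (hs : IsSymplecticSymmetric H m ω₀)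
    (hM : Manifold.IsSubmersion (𝓡 d) (𝓡 k) ∞ (QuotientGroup.mk : G → G ⧸ H)) (g : G) :
    m ≃L[ℝ] TangentSpace (𝓡 k) (QuotientGroup.mk g : G ⧸ H) :=
  (LinearEquiv.ofBijective (translate k H m g).toLinearMap
    (translate_bijective hs hM g)).toContinuousLinearEquiv

theorem coe_translateEquiv (hs : IsSymplecticSymmetric H m ω₀)
    (hM : Manifold.IsSubmersion (𝓡 d) (𝓡 k) ∞ (QuotientGroup.mk : G → G ⧸ H)) (g : G) :
    (translateEquiv hs hM g : m →L[ℝ] TangentSpace (𝓡 k) (QuotientGroup.mk g : G ⧸ H))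
      = translate k H m g := rfl

theorem translate_mul
    (hM : Manifold.IsSubmersion (𝓡 d) (𝓡 k) ∞ (QuotientGroup.mk : G → G ⧸ H)) (g : G) {h : G}
    (hh : h ∈ H) (X X' : m) (hX : adjoint h X.1 = X'.1) :
    (translate k H m (g * h) X : EuclideanSpace ℝ (Fin k)) = translate k H m g X' := by
  refine (translate_apply hM _ X).trans ((translateOp_mul hM g hh _).trans ?_)
  refine Eq.trans ?_ (translate_apply hM g X').symm
  exact congrArg (fun W => translateOp d k H g (toModel W)) hX

theorem inverse_translate (hs : IsSymplecticSymmetric H m ω₀)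
    (hM : Manifold.IsSubmersion (𝓡 d) (𝓡 k) ∞ (QuotientGroup.mk : G → G ⧸ H)) (g : G) (X : m) :
    (translate k H m g).inverse (translate k H m g X) = X := by
  rw [← coe_translateEquiv hs hM, ContinuousLinearMap.inverse_equiv]
  exact (translateEquiv hs hM g).symm_apply_apply X

/-- `omega` is defined with a chosen representative `g'` of the coset. Here `g = g' h⁻¹` with `h ∈
H`, the two identifications of `𝔪` with the tangent space differ by `Ad(h⁻¹)`, and this operator
preserves `ω₀`. -/
theorem omega_translate (hs : IsSymplecticSymmetric H m ω₀)
    (hM : Manifold.IsSubmersion (𝓡 d) (𝓡 k) ∞ (QuotientGroup.mk : G → G ⧸ H)) (g : G) (X Y : m) :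
    omega k ω₀ (QuotientGroup.mk g) (translate k H m g X) (translate k H m g Y) = ω₀ X Y := by
  obtain ⟨h, hh⟩ := QuotientGroup.mk_out_eq_mul H g
  set g' := (QuotientGroup.mk g : G ⧸ H).out with hg'
  have hgg : g = g' * (h : G)⁻¹ := by rw [hh, mul_inv_cancel_right]
  obtain ⟨hmem, hform⟩ := hs.le_isotropyStabilizer hM (H.inv_mem h.2)
  have key : ∀ X : m, (translate k H m g').inverse
      (translate k H m g X : EuclideanSpace ℝ (Fin k)) = ⟨_, (hmem X).1⟩ := by
    intro X
    refine Eq.trans ?_ (inverse_translate hs hM g' ⟨_, (hmem X).1⟩)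
    have h1 := translate_mul hM g' (H.inv_mem h.2) X ⟨_, (hmem X).1⟩ rfl
    rw [← hgg] at h1
    exact congrArg (fun w : EuclideanSpace ℝ (Fin k) => (translate k H m g').inverse w) h1
  have h2 : omega k ω₀ (QuotientGroup.mk g) (translate k H m g X) (translate k H m g Y)
      = ω₀ ⟨_, (hmem X).1⟩ ⟨_, (hmem Y).1⟩ := by
    rw [← key X, ← key Y]
    rfl
  exact h2.trans (hform X Y _ _ rfl rfl)

/-- The frame `[g, 1]` at `gH`. -/
noncomputable def translateFrame (hs : IsSymplecticSymmetric H m ω₀)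
    (hM : Manifold.IsSubmersion (𝓡 d) (𝓡 k) ∞ (QuotientGroup.mk : G → G ⧸ H)) (g : G) :
    SymplecticFrame k H ω₀ where
  base := QuotientGroup.mk g
  toLin := translateEquiv hs hM g
  symplectic X Y := omega_translate hs hM g X Y

theorem translateFrame_mul (hs : IsSymplecticSymmetric H m ω₀)
    (hM : Manifold.IsSubmersion (𝓡 d) (𝓡 k) ∞ (QuotientGroup.mk : G → G ⧸ H)) (g : G) {h : G}
    (hh : h ∈ H) (A : Sp ω₀) (hA : ∀ X : m, (A.1.1 X).1 = adjoint h X.1) :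
    translateFrame hs hM (g * h) = (translateFrame hs hM g).act A := by
  have hb : (QuotientGroup.mk (g * h) : G ⧸ H) = QuotientGroup.mk g :=
    QuotientGroup.eq.mpr (by simpa using H.inv_mem hh)
  refine SymplecticFrame.ext_vec hb fun X => ?_
  exact tangentBundle_mk_eq hb (translate_mul hM g hh X (A.1.1 X) (hA X).symm)

/-- Injectivity of the translation at `g` allows the element `A` to be recovered from the frames.
Thus a lift of frames from `g` to `gh` is the same as a lift of the isotropy operator `κ(h)`. -/
theorem translateFrame_act_iff (hs : IsSymplecticSymmetric H m ω₀)
    (hM : Manifold.IsSubmersion (𝓡 d) (𝓡 k) ∞ (QuotientGroup.mk : G → G ⧸ H))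
    {g h : G} (hh : h ∈ H) (A : Sp ω₀) :
    (translateFrame hs hM g).act A = translateFrame hs hM (g * h) ↔
      ∀ X : m, (A.1.1 X).1 = adjoint h X.1 := by
  constructor
  · intro hA X
    have h1 := ((hs.le_isotropyStabilizer hM hh).1 X).1
    have h2 := translate_mul hM g hh X ⟨_, h1⟩ rfl
    have h3 : (translate k H m (g * h) X : EuclideanSpace ℝ (Fin k))
        = translate k H m g (A.1.1 X) := by
      have h4 := (translateFrame hs hM g).op_act A (subspaceEquiv m X)
      rw [hA] at h4
      have h5 : ∀ (g : G) (X : m), (translateFrame hs hM g).op (subspaceEquiv m X)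
          = (translate k H m g X : EuclideanSpace ℝ (Fin k)) := by
        intro g X
        change (translate k H m g ((subspaceEquiv m).symm (subspaceEquiv m X)) :
          EuclideanSpace ℝ (Fin k)) = _
        rw [ContinuousLinearEquiv.symm_apply_apply]
      rw [h5, spOp_apply, ContinuousLinearEquiv.symm_apply_apply, h5] at h4
      exact h4
    have h6 := (translate_bijective hs hM g).1 (h3.symm.trans h2)
    exact congrArg Subtype.val h6
  · intro hA
    exact (translateFrame_mul hs hM g hh A hA).symm

/-- The frame `[g, 1]` is the derivative in `x` at `1` of `(g, x) ↦ gxH`, a smooth map of both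
variables. The rest identifies the tangent coordinates used on both sides; those of `G` are taken at
the constant point `1` and are trivial. -/
theorem contMDiff_translateFrame [IsManifold (𝓡 k) ∞ (G ⧸ H)]
    (hs : IsSymplecticSymmetric H m ω₀)
    (hM : Manifold.IsSubmersion (𝓡 d) (𝓡 k) ∞ (QuotientGroup.mk : G → G ⧸ H)) (X : m) :
    ContMDiff (𝓡 d) (𝓡 k).tangent ∞ (fun g : G => (translateFrame hs hM g).vec X) := by
  have : IsManifold (𝓡 d) ∞ G := LieGroup.toContMDiffMul.toIsManifold
  intro g₀
  have hf : ContMDiff ((𝓡 d).prod (𝓡 d)) (𝓡 k) ∞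
      (uncurry fun (g x : G) => (QuotientGroup.mk (g * x) : G ⧸ H)) :=
    hM.contMDiff.comp (contMDiff_fst.mul contMDiff_snd)
  have h := ContMDiffAt.mfderiv (m := ∞) (n := ∞) (x₀ := g₀)
    (fun g x : G => (QuotientGroup.mk (g * x) : G ⧸ H))
    (fun _ => (1 : G)) hf.contMDiffAt contMDiffAt_const (by simp)
  have hg : ContinuousAt (fun g : G => (QuotientGroup.mk (g * 1) : G ⧸ H)) g₀ :=
    (hM.contMDiff.comp (contMDiff_mul_right (I := 𝓡 d) (n := ∞) (a := (1 : G)))).continuous.continuousAt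
  have e : inTangentCoordinates (𝓡 d) (𝓡 k) (fun _ : G => (1 : G))
      (fun g : G => (QuotientGroup.mk (g * 1) : G ⧸ H)) (fun g => translateOp d k H g) g₀
      =ᶠ[𝓝 g₀] fun g => (tangentCoord (QuotientGroup.mk g₀ : G ⧸ H) (QuotientGroup.mk g)).comp
        (translateOp d k H g) := by
    filter_upwards [hg.eventually ((chartAt (EuclideanSpace ℝ (Fin k))
      (QuotientGroup.mk (g₀ * 1) : G ⧸ H)).open_source.mem_nhds (mem_chart_source _ _))] with g hg'
    refine (inTangentCoordinates_eq (I := 𝓡 d) (I' := 𝓡 k) (fun _ : G => (1 : G))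
      (fun g : G => (QuotientGroup.mk (g * 1) : G ⧸ H)) (fun g => translateOp d k H g)
      (mem_chart_source _ _) hg').trans ?_
    apply ContinuousLinearMap.ext
    intro v
    change (tangentBundleCore (𝓡 k) (G ⧸ H)).coordChange (achart _ (QuotientGroup.mk (g * 1)))
      (achart _ (QuotientGroup.mk (g₀ * 1))) (QuotientGroup.mk (g * 1))
      (translateOp d k H g ((tangentBundleCore (𝓡 d) G).coordChange _ _ _ v))
      = tangentCoord _ _ (translateOp d k H g v)
    rw [(tangentBundleCore (𝓡 d) G).coordChange_self _ _ (mem_chart_source _ _), mul_one, mul_one]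
    rfl
  have h1 := (ContMDiffAt.congr_of_eventuallyEq h e.symm).clm_apply
    (contMDiffAt_const (c := toModel X.1))
  refine (contMDiffAt_tangentBundle_iff (x := fun g : G => (QuotientGroup.mk g : G ⧸ H))
    (u := fun g => translateOp d k H g (toModel X.1))).mpr ⟨hM.contMDiff g₀, h1⟩
    |>.congr_of_eventuallyEq (Eventually.of_forall fun g => ?_)
  exact tangentBundle_mk_eq rfl (translate_apply hM g X)

end TranslateFrame

theorem mk_mul_mem {G : Type*} [Group G] {H : Subgroup G} (g : G) (h : H) :
    (QuotientGroup.mk (g * h) : G ⧸ H) = QuotientGroup.mk g :=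
  QuotientGroup.mk_mul_of_mem g h.2

/-! ### Local sections of `G → G / H` -/

section LocalSections

variable {d k : ℕ} {G : Type*} [TopologicalSpace G] [ChartedSpace (EuclideanSpace ℝ (Fin d)) G]
  [Group G] {H : Subgroup G} [ChartedSpace (EuclideanSpace ℝ (Fin k)) (G ⧸ H)]

/-- A section of `G → G / H` which is smooth on an open set. -/
structure LocalSection (d k : ℕ) {G : Type*} [TopologicalSpace G]
    [ChartedSpace (EuclideanSpace ℝ (Fin d)) G] [Group G] (H : Subgroup G)
    [ChartedSpace (EuclideanSpace ℝ (Fin k)) (G ⧸ H)] where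
  domain : Set (G ⧸ H)
  isOpen_domain : IsOpen domain
  toFun : G ⧸ H → G
  mk_toFun : ∀ x, (QuotientGroup.mk (toFun x) : G ⧸ H) = x
  smooth : ContMDiffOn (𝓡 k) (𝓡 d) ∞ toFun domain

theorem exists_localSection
    (hM : Manifold.IsSubmersion (𝓡 d) (𝓡 k) ∞ (QuotientGroup.mk : G → G ⧸ H)) (x : G ⧸ H) :
    ∃ s : LocalSection d k H, x ∈ s.domain := by
  classical
  obtain ⟨g, rfl⟩ := QuotientGroup.mk_surjective x
  obtain ⟨U, s, hU, hxU, hs, hfs, -⟩ :=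
    exists_section_of_isSubmersionAt (hM.isSubmersionOfComplement_complement g)
  -- Outside `U` an arbitrary representative is used. The section is then defined everywhere, so
  -- that every `g` has an `H`-coordinate, and smoothness is only claimed on `U`.
  refine ⟨⟨U, hU, fun y => if y ∈ U then s y else y.out, fun y => ?_, hs.congr fun y hy => ?_⟩, hxU⟩
  · by_cases hy : y ∈ U
    · simp only [hy, if_true]
      exact hfs y hy
    · simp only [hy, if_false]
      exact QuotientGroup.out_eq' y
  · simp only [hy, if_true]

/-- The element `h` of `H` with `g = s(gH) h`. -/
def LocalSection.coord (s : LocalSection d k H) (g : G) : H :=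
  ⟨(s.toFun (QuotientGroup.mk g))⁻¹ * g, QuotientGroup.eq.mp (s.mk_toFun _)⟩

theorem LocalSection.mul_coord (s : LocalSection d k H) (g : G) :
    s.toFun (QuotientGroup.mk g) * s.coord g = g := by
  simp [LocalSection.coord]

theorem LocalSection.coord_mul (s : LocalSection d k H) (g : G) (h : H) :
    s.coord (g * h) = s.coord g * h := by
  apply Subtype.ext
  simp [LocalSection.coord, mul_assoc]

theorem LocalSection.coord_toFun (s : LocalSection d k H) (x : G ⧸ H) :
    s.coord (s.toFun x) = 1 := by
  apply Subtype.ext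
  simp [LocalSection.coord, s.mk_toFun]

theorem LocalSection.contMDiffOn_coord [LieGroup (𝓡 d) ∞ G] (s : LocalSection d k H)
    (hM : Manifold.IsSubmersion (𝓡 d) (𝓡 k) ∞ (QuotientGroup.mk : G → G ⧸ H)) :
    ContMDiffOn (𝓡 d) (𝓡 d) ∞ (fun g : G => (s.coord g : G)) (QuotientGroup.mk ⁻¹' s.domain) :=
  (s.smooth.comp hM.contMDiff.contMDiffOn fun _ hg => hg).inv.mul contMDiffOn_id

theorem LocalSection.isOpen_preimage (s : LocalSection d k H)
    (hM : Manifold.IsSubmersion (𝓡 d) (𝓡 k) ∞ (QuotientGroup.mk : G → G ⧸ H)) :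
    IsOpen ((QuotientGroup.mk : G → G ⧸ H) ⁻¹' s.domain) :=
  s.isOpen_domain.preimage hM.contMDiff.continuous

end LocalSections

/-! ### The associated bundle `G ×_κ̃ Mp` as a metaplectic structure -/

section AssocBundle

variable {d k l : ℕ} {G : Type*} [TopologicalSpace G]
  [ChartedSpace (EuclideanSpace ℝ (Fin d)) G] [Group G] {H : Subgroup G}
  [ChartedSpace (EuclideanSpace ℝ (Fin k)) (G ⧸ H)]
  {m : Submodule ℝ (LieAlg d G)} {ω₀ : LinearMap.BilinForm ℝ m}
  {Mp : Type*} [TopologicalSpace Mp] [ChartedSpace (EuclideanSpace ℝ (Fin l)) Mp] [Group Mp]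
  {ρ : Mp →* Sp ω₀} (κ' : IsotropyLift H ρ)

theorem IsotropyLift.cls_eq (g : G) (h : H) (q : Mp) :
    κ'.cls (g * h, q) = κ'.cls (g, κ'.hom h * q) := by
  refine Quotient.sound ⟨h⁻¹, ?_⟩
  simp

theorem IsotropyLift.cls_surjective : Surjective κ'.cls := Quotient.mk_surjective

/-- The projection `[g, q] ↦ gH`. -/
def IsotropyLift.assocProj : κ'.AssocBundle → G ⧸ H :=
  Quotient.lift (fun a : G × Mp => (QuotientGroup.mk a.1 : G ⧸ H)) (by
    rintro a b ⟨h, rfl⟩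
    exact (mk_mul_mem a.1 h).symm)

/-- The action `[g, q] q' = [g, q q']`. -/
def IsotropyLift.assocAct (p : κ'.AssocBundle) (q' : Mp) : κ'.AssocBundle :=
  Quotient.map (fun a : G × Mp => (a.1, a.2 * q')) (by
    rintro a b ⟨h, rfl⟩
    exact ⟨h, by simp [mul_assoc]⟩) p

/-- The trivialization of the associated bundle over the domain of a section of `G → G / H`. -/
def IsotropyLift.assocCoord (s : LocalSection d k H) : κ'.AssocBundle → (G ⧸ H) × Mp :=
  Quotient.lift (fun a : G × Mp => ((QuotientGroup.mk a.1 : G ⧸ H), κ'.hom (s.coord a.1) * a.2)) (by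
    rintro a b ⟨h, rfl⟩
    dsimp only
    rw [mk_mul_mem, s.coord_mul, map_mul, mul_assoc, mul_inv_cancel_left])

variable {κ'}

theorem IsotropyLift.assocCoord_leftInverse (s : LocalSection d k H) (p : κ'.AssocBundle) :
    κ'.cls (s.toFun (κ'.assocCoord s p).1, (κ'.assocCoord s p).2) = p := by
  obtain ⟨a, rfl⟩ := κ'.cls_surjective p
  change κ'.cls (s.toFun (QuotientGroup.mk a.1), κ'.hom (s.coord a.1) * a.2) = _
  rw [← κ'.cls_eq, s.mul_coord]

theorem IsotropyLift.assocCoord_rightInverse (s : LocalSection d k H) (y : (G ⧸ H) × Mp) :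
    κ'.assocCoord s (κ'.cls (s.toFun y.1, y.2)) = y := by
  change ((QuotientGroup.mk (s.toFun y.1) : G ⧸ H), κ'.hom (s.coord (s.toFun y.1)) * y.2) = _
  rw [s.mk_toFun, s.coord_toFun, map_one, one_mul]

/-- The saturation of an open set is the union of its translates by the homeomorphisms belonging to
the elements of `H`. Openness of the quotient map lets continuity at a point be tested on `G × Mp`.
-/
theorem IsotropyLift.isOpenQuotientMap_cls [IsTopologicalGroup G] [IsTopologicalGroup Mp]
    (κ' : IsotropyLift H ρ) :
    IsOpenQuotientMap κ'.cls := by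
  refine ⟨κ'.cls_surjective, continuous_quotient_mk', fun O hO => ?_⟩
  change IsOpen (κ'.cls ⁻¹' (κ'.cls '' O))
  have e : κ'.cls ⁻¹' (κ'.cls '' O)
      = ⋃ h : H, (fun a : G × Mp => (a.1 * (h : G), (κ'.hom h)⁻¹ * a.2)) ⁻¹' O := by
    ext a
    simp only [mem_preimage, mem_image, mem_iUnion]
    constructor
    · rintro ⟨b, hb, hba⟩
      obtain ⟨h, rfl⟩ : ∃ h : H, b = (a.1 * h, (κ'.hom h)⁻¹ * a.2) :=
        Quotient.exact (s := κ'.setoid) hba.symm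
      exact ⟨h, hb⟩
    · rintro ⟨h, hh⟩
      exact ⟨_, hh, (Quotient.sound (s := κ'.setoid) (show κ'.setoid.r a _ from ⟨h, rfl⟩)).symm⟩
  rw [e]
  exact isOpen_iUnion fun h => hO.preimage (by fun_prop)

variable [LieGroup (𝓡 d) ∞ G] [LieGroup (𝓡 l) ∞ Mp]

/-- The frame `[g, ρ(q)]`. -/
noncomputable def IsotropyLift.assocFrame (κ' : IsotropyLift H ρ)
    (hs : IsSymplecticSymmetric H m ω₀)
    (hM : Manifold.IsSubmersion (𝓡 d) (𝓡 k) ∞ (QuotientGroup.mk : G → G ⧸ H)) :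
    κ'.AssocBundle → SymplecticFrame k H ω₀ :=
  Quotient.lift (fun a : G × Mp => (translateFrame hs hM a.1).act (ρ a.2)) (by
    rintro a b ⟨h, rfl⟩
    dsimp only
    rw [translateFrame_mul hs hM a.1 h.2 (ρ (κ'.hom h)) (fun X => κ'.lifts h X),
      ← SymplecticFrame.act_mul, ← map_mul, mul_inv_cancel_left])

theorem IsotropyLift.contMDiffAt_hom_coord (hρ : IsConnectedDoubleCover l ρ)
    (κ' : IsotropyLift H ρ) (s : LocalSection d k H)
    (hM : Manifold.IsSubmersion (𝓡 d) (𝓡 k) ∞ (QuotientGroup.mk : G → G ⧸ H)) {g : G}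
    (hg : QuotientGroup.mk g ∈ s.domain) :
    ContMDiffAt (𝓡 d) (𝓡 l) ∞ (fun g => κ'.hom (s.coord g)) g :=
  κ'.contMDiffAt_comp hρ
    ((s.contMDiffOn_coord hM).contMDiffAt ((s.isOpen_preimage hM).mem_nhds hg))

/-- The trivialization of the associated bundle over the domain of a section of `G → G / H`. -/
noncomputable def IsotropyLift.assocTriv (hρ : IsConnectedDoubleCover l ρ) (κ' : IsotropyLift H ρ)
    (hM : Manifold.IsSubmersion (𝓡 d) (𝓡 k) ∞ (QuotientGroup.mk : G → G ⧸ H))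
    (s : LocalSection d k H) : OpenPartialHomeomorph κ'.AssocBundle ((G ⧸ H) × Mp) where
  toFun := κ'.assocCoord s
  invFun y := κ'.cls (s.toFun y.1, y.2)
  source := κ'.assocProj ⁻¹' s.domain
  target := s.domain ×ˢ univ
  map_source' := by
    intro p hp
    obtain ⟨a, rfl⟩ := κ'.cls_surjective p
    exact ⟨hp, mem_univ _⟩
  map_target' := by
    intro y hy
    change QuotientGroup.mk (s.toFun y.1) ∈ s.domain
    rw [s.mk_toFun]
    exact hy.1
  left_inv' p _ := IsotropyLift.assocCoord_leftInverse s p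
  right_inv' y _ := IsotropyLift.assocCoord_rightInverse s y
  open_source := by
    have : IsTopologicalGroup G := topologicalGroup_of_lieGroup (𝓡 d) ∞
    have : IsTopologicalGroup Mp := topologicalGroup_of_lieGroup (𝓡 l) ∞
    rw [← κ'.isOpenQuotientMap_cls.isQuotientMap.isOpen_preimage]
    exact (s.isOpen_preimage hM).preimage continuous_fst
  open_target := s.isOpen_domain.prod isOpen_univ
  continuousOn_toFun := by
    have : IsTopologicalGroup G := topologicalGroup_of_lieGroup (𝓡 d) ∞
    have : IsTopologicalGroup Mp := topologicalGroup_of_lieGroup (𝓡 l) ∞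
    intro p hp
    obtain ⟨a, rfl⟩ := κ'.cls_surjective p
    refine ContinuousAt.continuousWithinAt ?_
    -- On `G × Mp` the trivialization is `(g, q) ↦ (gH, κ̃(h) q)` with `g = s(gH) h`, an explicit
    -- continuous map.
    rw [← κ'.isOpenQuotientMap_cls.continuousAt_comp_iff]
    have h1 : ContinuousAt (fun g => κ'.hom (s.coord g)) a.1 :=
      (κ'.contMDiffAt_hom_coord hρ s hM hp).continuousAt
    exact ((hM.contMDiff.continuous.comp continuous_fst).continuousAt).prodMk
      ((h1.comp continuousAt_fst).mul continuousAt_snd)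
  continuousOn_invFun := by
    have : IsTopologicalGroup G := topologicalGroup_of_lieGroup (𝓡 d) ∞
    have : IsTopologicalGroup Mp := topologicalGroup_of_lieGroup (𝓡 l) ∞
    refine κ'.isOpenQuotientMap_cls.continuous.comp_continuousOn ?_
    exact (s.smooth.continuousOn.comp continuousOn_fst fun y hy => hy.1).prodMk continuousOn_snd

/-- The transition is `(x, q) ↦ (x, κ̃(h(x)) q)`, where `s(x) = s'(x) h(x)`, and `κ̃` is smooth
along smooth maps to `H`. -/
theorem IsotropyLift.contMDiffOn_transition (hρ : IsConnectedDoubleCover l ρ)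
    (κ' : IsotropyLift H ρ)
    (hM : Manifold.IsSubmersion (𝓡 d) (𝓡 k) ∞ (QuotientGroup.mk : G → G ⧸ H))
    (s s' : LocalSection d k H) :
    ContMDiffOn ((𝓡 k).prod (𝓡 l)) ((𝓡 k).prod (𝓡 l)) ∞
      ((κ'.assocTriv hρ hM s).symm ≫ₕ κ'.assocTriv hρ hM s')
      ((κ'.assocTriv hρ hM s).symm ≫ₕ κ'.assocTriv hρ hM s').source := by
  intro y hy
  have hy1 : y.1 ∈ s.domain := hy.1.1
  have hy2 : QuotientGroup.mk (s.toFun y.1) ∈ s'.domain := hy.2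
  have h1 : ContMDiffAt (𝓡 k) (𝓡 d) ∞ s.toFun y.1 :=
    s.smooth.contMDiffAt (s.isOpen_domain.mem_nhds hy1)
  have h2 : ContMDiffAt (𝓡 k) (𝓡 l) ∞ (fun x => κ'.hom (s'.coord (s.toFun x))) y.1 :=
    (κ'.contMDiffAt_hom_coord hρ s' hM hy2).comp y.1 h1
  have h3 : ContMDiffAt ((𝓡 k).prod (𝓡 l)) ((𝓡 k).prod (𝓡 l)) ∞
      (fun z : (G ⧸ H) × Mp => (z.1, κ'.hom (s'.coord (s.toFun z.1)) * z.2)) y :=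
    contMDiffAt_fst.prodMk
      ((h2.comp y contMDiffAt_fst).mul contMDiffAt_snd)
  refine (h3.congr_of_eventuallyEq (Eventually.of_forall fun z => ?_)).contMDiffWithinAt
  change ((QuotientGroup.mk (s.toFun z.1) : G ⧸ H), _) = _
  rw [s.mk_toFun]

/-- The diffeomorphism `(g, q) ↦ (g, κ̃(h) q)`, `g = s(gH) h`. -/
noncomputable def IsotropyLift.shear (hρ : IsConnectedDoubleCover l ρ) (κ' : IsotropyLift H ρ)
    (hM : Manifold.IsSubmersion (𝓡 d) (𝓡 k) ∞ (QuotientGroup.mk : G → G ⧸ H))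
    (s : LocalSection d k H) : OpenPartialHomeomorph (G × Mp) (G × Mp) where
  toFun a := (a.1, κ'.hom (s.coord a.1) * a.2)
  invFun a := (a.1, (κ'.hom (s.coord a.1))⁻¹ * a.2)
  source := (QuotientGroup.mk ⁻¹' s.domain) ×ˢ univ
  target := (QuotientGroup.mk ⁻¹' s.domain) ×ˢ univ
  map_source' a ha := ⟨ha.1, mem_univ _⟩
  map_target' a ha := ⟨ha.1, mem_univ _⟩
  left_inv' a _ := by simp
  right_inv' a _ := by simp
  open_source := (s.isOpen_preimage hM).prod isOpen_univ
  open_target := (s.isOpen_preimage hM).prod isOpen_univ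
  continuousOn_toFun := by
    have : IsTopologicalGroup Mp := topologicalGroup_of_lieGroup (𝓡 l) ∞
    intro a ha
    have h1 : ContinuousAt (fun g => κ'.hom (s.coord g)) a.1 :=
      (κ'.contMDiffAt_hom_coord hρ s hM ha.1).continuousAt
    exact (continuousAt_fst.prodMk
      ((h1.comp continuousAt_fst).mul continuousAt_snd)).continuousWithinAt
  continuousOn_invFun := by
    have : IsTopologicalGroup Mp := topologicalGroup_of_lieGroup (𝓡 l) ∞
    intro a ha
    have h1 : ContinuousAt (fun g => κ'.hom (s.coord g)) a.1 :=
      (κ'.contMDiffAt_hom_coord hρ s hM ha.1).continuousAt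
    exact (continuousAt_fst.prodMk
      ((h1.comp continuousAt_fst).inv.mul continuousAt_snd)).continuousWithinAt

theorem IsotropyLift.contMDiffOn_shear (hρ : IsConnectedDoubleCover l ρ) (κ' : IsotropyLift H ρ)
    (hM : Manifold.IsSubmersion (𝓡 d) (𝓡 k) ∞ (QuotientGroup.mk : G → G ⧸ H))
    (s : LocalSection d k H) :
    ContMDiffOn ((𝓡 d).prod (𝓡 l)) ((𝓡 d).prod (𝓡 l)) ∞ (κ'.shear hρ hM s)
        (κ'.shear hρ hM s).source ∧
      ContMDiffOn ((𝓡 d).prod (𝓡 l)) ((𝓡 d).prod (𝓡 l)) ∞ (κ'.shear hρ hM s).symm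
        (κ'.shear hρ hM s).target := by
  constructor
  · intro a ha
    have h1 : ContMDiffAt ((𝓡 d).prod (𝓡 l)) (𝓡 l) ∞
        (fun b : G × Mp => κ'.hom (s.coord b.1)) a :=
      (κ'.contMDiffAt_hom_coord hρ s hM ha.1).comp a contMDiffAt_fst
    exact (contMDiffAt_fst.prodMk (h1.mul contMDiffAt_snd)).contMDiffWithinAt
  · intro a ha
    have h1 : ContMDiffAt ((𝓡 d).prod (𝓡 l)) (𝓡 l) ∞
        (fun b : G × Mp => κ'.hom (s.coord b.1)) a :=
      (κ'.contMDiffAt_hom_coord hρ s hM ha.1).comp a contMDiffAt_fst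
    exact (contMDiffAt_fst.prodMk (h1.inv.mul contMDiffAt_snd)).contMDiffWithinAt

variable [IsManifold (𝓡 k) ∞ (G ⧸ H)]

/-- The trivializations over local sections of `π` are glued to an atlas. In this atlas the quotient
map is a submersion, and smoothness of the frame map descends from `G × Mp`, where it is the frame
`[g, 1]` moved by `ρ(q)`. -/
theorem IsotropyLift.exists_constructs (hs : IsSymplecticSymmetric H m ω₀)
    (hM : Manifold.IsSubmersion (𝓡 d) (𝓡 k) ∞ (QuotientGroup.mk : G → G ⧸ H))
    (hρ : IsConnectedDoubleCover l ρ) (κ' : IsotropyLift H ρ) :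
    ∃ S : MetaplecticStructure (k := k) (l := l) (H := H) ρ, κ'.Constructs S := by
  have : IsManifold (𝓡 d) ∞ G := LieGroup.toContMDiffMul.toIsManifold
  have : IsManifold (𝓡 l) ∞ Mp := LieGroup.toContMDiffMul.toIsManifold
  choose s hsx using exists_localSection hM
  let Φ : κ'.AssocBundle → OpenPartialHomeomorph κ'.AssocBundle ((G ⧸ H) × Mp) :=
    fun p => κ'.assocTriv hρ hM (s (κ'.assocProj p))
  have hΦ : ∀ p, p ∈ (Φ p).source := fun p => hsx _
  have hc : ∀ p p', ContMDiffOn ((𝓡 k).prod (𝓡 l)) ((𝓡 k).prod (𝓡 l)) ∞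
      ((Φ p).symm ≫ₕ Φ p') ((Φ p).symm ≫ₕ Φ p').source :=
    fun p p' => κ'.contMDiffOn_transition hρ hM _ _
  let C : ChartedSpace (ModelProd (EuclideanSpace ℝ (Fin k)) (EuclideanSpace ℝ (Fin l)))
    κ'.AssocBundle := gluedChartedSpace Φ hΦ
  have hmfd : IsManifold ((𝓡 k).prod (𝓡 l)) ∞ κ'.AssocBundle := isManifold_glued hΦ hc
  have hglued := contMDiffOn_glued hΦ hc
  have hsub : Manifold.IsSubmersion ((𝓡 d).prod (𝓡 l)) ((𝓡 k).prod (𝓡 l)) ∞ κ'.cls := by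
    -- Over the domain of a section, the quotient map is the shear `(g, q) ↦ (g, κ̃(h) q)`, followed
    -- by `π × id` and by the inverse trivialization. The middle map is a submersion, the identity
    -- factor having a zero complement, and the outer two are local diffeomorphisms.
    have h0 := hM.isSubmersionOfComplement_complement.prodMap
      (Manifold.IsSubmersionOfComplement.id :
        Manifold.IsSubmersionOfComplement PUnit.{1} (𝓡 l) (𝓡 l) ∞ (@id Mp))
    refine Manifold.IsSubmersionOfComplement.isSubmersion (F := hM.complement × PUnit.{1}) fun a => ?_
    let p := κ'.cls a
    have h1 := isSubmersionAtOfComplement_comp_right (x := a)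
      (θ := κ'.shear hρ hM (s (κ'.assocProj p))) ⟨hsx _, mem_univ _⟩
      (κ'.contMDiffOn_shear hρ hM _).1 (κ'.contMDiffOn_shear hρ hM _).2 (h0 _)
    have h2 := isSubmersionAtOfComplement_comp_left (θ := (Φ p).symm) (x := a)
      ⟨hsx _, mem_univ _⟩ (hglued p).2 (hglued p).1 h1
    refine h2.congr_of_eventuallyEq (Eventually.of_forall fun b => ?_)
    exact IsotropyLift.assocCoord_leftInverse (s (κ'.assocProj p)) (κ'.cls b)
  have hframe : ∀ X : m, ContMDiff ((𝓡 k).prod (𝓡 l)) (𝓡 k).tangent ∞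
      (fun p => (κ'.assocFrame hs hM p).vec X) := by
    intro X
    refine contMDiff_of_comp_submersion hsub κ'.cls_surjective fun a => ?_
    exact SymplecticFrame.contMDiffAt_act (f := fun a : G × Mp => translateFrame hs hM a.1)
      (A := fun a => ρ a.2)
      (fun Y => (contMDiff_translateFrame hs hM Y).contMDiffAt.comp a contMDiffAt_fst)
      (hρ.contMDiff_spOp.contMDiffAt.comp a contMDiffAt_snd) X
  have hcont : Continuous κ'.cls := hsub.contMDiff.continuous
  let S : MetaplecticStructure (k := k) (l := l) (H := H) ρ :=
    { carrier := κ'.AssocBundle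
      top := inferInstance
      charted := C
      isManifold := by
        -- The bundle is modelled on the vector space `ℝ^k × ℝ^l`, and the charts are glued from the
        -- product manifold; the two models with corners coincide.
        rw [modelWithCornersSelf_prod]
        exact hmfd
      proj := κ'.assocProj
      act := κ'.assocAct
      act_one := fun p => by
        obtain ⟨a, rfl⟩ := κ'.cls_surjective p
        exact congrArg (fun q => κ'.cls (a.1, q)) (mul_one a.2)
      act_mul := fun p q q' => by
        obtain ⟨a, rfl⟩ := κ'.cls_surjective p
        exact congrArg (fun q => κ'.cls (a.1, q)) (mul_assoc a.2 q q').symm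
      locally_trivial := fun x => by
        rw [modelWithCornersSelf_prod]
        obtain ⟨g, rfl⟩ := QuotientGroup.mk_surjective x
        refine ⟨(s (QuotientGroup.mk g)).domain, Φ (κ'.cls (g, 1)), (s _).isOpen_domain, hsx _, rfl,
          rfl, (hglued _).1, (hglued _).2, fun p _ => ?_⟩
        obtain ⟨a, rfl⟩ := κ'.cls_surjective p
        exact ⟨rfl, fun q => ⟨rfl, Prod.ext rfl (mul_assoc _ _ _).symm⟩⟩
      frame := κ'.assocFrame hs hM
      frame_base := fun p => by
        obtain ⟨a, rfl⟩ := κ'.cls_surjective p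
        rfl
      frame_smooth := fun X => by
        rw [modelWithCornersSelf_prod]
        exact hframe X
      frame_act := fun p q => by
        obtain ⟨a, rfl⟩ := κ'.cls_surjective p
        change (translateFrame hs hM a.1).act (ρ (a.2 * q)) = _
        rw [map_mul, SymplecticFrame.act_mul]
        rfl }
  refine ⟨S, Homeomorph.refl _, ?_, fun g q => rfl, fun g q q' => rfl, fun g q X => rfl⟩
  rw [modelWithCornersSelf_prod]
  exact hsub

end AssocBundle

/-! ### Principal bundles: the action on fibres, sections, equivariant maps -/

namespace SmoothPrincipalBundle

variable {k l : ℕ} {M : Type*} [TopologicalSpace M] [ChartedSpace (EuclideanSpace ℝ (Fin k)) M]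
  {K : Type*} [TopologicalSpace K] [ChartedSpace (EuclideanSpace ℝ (Fin l)) K] [Group K]
  (P : SmoothPrincipalBundle k l M K)

theorem proj_act (p : P.carrier) (a : K) : P.proj (P.act p a) = P.proj p := by
  obtain ⟨U, Φ, -, hx, -, -, -, -, h⟩ := P.locally_trivial (P.proj p)
  exact ((h p hx).2 a).1

theorem act_right_injective (p : P.carrier) : Injective (P.act p) := by
  intro a b hab
  obtain ⟨U, Φ, -, hx, -, -, -, -, h⟩ := P.locally_trivial (P.proj p)
  have h1 := ((h p hx).2 a).2
  rw [hab, ((h p hx).2 b).2] at h1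
  exact (mul_left_cancel (congrArg Prod.snd h1)).symm

theorem exists_act_eq {p p' : P.carrier} (hp : P.proj p = P.proj p') : ∃ a, P.act p a = p' := by
  obtain ⟨U, Φ, -, hx, hs, -, -, -, h⟩ := P.locally_trivial (P.proj p)
  have hx' : P.proj p' ∈ U := hp ▸ hx
  refine ⟨(Φ p).2⁻¹ * (Φ p').2, Φ.injOn ?_ ?_ ?_⟩
  · rw [hs, mem_preimage, P.proj_act]
    exact hx
  · rw [hs]
    exact hx'
  · rw [((h p hx).2 _).2, mul_inv_cancel_left]
    exact Prod.ext ((h p hx).1.trans (hp.trans (h p' hx').1.symm)) rfl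

theorem contMDiff_proj :
    ContMDiff 𝓘(ℝ, EuclideanSpace ℝ (Fin k) × EuclideanSpace ℝ (Fin l)) (𝓡 k) ∞ P.proj := by
  intro p
  obtain ⟨U, Φ, -, hx, hs, -, hΦ, -, h⟩ := P.locally_trivial (P.proj p)
  have hp : Φ.source ∈ 𝓝 p := Φ.open_source.mem_nhds (by rw [hs]; exact hx)
  refine (contMDiffAt_fst.comp p (hΦ.contMDiffAt hp)).congr_of_eventuallyEq ?_
  filter_upwards [hp] with p' hp'
  rw [hs] at hp'
  exact ((h p' hp').1).symm

/-- In a local trivialization the action is right multiplication in the group factor. -/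
theorem contMDiffAt_act [LieGroup (𝓡 l) ∞ K] {E N H' : Type*} [NormedAddCommGroup E]
    [NormedSpace ℝ E] [TopologicalSpace H'] {I : ModelWithCorners ℝ E H'} [TopologicalSpace N]
    [ChartedSpace H' N] {f : N → P.carrier} {a : N → K} {x : N}
    (hf : ContMDiffAt I 𝓘(ℝ, EuclideanSpace ℝ (Fin k) × EuclideanSpace ℝ (Fin l)) ∞ f x)
    (ha : ContMDiffAt I (𝓡 l) ∞ a x) :
    ContMDiffAt I 𝓘(ℝ, EuclideanSpace ℝ (Fin k) × EuclideanSpace ℝ (Fin l)) ∞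
      (fun n => P.act (f n) (a n)) x := by
  obtain ⟨U, Φ, -, hx, hs, -, hΦ, hΦ', h⟩ := P.locally_trivial (P.proj (f x))
  have hp : Φ.source ∈ 𝓝 (f x) := Φ.open_source.mem_nhds (by rw [hs]; exact hx)
  have h1 : ContMDiffAt I ((𝓡 k).prod (𝓡 l)) ∞ (fun n => Φ (f n)) x :=
    (hΦ.contMDiffAt hp).comp x hf
  have h2 : ContMDiffAt I ((𝓡 k).prod (𝓡 l)) ∞ (fun n => ((Φ (f n)).1, (Φ (f n)).2 * a n)) x :=
    (contMDiffAt_fst.comp x h1).prodMk ((contMDiffAt_snd.comp x h1).mul ha)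
  have hact : ∀ p b, p ∈ Φ.source → P.act p b ∈ Φ.source ∧
      Φ (P.act p b) = ((Φ p).1, (Φ p).2 * b) := by
    intro p b hp
    have hp' : P.proj p ∈ U := by rwa [hs] at hp
    refine ⟨?_, ((h p hp').2 b).2⟩
    rw [hs, mem_preimage, P.proj_act]
    exact hp'
  have h3 : Φ.target ∈ 𝓝 ((Φ (f x)).1, (Φ (f x)).2 * a x) := by
    refine Φ.open_target.mem_nhds ?_
    rw [← (hact _ (a x) (mem_of_mem_nhds hp)).2]
    exact Φ.map_source (hact _ _ (mem_of_mem_nhds hp)).1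
  refine (ContMDiffAt.comp x (hΦ'.contMDiffAt h3) h2).congr_of_eventuallyEq ?_
  filter_upwards [hf.continuousAt.eventually hp] with n hn
  refine Eq.trans ?_ (congrArg Φ.symm (hact _ (a n) hn).2)
  exact (Φ.left_inv (hact _ _ hn).1).symm

/-- A principal bundle has local sections; every point over their domain is a translate of the
value of the section, by a smooth function. -/
theorem exists_section [LieGroup (𝓡 l) ∞ K] (x : M) :
    ∃ (U : Set M) (s : M → P.carrier) (δ : P.carrier → K), IsOpen U ∧ x ∈ U ∧
      ContMDiffOn (𝓡 k) 𝓘(ℝ, EuclideanSpace ℝ (Fin k) × EuclideanSpace ℝ (Fin l)) ∞ s U ∧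
      ContMDiffOn 𝓘(ℝ, EuclideanSpace ℝ (Fin k) × EuclideanSpace ℝ (Fin l)) (𝓡 l) ∞ δ
        (P.proj ⁻¹' U) ∧
      (∀ y ∈ U, P.proj (s y) = y) ∧ (∀ p, P.proj p ∈ U → P.act (s (P.proj p)) (δ p) = p) ∧
      ∀ p a, P.proj p ∈ U → δ (P.act p a) = δ p * a := by
  obtain ⟨U, Φ, hU, hx, hs, ht, hΦ, hΦ', h⟩ := P.locally_trivial x
  have hmem : ∀ y ∈ U, (y, (1 : K)) ∈ Φ.target := fun y hy => by
    rw [ht]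
    exact ⟨hy, mem_univ _⟩
  have hsrc : ∀ y ∈ U, P.proj (Φ.symm (y, 1)) ∈ U := fun y hy => by
    have := Φ.map_target (hmem y hy)
    rwa [hs] at this
  have hproj : ∀ y ∈ U, P.proj (Φ.symm (y, 1)) = y := fun y hy => by
    rw [← (h _ (hsrc y hy)).1, Φ.right_inv (hmem y hy)]
  refine ⟨U, fun y => Φ.symm (y, 1), fun p => (Φ p).2, hU, hx,
    hΦ'.comp (contMDiffOn_id.prodMk contMDiffOn_const) hmem, ?_, hproj, fun p hp => ?_,
    fun p a hp => ?_⟩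
  · rw [← hs]
    exact contMDiff_snd.comp_contMDiffOn hΦ
  · refine Φ.injOn ?_ ?_ ?_
    · rw [hs, mem_preimage, P.proj_act]
      exact hsrc _ hp
    · rw [hs]
      exact hp
    · rw [((h _ (hsrc _ hp)).2 _).2, Φ.right_inv (hmem _ hp), one_mul]
      exact Prod.ext (h p hp).1.symm rfl
  · exact congrArg Prod.snd ((h p hp).2 a).2

/-- A smooth equivariant map over the identity has a smooth inverse. -/
theorem contMDiff_symm_of_equivariant [LieGroup (𝓡 l) ∞ K] {Q : SmoothPrincipalBundle k l M K}
    (φ : P.carrier ≃ Q.carrier)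
    (hφ : ContMDiff 𝓘(ℝ, EuclideanSpace ℝ (Fin k) × EuclideanSpace ℝ (Fin l))
      𝓘(ℝ, EuclideanSpace ℝ (Fin k) × EuclideanSpace ℝ (Fin l)) ∞ φ)
    (hproj : ∀ p, Q.proj (φ p) = P.proj p) (hact : ∀ p a, φ (P.act p a) = Q.act (φ p) a) :
    ContMDiff 𝓘(ℝ, EuclideanSpace ℝ (Fin k) × EuclideanSpace ℝ (Fin l))
      𝓘(ℝ, EuclideanSpace ℝ (Fin k) × EuclideanSpace ℝ (Fin l)) ∞ φ.symm := by
  intro p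
  obtain ⟨U, s, -, hU, hx, hs, -, hps, -, -⟩ := P.exists_section (Q.proj p)
  obtain ⟨V, t, δ, hV, hy, ht, hδ, hpt, htδ, hδact⟩ := Q.exists_section (Q.proj p)
  have h1 : ContMDiffAt 𝓘(ℝ, EuclideanSpace ℝ (Fin k) × EuclideanSpace ℝ (Fin l))
      𝓘(ℝ, EuclideanSpace ℝ (Fin k) × EuclideanSpace ℝ (Fin l)) ∞ (fun p => s (Q.proj p)) p :=
    (hs.contMDiffAt (hU.mem_nhds hx)).comp p (Q.contMDiff_proj p)
  have hδ' : ∀ p, Q.proj p ∈ V → ContMDiffAt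
      𝓘(ℝ, EuclideanSpace ℝ (Fin k) × EuclideanSpace ℝ (Fin l)) (𝓡 l) ∞ δ p := fun p hp =>
    hδ.contMDiffAt ((hV.preimage Q.contMDiff_proj.continuous).mem_nhds hp)
  -- With `x = Q.proj p`, the points `φ (s x)` and `p` lie in one fibre of `Q` and differ by `δ (φ
  -- (s x))⁻¹ δ p`. By equivariance `φ⁻¹(p)` is `s x` moved by this element, which depends smoothly
  -- on `p`.
  have h2 : ContMDiffAt 𝓘(ℝ, EuclideanSpace ℝ (Fin k) × EuclideanSpace ℝ (Fin l)) (𝓡 l) ∞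
      (fun p => (δ (φ (s (Q.proj p))))⁻¹ * δ p) p := by
    refine ContMDiffAt.mul (ContMDiffAt.inv ?_) (hδ' p hy)
    refine (hδ' _ ?_).comp p (hφ.contMDiffAt.comp p h1)
    rw [hproj, hps _ hx]
    exact hy
  refine (P.contMDiffAt_act h1 h2).congr_of_eventuallyEq ?_
  filter_upwards [(hU.preimage Q.contMDiff_proj.continuous).mem_nhds hx,
    (hV.preimage Q.contMDiff_proj.continuous).mem_nhds hy] with p' hpU hpV
  rw [Equiv.symm_apply_eq, hact]
  have h3 : Q.proj (φ (s (Q.proj p'))) = Q.proj p' := by rw [hproj, hps _ hpU]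
  obtain ⟨a, ha⟩ := Q.exists_act_eq h3
  have h4 := hδact (φ (s (Q.proj p'))) a (by rw [h3]; exact hpV)
  rw [ha] at h4
  rw [h4, inv_mul_cancel_left, ha]

end SmoothPrincipalBundle

/-! ### Pullback of evenly covered neighbourhoods -/

section Covering

/-- The hypotheses say that over `U` the projection `S → X` is the pullback of `r` along `A`, with
`δ` and `c` as mutually inverse coordinates. A trivialization of `r` around `A x₀` then pulls back
to the part of `U` which `A` sends into its base. -/
theorem isEvenlyCovered_of_pullback {X P K Y : Type*} [TopologicalSpace X] [TopologicalSpace P]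
    [TopologicalSpace K] [TopologicalSpace Y] {r : K → Y} {A : X → Y} {x₀ : X} {I : Type*}
    [TopologicalSpace I] (hr : IsEvenlyCovered r (A x₀) I) (hne : ∃ q, r q = A x₀) {U : Set X}
    (hU : IsOpen U) (hx₀ : x₀ ∈ U) (hA : ∀ x ∈ U, ContinuousAt A x) {S : Set (X × P)}
    {δ : P → K} {c : X → K → P}
    (h₁ : ∀ a ∈ S, a.1 ∈ U → ContinuousAt δ a.2 ∧ r (δ a.2) = A a.1 ∧ c a.1 (δ a.2) = a.2)
    (h₂ : ∀ x q, x ∈ U → r q = A x → (x, c x q) ∈ S ∧ δ (c x q) = q ∧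
      ContinuousAt (fun a : X × K => c a.1 a.2) (x, q)) :
    IsEvenlyCovered (fun a : S => a.1.1) x₀ (r ⁻¹' {A x₀}) := by
  obtain ⟨q₀, hq₀⟩ := hne
  have hcov := hr.to_isEvenlyCovered_preimage
  have : Nonempty (r ⁻¹' {A x₀}) := ⟨⟨q₀, hq₀⟩⟩
  let t := hcov.toTrivialization
  have ht₀ : A x₀ ∈ t.baseSet := hcov.mem_toTrivialization_baseSet
  have hAU : ContinuousOn A U := fun x hx => (hA x hx).continuousWithinAt
  have hW : IsOpen (U ∩ A ⁻¹' t.baseSet) := hAU.isOpen_inter_preimage hU t.open_baseSet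
  have hfst : Continuous (fun a : S => a.1.1) := continuous_fst.comp continuous_subtype_val
  refine ⟨hcov.1, U ∩ A ⁻¹' t.baseSet, ⟨hx₀, ht₀⟩, hW, hW.preimage hfst,
    { toFun := fun a => (⟨a.1.1.1, a.2⟩, (t (δ a.1.1.2)).2)
      invFun := fun b : ↥(U ∩ A ⁻¹' t.baseSet) × (r ⁻¹' {A x₀}) =>
        ⟨⟨(b.1.1, c b.1.1 (t.toOpenPartialHomeomorph.symm (A b.1.1, b.2))),
          (h₂ b.1.1 (t.toOpenPartialHomeomorph.symm (A b.1.1, b.2)) b.1.2.1 (t.proj_symm_apply' b.1.2.2)).1⟩, b.1.2⟩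
      left_inv := ?_
      right_inv := ?_
      continuous_toFun := ?_
      continuous_invFun := ?_ }, fun a => rfl⟩
  · rintro ⟨⟨⟨x, p⟩, hp⟩, hx⟩
    obtain ⟨-, h3, h4⟩ := h₁ _ hp hx.1
    have h2 : t.toOpenPartialHomeomorph.symm (A x, (t (δ p)).2) = δ p := by
      rw [← h3]
      exact t.symm_apply_mk_proj (t.mem_source.mpr (by rw [h3]; exact hx.2))
    refine Subtype.ext (Subtype.ext (Prod.ext rfl ?_))
    change c x (t.toOpenPartialHomeomorph.symm (A x, (t (δ p)).2)) = p
    rw [h2]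
    exact h4
  · rintro ⟨⟨x, hx⟩, i⟩
    refine Prod.ext rfl ?_
    change (t (δ (c x (t.toOpenPartialHomeomorph.symm (A x, i))))).2 = i
    rw [(h₂ _ _ hx.1 (t.proj_symm_apply' hx.2)).2.1, t.apply_symm_apply' hx.2]
  · refine Continuous.prodMk ((hfst.comp continuous_subtype_val).subtype_mk _) ?_
    rw [continuous_iff_continuousAt]
    intro a
    obtain ⟨h3, h4, -⟩ := h₁ _ a.1.2 a.2.1
    have h5 : ContinuousAt t (δ a.1.1.2) := t.continuousOn_toFun.continuousAt
      (t.open_source.mem_nhds (t.mem_source.mpr (by rw [h4]; exact a.2.2)))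
    have h6 : ContinuousAt (fun a : (fun a : S => a.1.1) ⁻¹' (U ∩ A ⁻¹' t.baseSet) => a.1.1.2) a :=
      (continuous_snd.comp (continuous_subtype_val.comp continuous_subtype_val)).continuousAt
    exact continuousAt_snd.comp (ContinuousAt.comp (f := fun a : (fun a : S => a.1.1) ⁻¹'
      (U ∩ A ⁻¹' t.baseSet) => δ a.1.1.2) h5 (ContinuousAt.comp (g := δ) h3 h6))
  · refine Continuous.subtype_mk (Continuous.subtype_mk (Continuous.prodMk
      (continuous_subtype_val.comp continuous_fst) ?_) _) _
    rw [continuous_iff_continuousAt]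
    intro b
    have h3 : ContinuousAt (fun b : ↥(U ∩ A ⁻¹' t.baseSet) × (r ⁻¹' {A x₀}) => b.1.1) b :=
      (continuous_subtype_val.comp continuous_fst).continuousAt
    have h4 : ContinuousAt (fun b : ↥(U ∩ A ⁻¹' t.baseSet) × (r ⁻¹' {A x₀}) =>
        t.toOpenPartialHomeomorph.symm (A b.1.1, b.2)) b := by
      have h5 : ContinuousAt t.toOpenPartialHomeomorph.symm (A b.1.1, b.2) := t.continuousOn_invFun.continuousAt
        (t.open_target.mem_nhds (t.mem_target.mpr b.1.2.2))
      exact ContinuousAt.comp (g := t.toOpenPartialHomeomorph.symm) h5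
        ((ContinuousAt.comp (g := A) (f := fun b : ↥(U ∩ A ⁻¹' t.baseSet) × (r ⁻¹' {A x₀}) => b.1.1)
          (hA _ b.1.2.1) h3).prodMk continuousAt_snd)
    have h6 := (h₂ b.1.1 (t.toOpenPartialHomeomorph.symm (A b.1.1, b.2)) b.1.2.1
      (t.proj_symm_apply' b.1.2.2)).2.2
    exact ContinuousAt.comp (g := fun a : X × K => c a.1 a.2)
      (f := fun b : ↥(U ∩ A ⁻¹' t.baseSet) × (r ⁻¹' {A x₀}) =>
        (b.1.1, t.toOpenPartialHomeomorph.symm (A b.1.1, b.2))) h6 (h3.prodMk h4)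

end Covering

/-! ### Uniqueness of the lift of the isotropy representation -/

section Lifts

variable {d k l : ℕ} {G : Type*} [TopologicalSpace G]
  [ChartedSpace (EuclideanSpace ℝ (Fin d)) G] [Group G] {H : Subgroup G}
  {m : Submodule ℝ (LieAlg d G)} {ω₀ : LinearMap.BilinForm ℝ m}
  {Mp : Type*} [TopologicalSpace Mp] [ChartedSpace (EuclideanSpace ℝ (Fin l)) Mp] [Group Mp]
  {ρ : Mp →* Sp ω₀}

/-- The isotropy representation of a connected group has at most one lift. -/
theorem IsotropyLift.subsingleton (hH : IsConnected (H : Set G))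
    (hρ : IsConnectedDoubleCover l ρ) : Subsingleton (IsotropyLift H ρ) := by
  refine ⟨fun κ₁ κ₂ => ?_⟩
  have : ConnectedSpace H := isConnected_iff_connectedSpace.mp hH
  have h1 : ρ ∘ κ₁.hom = ρ ∘ κ₂.hom := by
    funext h
    refine Subtype.ext (Units.ext (ContinuousLinearMap.ext fun X => Subtype.ext ?_))
    exact (κ₁.lifts h X).trans (κ₂.lifts h X).symm
  have h2 := hρ.covering.eq_of_comp_eq κ₁.hom.continuous_toFun κ₂.hom.continuous_toFun h1 1
    ((map_one κ₁.hom).trans (map_one κ₂.hom).symm)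
  obtain ⟨κ₁, h₁⟩ := κ₁
  obtain ⟨κ₂, h₂⟩ := κ₂
  obtain rfl : κ₁ = κ₂ := DFunLike.coe_injective h2
  rfl

end Lifts

/-! ### The covering of `G` defined by a metaplectic structure -/

section FrameLift

variable {d k l : ℕ} {G : Type*} [TopologicalSpace G]
  [ChartedSpace (EuclideanSpace ℝ (Fin d)) G] [Group G] [LieGroup (𝓡 d) ∞ G] {H : Subgroup G}
  [ChartedSpace (EuclideanSpace ℝ (Fin k)) (G ⧸ H)] [IsManifold (𝓡 k) ∞ (G ⧸ H)]
  {m : Submodule ℝ (LieAlg d G)} {ω₀ : LinearMap.BilinForm ℝ m}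
  {Mp : Type*} [TopologicalSpace Mp] [ChartedSpace (EuclideanSpace ℝ (Fin l)) Mp] [Group Mp]
  {ρ : Mp →* Sp ω₀}
  (T : MetaplecticStructure (k := k) (l := l) (H := H) ρ)

theorem MetaplecticStructure.proj_eq_of_mem_frameLift {hs : IsSymplecticSymmetric H m ω₀}
    {hM : Manifold.IsSubmersion (𝓡 d) (𝓡 k) ∞ (QuotientGroup.mk : G → G ⧸ H)} {g : G}
    {p : T.carrier} (h : T.frame p = translateFrame hs hM g) : T.proj p = QuotientGroup.mk g := by
  rw [← T.frame_base, h]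
  rfl

variable [LieGroup (𝓡 l) ∞ Mp]

/-- A local section of the bundle, composed with `π`, gives points `b(g)` over `gH`. Their frames
differ from `[g, 1]` by a smooth `A(g)`, and `δ` is the group coordinate relative to `b`. In these
terms `F(p) = [g, 1]` becomes `p = b(g) q` with `ρ(q) = A(g)`. -/
theorem MetaplecticStructure.exists_frame_section (hs : IsSymplecticSymmetric H m ω₀)
    (hM : Manifold.IsSubmersion (𝓡 d) (𝓡 k) ∞ (QuotientGroup.mk : G → G ⧸ H)) (g₀ : G) :
    ∃ (U : Set G) (b : G → T.carrier) (A : G → Sp ω₀) (δ : T.carrier → Mp), IsOpen U ∧ g₀ ∈ U ∧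
      ContMDiffOn (𝓡 d) 𝓘(ℝ, EuclideanSpace ℝ (Fin k) × EuclideanSpace ℝ (Fin l)) ∞ b U ∧
      (∀ g ∈ U, ContMDiffAt (𝓡 d) 𝓘(ℝ, modelSubspace m →L[ℝ] modelSubspace m) ∞
        (fun g => spOp ω₀ (A g)) g) ∧
      (∀ g ∈ U, (T.frame (b g)).act (A g) = translateFrame hs hM g) ∧
      (∀ g p, g ∈ U → T.proj p = QuotientGroup.mk g → ContinuousAt δ p ∧ T.act (b g) (δ p) = p) ∧
      ∀ g q, g ∈ U → δ (T.act (b g) q) = q := by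
  classical
  obtain ⟨U, s, δ, hU, hx, hsm, hδ, hps, hsδ, hδact⟩ :=
    T.toSmoothPrincipalBundle.exists_section (QuotientGroup.mk g₀)
  have hbase : ∀ g, QuotientGroup.mk g ∈ U →
      (T.frame (s (QuotientGroup.mk g))).base = (translateFrame hs hM g).base := by
    intro g hg
    rw [T.frame_base, hps _ hg]
    rfl
  -- Off the domain of the section the frames may have different base points, and `A` takes the
  -- irrelevant value `1`.
  have hA : ∀ g, ∃ A : Sp ω₀, QuotientGroup.mk g ∈ U →
      (T.frame (s (QuotientGroup.mk g))).act A = translateFrame hs hM g := by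
    intro g
    by_cases hg : QuotientGroup.mk g ∈ U
    · obtain ⟨A, hA⟩ := SymplecticFrame.exists_act_eq _ _ (hbase g hg)
      exact ⟨A, fun _ => hA⟩
    · exact ⟨1, fun h => absurd h hg⟩
  choose A hA using hA
  have hUo : IsOpen ((QuotientGroup.mk : G → G ⧸ H) ⁻¹' U) := hU.preimage hM.contMDiff.continuous
  have hb : ContMDiffOn (𝓡 d) 𝓘(ℝ, EuclideanSpace ℝ (Fin k) × EuclideanSpace ℝ (Fin l)) ∞
      (fun g : G => s (QuotientGroup.mk g)) (QuotientGroup.mk ⁻¹' U) :=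
    hsm.comp hM.contMDiff.contMDiffOn fun _ hg => hg
  have hδ1 : ∀ y ∈ U, δ (s y) = 1 := by
    intro y hy
    have h1 := hsδ (s y) (by rw [hps y hy]; exact hy)
    rw [hps y hy] at h1
    exact T.act_right_injective (s y) (h1.trans (T.act_one _).symm)
  refine ⟨QuotientGroup.mk ⁻¹' U, fun g => s (QuotientGroup.mk g), A, δ, hUo, hx, hb,
    fun g hg => ?_, fun g hg => hA g hg, fun g p hg hp => ⟨?_, ?_⟩, fun g q hg => ?_⟩
  · refine SymplecticFrame.contMDiffAt_of_act_eq
      (f := fun g => T.frame (s (QuotientGroup.mk g))) (f' := translateFrame hs hM)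
      (fun X => (T.frame_smooth X).contMDiffAt.comp g (hb.contMDiffAt (hUo.mem_nhds hg)))
      (fun X => contMDiff_translateFrame hs hM X g) ?_
    filter_upwards [hUo.mem_nhds hg] with g' hg' using hA g' hg'
  · refine (hδ.contMDiffAt ((hU.preimage T.contMDiff_proj.continuous).mem_nhds ?_)).continuousAt
    rw [mem_preimage, hp]
    exact hg
  · have h1 := hsδ p (by rw [hp]; exact hg)
    rwa [hp] at h1
  · rw [hδact _ _ (by rw [hps _ hg]; exact hg), hδ1 _ hg, one_mul]

/-- The points of a metaplectic structure over the frames `[g, 1]`. -/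
def MetaplecticStructure.frameLift (hs : IsSymplecticSymmetric H m ω₀)
    (hM : Manifold.IsSubmersion (𝓡 d) (𝓡 k) ∞ (QuotientGroup.mk : G → G ⧸ H)) :
    Set (G × T.carrier) :=
  {a | T.frame a.2 = translateFrame hs hM a.1}

/-- Locally the points over `[g, 1]` are `b(g) q` with `ρ(q) = A(g)`, so the space is the pullback
of the covering `ρ` along the continuous map `A`. -/
theorem MetaplecticStructure.isCoveringMap_frameLift (hs : IsSymplecticSymmetric H m ω₀)
    (hM : Manifold.IsSubmersion (𝓡 d) (𝓡 k) ∞ (QuotientGroup.mk : G → G ⧸ H))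
    (hρ : IsConnectedDoubleCover l ρ) :
    IsCoveringMap (fun a : T.frameLift hs hM => a.1.1) := by
  intro g₀
  obtain ⟨U, b, A, δ, hU, hg₀, hb, hAs, hA, hδ, hδb⟩ := T.exists_frame_section hs hM g₀
  have hAc : ∀ g ∈ U, ContinuousAt A g := fun g hg => continuousAt_sp (hAs g hg).continuousAt
  refine (isEvenlyCovered_of_pullback (hρ.covering (A g₀)) (hρ.surjective (A g₀)) hU hg₀ hAc
    (δ := δ) (c := fun g q => T.act (b g) q) (fun a ha haU => ?_)
    (fun g q hg hq => ?_)).to_isEvenlyCovered_preimage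
  · have h1 := hδ _ _ haU (T.proj_eq_of_mem_frameLift ha)
    refine ⟨h1.1, ?_, h1.2⟩
    apply (T.frame (b a.1)).act_injective
    rw [← T.frame_act, h1.2, hA _ haU]
    exact ha
  · refine ⟨?_, hδb _ _ hg, ?_⟩
    · change T.frame (T.act (b g) q) = translateFrame hs hM g
      rw [T.frame_act, hq, hA g hg]
    · exact (T.contMDiffAt_act (f := fun a : G × Mp => b a.1) (a := fun a => a.2) (x := (g, q))
        (I := (𝓡 d).prod (𝓡 l)) ((hb.contMDiffAt (hU.mem_nhds hg)).comp (g, q) contMDiffAt_fst)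
        contMDiffAt_snd).continuousAt

end FrameLift

/-! ### Every metaplectic structure comes from a lift -/

section Classification

variable {d k l : ℕ} {G : Type*} [TopologicalSpace G]
  [ChartedSpace (EuclideanSpace ℝ (Fin d)) G] [Group G] [LieGroup (𝓡 d) ∞ G]
  {H : Subgroup G}
  [ChartedSpace (EuclideanSpace ℝ (Fin k)) (G ⧸ H)] [IsManifold (𝓡 k) ∞ (G ⧸ H)]
  {m : Submodule ℝ (LieAlg d G)} {ω₀ : LinearMap.BilinForm ℝ m}
  {Mp : Type*} [TopologicalSpace Mp] [ChartedSpace (EuclideanSpace ℝ (Fin l)) Mp] [Group Mp]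
  [LieGroup (𝓡 l) ∞ Mp] {ρ : Mp →* Sp ω₀}
  (T : MetaplecticStructure (k := k) (l := l) (H := H) ρ)

/-- The map `g ↦ [g, 1]` lifts to every metaplectic structure. -/
theorem MetaplecticStructure.exists_lift_translateFrame [SimplyConnectedSpace G]
    (hs : IsSymplecticSymmetric H m ω₀)
    (hM : Manifold.IsSubmersion (𝓡 d) (𝓡 k) ∞ (QuotientGroup.mk : G → G ⧸ H))
    (hρ : IsConnectedDoubleCover l ρ) :
    ∃ τ : G → T.carrier, Continuous τ ∧ ∀ g, T.frame (τ g) = translateFrame hs hM g := by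
  have : LocallyPathConnectedSpace G :=
    ChartedSpace.locallyPathConnectedSpace (EuclideanSpace ℝ (Fin d)) G
  obtain ⟨U, b, A, δ, -, hg, -, -, hA, -, -⟩ := T.exists_frame_section hs hM (1 : G)
  obtain ⟨q, hq⟩ := hρ.surjective (A 1)
  have h0 : ((1 : G), T.act (b 1) q) ∈ T.frameLift hs hM := by
    change T.frame (T.act (b 1) q) = _
    rw [T.frame_act, hq, hA 1 hg]
  -- The identity of the simply connected group `G` lifts through the covering, starting at a point
  -- over `1`; the second component of the lift is `τ`.
  obtain ⟨F, ⟨-, hF⟩, -⟩ := (T.isCoveringMap_frameLift hs hM hρ).existsUnique_continuousMap_lifts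
    (ContinuousMap.id G) 1 ⟨_, h0⟩ rfl
  refine ⟨fun g => (F g).1.2, (continuous_snd.comp continuous_subtype_val).comp F.continuous,
    fun g => ?_⟩
  have h1 : T.frame (F g).1.2 = translateFrame hs hM (F g).1.1 := (F g).2
  have h2 : (F g).1.1 = g := congrFun hF g
  rw [h1, h2]

variable {T} {hs : IsSymplecticSymmetric H m ω₀}
  {hM : Manifold.IsSubmersion (𝓡 d) (𝓡 k) ∞ (QuotientGroup.mk : G → G ⧸ H)}
  {τ : G → T.carrier}

/-- Locally `τ(g) = b(g) q(g)` with `q` continuous and `ρ(q(g)) = A(g)` smooth, and a continuous map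
to `Mp` is smooth once its image under `ρ` is. -/
theorem MetaplecticStructure.contMDiff_lift (hτ : Continuous τ)
    (hfτ : ∀ g, T.frame (τ g) = translateFrame hs hM g) (hρ : IsConnectedDoubleCover l ρ) :
    ContMDiff (𝓡 d) 𝓘(ℝ, EuclideanSpace ℝ (Fin k) × EuclideanSpace ℝ (Fin l)) ∞ τ := by
  intro g₀
  obtain ⟨U, b, A, δ, hU, hg₀, hb, hAs, hA, hδ, -⟩ := T.exists_frame_section hs hM g₀
  have h1 : ContMDiffAt (𝓡 d) (𝓡 l) ∞ (fun g => δ (τ g)) g₀ := by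
    refine hρ.contMDiffAt ?_ ((hAs g₀ hg₀).congr_of_eventuallyEq ?_)
    · exact ContinuousAt.comp (hδ _ _ hg₀ (T.proj_eq_of_mem_frameLift (hfτ g₀))).1 hτ.continuousAt
    · filter_upwards [hU.mem_nhds hg₀] with g hg
      congr 1
      apply (T.frame (b g)).act_injective
      rw [← T.frame_act, (hδ _ _ hg (T.proj_eq_of_mem_frameLift (hfτ g))).2, hA _ hg, hfτ]
  refine (T.contMDiffAt_act (hb.contMDiffAt (hU.mem_nhds hg₀)) h1).congr_of_eventuallyEq ?_
  filter_upwards [hU.mem_nhds hg₀] with g hg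
  exact (hδ _ _ hg (T.proj_eq_of_mem_frameLift (hfτ g))).2.symm

/-- `κ̃(h)` is the element that moves `τ(1)` to `τ(h)`. Comparison of frames gives `ρ(κ̃(h)) =
κ(h)`, and uniqueness of lifts extends `τ(gh) = τ(g) κ̃(h)` from `g = 1` to all `g`, which contains
the homomorphism property. -/
theorem MetaplecticStructure.exists_isotropyLift [SimplyConnectedSpace G]
    (hτ : Continuous τ)
    (hfτ : ∀ g, T.frame (τ g) = translateFrame hs hM g) (hρ : IsConnectedDoubleCover l ρ) :
    ∃ κ' : IsotropyLift H ρ, ∀ (g : G) (h : H), τ (g * h) = T.act (τ g) (κ'.hom h) := by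
  have hG : IsTopologicalGroup G := topologicalGroup_of_lieGroup (𝓡 d) ∞
  have hK : IsTopologicalGroup Mp := topologicalGroup_of_lieGroup (𝓡 l) ∞
  have hex : ∀ h : H, ∃ q : Mp, T.act (τ 1) q = τ h := fun h =>
    T.toSmoothPrincipalBundle.exists_act_eq (by
      rw [T.proj_eq_of_mem_frameLift (hfτ _), T.proj_eq_of_mem_frameLift (hfτ _)]
      simpa using (mk_mul_mem (1 : G) h).symm)
  choose κ hκ using hex
  have hlift : ∀ (h : H) (X : m), ((ρ (κ h)).1.1 X).1 = adjoint (h : G) X.1 := by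
    intro h
    rw [← translateFrame_act_iff hs hM (g := 1) h.2, one_mul, ← hfτ, ← hfτ,
      ← T.frame_act, hκ]
  have hmul : ∀ (g : G) (h : H), τ (g * h) = T.act (τ g) (κ h) := by
    intro g h
    -- Two lifts of `g ↦ gh` to the covering, which agree at `g = 1`; `G` is connected.
    let F₁ : G → T.frameLift hs hM := fun g => ⟨(g * h, τ (g * h)), hfτ _⟩
    let F₂ : G → T.frameLift hs hM := fun g => ⟨(g * h, T.act (τ g) (κ h)), by
      change T.frame _ = _
      rw [T.frame_act, hfτ]
      exact (translateFrame_act_iff hs hM h.2 _).mpr (hlift h)⟩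
    have hF₁ : Continuous F₁ := ((continuous_mul_const (h : G)).prodMk
      (hτ.comp (continuous_mul_const (h : G)))).subtype_mk _
    have hc : Continuous (fun p => T.act p (κ h)) := (show ContMDiff _ _ _ _ from
      fun p => T.contMDiffAt_act (a := fun _ => κ h) contMDiffAt_id contMDiffAt_const).continuous
    have hF₂ : Continuous F₂ := ((continuous_mul_const (h : G)).prodMk
      (hc.comp hτ)).subtype_mk _
    have h1 := (T.isCoveringMap_frameLift hs hM hρ).eq_of_comp_eq hF₁ hF₂ rfl 1
      (Subtype.ext (Prod.ext rfl (by
        change τ (1 * h) = T.act (τ 1) (κ h)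
        rw [one_mul, hκ])))
    exact congrArg (fun a => a.1.2) (congrFun h1 g)
  have hκmul : ∀ h h' : H, κ (h * h') = κ h * κ h' := by
    intro h h'
    apply T.act_right_injective (τ 1)
    rw [hκ, T.act_mul, hκ, ← hmul]
    rfl
  have hκ1 : κ 1 = 1 := by
    have := hκmul 1 1
    rwa [one_mul, left_eq_mul] at this
  have hκc : Continuous κ := by
    obtain ⟨U, b, A, δ, hU, hg₀, -, -, hA, hδ, hδb⟩ := T.exists_frame_section hs hM (1 : G)
    have hproj : ∀ h : H, T.proj (τ h) = QuotientGroup.mk (1 : G) := by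
      intro h
      rw [T.proj_eq_of_mem_frameLift (hfτ _)]
      simpa using mk_mul_mem (1 : G) h
    -- All `τ(h)` lie in the fibre over the base point, so a single trivialization expresses `κ̃` by
    -- the continuous coordinate `δ`.
    have h1 : ∀ h, κ h = (δ (τ 1))⁻¹ * δ (τ h) := by
      intro h
      have h2 := (hδ 1 _ hg₀ (hproj 1)).2
      rw [eq_inv_mul_iff_mul_eq, ← hδb 1 (δ (τ 1) * κ h) hg₀, T.act_mul]
      rw [OneMemClass.coe_one] at h2
      rw [h2, hκ]
    rw [funext h1]
    refine continuous_const.mul (continuous_iff_continuousAt.mpr fun h => ?_)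
    exact ContinuousAt.comp (g := δ) (f := fun h : H => τ h) (hδ 1 _ hg₀ (hproj h)).1
      (hτ.comp continuous_subtype_val).continuousAt
  exact ⟨⟨⟨⟨⟨κ, hκ1⟩, hκmul⟩, hκc⟩, hlift⟩, hmul⟩

/-- The isomorphism is `[g, q] ↦ τ(g) q`. It respects the equivalence relation because of `τ(gh) =
τ(g) κ̃(h)`, it is bijective because `Mp` acts simply transitively on the fibres, and it is smooth
because it is smooth on `G × Mp`, which submerses onto the source. -/
theorem IsotropyLift.Constructs.isomorphic (hτ : Continuous τ)
    (hfτ : ∀ g, T.frame (τ g) = translateFrame hs hM g) (hρ : IsConnectedDoubleCover l ρ)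
    {κ' : IsotropyLift H ρ} (hκ' : ∀ (g : G) (h : H), τ (g * h) = T.act (τ g) (κ'.hom h))
    {S : MetaplecticStructure (k := k) (l := l) (H := H) ρ} (hS : κ'.Constructs S) :
    S.Isomorphic T := by
  obtain ⟨e, hsub, hproj, hact, hframe⟩ := hS
  let ψ : κ'.AssocBundle → T.carrier := Quotient.lift (fun a : G × Mp => T.act (τ a.1) a.2) (by
    rintro a b ⟨h, rfl⟩
    dsimp only
    rw [hκ', ← T.act_mul, mul_inv_cancel_left])
  have hψ : ∀ g q, ψ (κ'.cls (g, q)) = T.act (τ g) q := fun g q => rfl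
  have hprojτ : ∀ g, T.proj (τ g) = QuotientGroup.mk g := fun g =>
    T.proj_eq_of_mem_frameLift (hfτ g)
  have hbij : Bijective ψ := by
    constructor
    · intro p p' hpp
      obtain ⟨⟨g, q⟩, rfl⟩ := κ'.cls_surjective p
      obtain ⟨⟨g', q'⟩, rfl⟩ := κ'.cls_surjective p'
      rw [hψ, hψ] at hpp
      have h1 := congrArg T.proj hpp
      rw [T.proj_act, T.proj_act, hprojτ, hprojτ] at h1
      -- Equal images lie over the same coset, so `g'` differs from `g` by an element of `H`, and
      -- freeness of the action then determines `q`.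
      obtain ⟨h, rfl⟩ : ∃ h : H, g' = g * h := ⟨⟨_, QuotientGroup.eq.mp h1⟩, by simp⟩
      rw [hκ', ← T.act_mul] at hpp
      rw [κ'.cls_eq, T.act_right_injective _ hpp]
    · intro p
      obtain ⟨g, hg⟩ := QuotientGroup.mk_surjective (T.proj p)
      obtain ⟨q, hq⟩ := T.toSmoothPrincipalBundle.exists_act_eq ((hprojτ g).trans hg)
      exact ⟨κ'.cls (g, q), hq⟩
  let φ : S.carrier ≃ T.carrier := e.symm.toEquiv.trans (Equiv.ofBijective ψ hbij)
  have hφ : ∀ g q, φ (e (κ'.cls (g, q))) = T.act (τ g) q := by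
    intro g q
    change ψ (e.symm (e (κ'.cls (g, q)))) = _
    rw [e.symm_apply_apply]
    exact hψ g q
  have hsurj : Surjective (fun a : G × Mp => e (κ'.cls a)) := e.surjective.comp κ'.cls_surjective
  have hφs : ContMDiff 𝓘(ℝ, EuclideanSpace ℝ (Fin k) × EuclideanSpace ℝ (Fin l))
      𝓘(ℝ, EuclideanSpace ℝ (Fin k) × EuclideanSpace ℝ (Fin l)) ∞ φ := by
    refine contMDiff_of_comp_submersion hsub hsurj fun a => ?_
    have h1 := T.contMDiffAt_act (f := fun a : G × Mp => τ a.1) (a := fun a => a.2) (x := a)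
      ((MetaplecticStructure.contMDiff_lift hτ hfτ hρ).contMDiffAt.comp a
        contMDiffAt_fst) contMDiffAt_snd
    exact h1.congr_of_eventuallyEq (Eventually.of_forall fun b => hφ b.1 b.2)
  have hφp : ∀ p, T.proj (φ p) = S.proj p := by
    intro p
    obtain ⟨⟨g, q⟩, rfl⟩ := hsurj p
    dsimp only
    rw [hφ, hproj, T.proj_act, hprojτ]
  have hφa : ∀ p q, φ (S.act p q) = T.act (φ p) q := by
    intro p q'
    obtain ⟨⟨g, q⟩, rfl⟩ := hsurj p
    dsimp only
    rw [hφ, hact, hφ, T.act_mul]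
  refine ⟨⟨φ, hφs, SmoothPrincipalBundle.contMDiff_symm_of_equivariant
    (P := S.toSmoothPrincipalBundle) (Q := T.toSmoothPrincipalBundle) φ hφs hφp hφa⟩, hφp, hφa,
    fun p => ?_⟩
  obtain ⟨⟨g, q⟩, rfl⟩ := hsurj p
  change T.frame (φ (e (κ'.cls (g, q)))) = S.frame (e (κ'.cls (g, q)))
  rw [hφ, T.frame_act, hfτ]
  refine SymplecticFrame.ext_vec ?_ fun X => ?_
  · rw [S.frame_base, hproj]
    rfl
  · rw [hframe]
    rfl

end Classification

end MetaplecticSymmetric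

/-- The mapping to isomorphism classes is expressed by an arbitrary choice `P` of structures
constructed from the lifts, and bijectivity is proved for each such choice. -/
theorem mainTheorem11 {d k l : ℕ}
    {G : Type*} [TopologicalSpace G] [ChartedSpace (EuclideanSpace ℝ (Fin d)) G] [Group G]
    [LieGroup (𝓡 d) ∞ G] [SimplyConnectedSpace G]
    (H : Subgroup G) (m : Submodule ℝ (MetaplecticSymmetric.LieAlg d G))
    (ω₀ : LinearMap.BilinForm ℝ m)
    (hsymm : MetaplecticSymmetric.IsSymplecticSymmetric H m ω₀)
    [ChartedSpace (EuclideanSpace ℝ (Fin k)) (G ⧸ H)] [IsManifold (𝓡 k) ∞ (G ⧸ H)]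
    (hM : Manifold.IsSubmersion (𝓡 d) (𝓡 k) ∞ (QuotientGroup.mk : G → G ⧸ H))
    {Mp : Type*} [TopologicalSpace Mp] [ChartedSpace (EuclideanSpace ℝ (Fin l)) Mp] [Group Mp]
    [LieGroup (𝓡 l) ∞ Mp]
    (ρ : Mp →* MetaplecticSymmetric.Sp ω₀)
    (hρ : MetaplecticSymmetric.IsConnectedDoubleCover l ρ) :
    (∀ κ' : MetaplecticSymmetric.IsotropyLift H ρ,
      ∃ S : MetaplecticSymmetric.MetaplecticStructure (k := k) (l := l) (H := H) ρ,
        MetaplecticSymmetric.IsotropyLift.Constructs κ' S) ∧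
    ∀ P : MetaplecticSymmetric.IsotropyLift H ρ →
        MetaplecticSymmetric.MetaplecticStructure (k := k) (l := l) (H := H) ρ,
      (∀ κ', MetaplecticSymmetric.IsotropyLift.Constructs κ' (P κ')) →
      Function.Bijective (fun κ' =>
        (Quotient.mk _ (P κ') :
          MetaplecticSymmetric.MetaplecticStructure.IsoClass (k := k) (l := l) H ρ)) := by
  refine ⟨fun κ' => κ'.exists_constructs hsymm hM hρ, fun P hP => ⟨?_, ?_⟩⟩
  · have := MetaplecticSymmetric.IsotropyLift.subsingleton hsymm.isConnected hρ
    exact Function.injective_of_subsingleton _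
  · rintro ⟨T⟩
    obtain ⟨τ, hτ, hfτ⟩ := T.exists_lift_translateFrame hsymm hM hρ
    obtain ⟨κ', hκ'⟩ :=
      MetaplecticSymmetric.MetaplecticStructure.exists_isotropyLift hτ hfτ hρ
    exact ⟨κ', Quotient.sound ((hP κ').isomorphic hτ hfτ hρ hκ')⟩
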